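/- Let $d_1,d_2\ge 1$, $d=(d_1+d_2)/2$, and let $\Theta^*\in\mathbb R^{d_1\times d_2}$ have all row sums equal to zero. Let $\alpha=\max_{i,j_1,j_2}|\Theta^*_{ij_1}-\Theta^*_{ij_2}|$ be its dynamic range, let $\sigma_1(A)\ge\sigma_2(A)\ge\cdots$ denote the singular values of a matrix $A$, and let $\|A\|_{\rm nuc}=\sum_j\sigma_j(A)$ be its nuclear norm and $\|A\|_F$ its Frobenius norm. Sampling model. Independently for each user $i\in\{1,\dots,d_1\}$, items $j_{i,1},\dots,j_{i,k}$ are drawn independently and uniformly, with replacement, from $\{1,\dots,d_2\}$. Given these items, user $i$ ranks the $k$ slots (copies of the same item being treated as distinct items of equal weight) according to the multinomial logit (MNL) model: the ranking that is the permutation $\pi$ of $\{1,\dots,k\}$, with slot $\pi(\ell)$ in position $\ell$, has probability $$\prod_{\ell=1}^k \frac{\exp(\Theta^*_{i,j_{i,\pi(\ell)}})}{\sum_{m=\ell}^k\exp(\Theta^*_{i,j_{i,\pi(m)}})} .$$ One observes the ranked lists $v_{i,\ell}=j_{i,\pi_i(\ell)}$, where $\pi_i$ is the ranking of user $i$. Estimator.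 Let $$\mathcal L(\Theta)=-\frac1{kd_1}\sum_{i=1}^{d_1}\sum_{\ell=1}^k\Big(\Theta_{i,v_{i,\ell}}-\log\sum_{m=\ell}^k\exp(\Theta_{i,v_{i,m}})\Big),$$ $$\Omega_\alpha=\Big\{A\in\mathbb R^{d_1\times d_2}:\ |A_{ij}|\le\alpha \text{ for all } i,j,\ \text{ and } \sum_{j}A_{ij}=0\text{ for all } i\Big\},$$ and consider the minimizers $\widehat\Theta\in\arg\min_{\Theta\in\Omega_\alpha}\ \mathcal L(\Theta)+\lambda\|\Theta\|_{\rm nuc}$. Define $$\lambda_0=e^{2\alpha}\sqrt{\frac{d_1\log d+d_2(\log d)^2}{k\,d_1^2\,d_2}} .$$ Theorem. Assume $24\le k\le\min\{d_1^2,\,(d_1^2+d_2^2)/(2d_1)\}\,\log d$, let $c_0>32$ and $\lambda\in[32\lambda_0,\,c_0\lambda_0]$. Then with probability at least $1-2d^{-3}$, a minimizer exists and every minimizer $\widehat\Theta$ satisfies, for every $r\in\{1,\dots,\min\{d_1,d_2\}\}$, $$\frac{1}{d_1d_2}\|\widehat\Theta-\Theta^*\|_F^2\ \le\ 288\sqrt2\,e^{4\alpha}c_0\lambda_0\sqrt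 r\,\|\widehat\Theta-\Theta^*\|_F+288\,e^{4\alpha}c_0\lambda_0\sum_{j=r+1}^{\min\{d_1,d_2\}}\sigma_j(\Theta^*).$$ -/

import Mathlib

open MeasureTheory
open scoped BigOperators

noncomputable section

namespace MNLRanking

/-! ### Matrix norms -/

/-- The Frobenius norm of a real matrix. -/
def frobNorm {d₁ d₂ : ℕ} (A : Matrix (Fin d₁) (Fin d₂) ℝ) : ℝ :=
  @norm _ Matrix.frobeniusNormedAddCommGroup.toNorm A

/-- The Frobenius norm is the square root of the sum of the squared entries. -/
theorem frobNorm_eq_sqrt {d₁ d₂ : ℕ} (A : Matrix (Fin d₁) (Fin d₂) ℝ) :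
    frobNorm A = Real.sqrt (∑ i, ∑ j, A i j ^ 2) := by
  unfold frobNorm
  rw [Matrix.frobenius_norm_def, Real.sqrt_eq_rpow]
  simp

/-- The singular values of a real matrix in decreasing order (with multiplicity), indexed from
zero: `singVal A j` is the `(j+1)`-st largest singular value, and it is zero once
`min d₁ d₂ ≤ j`. -/
def singVal {d₁ d₂ : ℕ} (A : Matrix (Fin d₁) (Fin d₂) ℝ) (j : ℕ) : ℝ :=
  (Matrix.toEuclideanLin A).singularValues j

/-- The nuclear norm: the sum of the singular values. -/
def nuclearNorm {d₁ d₂ : ℕ} (A : Matrix (Fin d₁) (Fin d₂) ℝ) : ℝ :=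
  ∑ j ∈ Finset.range (min d₁ d₂), singVal A j

/-! ### The MNL distribution of a ranking -/

/-- The MNL (Plackett-Luce) probability of the ranking `σ` of `k` slots with utilities `w`:
`σ ℓ` is the slot ranked at position `ℓ`, and it is chosen among the slots that have not
been ranked before, which are the slots `σ m` with `ℓ ≤ m`. -/
def rankProb {k : ℕ} (w : Fin k → ℝ) (σ : Equiv.Perm (Fin k)) : ℝ :=
  ∏ ℓ, Real.exp (w (σ ℓ)) / ∑ m ∈ Finset.Ici ℓ, Real.exp (w (σ m))

theorem rankProb_nonneg {k : ℕ} (w : Fin k → ℝ) (σ : Equiv.Perm (Fin k)) :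
    0 ≤ rankProb w σ :=
  Finset.prod_nonneg fun _ _ =>
    div_nonneg (Real.exp_pos _).le (Finset.sum_nonneg fun _ _ => (Real.exp_pos _).le)

theorem rankProb_decompose {k : ℕ} (w : Fin (k + 1) → ℝ) (p : Fin (k + 1))
    (e : Equiv.Perm (Fin k)) :
    rankProb w (Equiv.Perm.decomposeFin.symm (p, e)) =
      Real.exp (w p) / (∑ m, Real.exp (w m)) *
        rankProb (fun x : Fin k => w (Equiv.swap 0 p x.succ)) e := by
  unfold rankProb
  rw [Fin.prod_univ_succ]
  congr 1
  · have h : (Finset.Ici (0 : Fin (k + 1))) = Finset.univ := by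
      ext x; simp
    rw [h, Equiv.sum_comp (Equiv.Perm.decomposeFin.symm (p, e)) fun m => Real.exp (w m)]
    simp
  · refine Finset.prod_congr rfl fun ℓ _ => ?_
    have h : Finset.Ici ℓ.succ = (Finset.Ici ℓ).map (Fin.succEmb k) := by
      ext x
      refine Fin.cases ?_ (fun y => ?_) x
      · simp [Fin.succ_ne_zero]
      · simp
    rw [h, Finset.sum_map]
    simp

/-- The MNL probabilities of all rankings sum to one. -/
theorem sum_rankProb {k : ℕ} (w : Fin k → ℝ) : ∑ σ, rankProb w σ = 1 := by
  induction k with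
  | zero => simp [rankProb]
  | succ k ih =>
    rw [← Equiv.sum_comp Equiv.Perm.decomposeFin.symm, Fintype.sum_prod_type]
    simp_rw [rankProb_decompose, ← Finset.mul_sum, ih, mul_one]
    rw [← Finset.sum_div]
    exact div_self (Finset.sum_pos (fun _ _ => Real.exp_pos _) Finset.univ_nonempty).ne'

/-- The MNL law on the rankings of `k` slots with utilities `w`. -/
def rankPMF {k : ℕ} (w : Fin k → ℝ) : PMF (Equiv.Perm (Fin k)) :=
  PMF.ofFintype (fun σ => ENNReal.ofReal (rankProb w σ)) (by
    rw [← ENNReal.ofReal_sum_of_nonneg fun σ _ => rankProb_nonneg w σ, sum_rankProb,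
      ENNReal.ofReal_one])

/-! ### The sampling model -/

/-- Every set of rankings is measurable. -/
instance instMeasurableSpacePerm (k : ℕ) : MeasurableSpace (Equiv.Perm (Fin k)) := ⊤

/-- The outcome for one user: the `k` items presented, as a family indexed by `k` slots (an item
may occur in several slots), and a ranking of the slots, whose value at `ℓ` is the slot
of the `ℓ`-th best choice. -/
abbrev UserOutcome (d₂ k : ℕ) : Type := (Fin k → Fin d₂) × Equiv.Perm (Fin k)

/-- The law of the outcome for a user with preference vector `θ`: the items are independent and
uniform over the `d₂` items, and given the items the slots are ranked by the MNL model, a slot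
having the utility of its item. -/
def userPMF {d₂ : ℕ} [NeZero d₂] (k : ℕ) (θ : Fin d₂ → ℝ) : PMF (UserOutcome d₂ k) :=
  (PMF.uniformOfFintype (Fin k → Fin d₂)).bind fun J =>
    (rankPMF fun s => θ (J s)).map fun σ => (J, σ)

/-- The joint law of the outcomes for all users: independent users, the `i`-th of whom has the
`i`-th row of `Θ` as preference vector. -/
def sampleLaw {d₁ d₂ : ℕ} [NeZero d₂] (k : ℕ) (Θ : Matrix (Fin d₁) (Fin d₂) ℝ) :
    Measure (Fin d₁ → UserOutcome d₂ k) :=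
  Measure.pi fun i => (userPMF k (Θ i)).toMeasure

/-- The observed ranked lists: `rankedItems ω i ℓ` is the `ℓ`-th best choice of user `i`. -/
def rankedItems {d₁ d₂ k : ℕ} (ω : Fin d₁ → UserOutcome d₂ k) (i : Fin d₁) (ℓ : Fin k) :
    Fin d₂ :=
  (ω i).1 ((ω i).2 ℓ)

/-! ### The estimator -/

/-- The normalized negative log-likelihood of the ranked lists `v`. The multi-set of items
available to user `i` at position `ℓ` consists of the `v i m` with `ℓ ≤ m`. -/
def negLogLik {d₁ d₂ k : ℕ} (v : Fin d₁ → Fin k → Fin d₂)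
    (Θ : Matrix (Fin d₁) (Fin d₂) ℝ) : ℝ :=
  -(1 / ((k : ℝ) * d₁)) * ∑ i, ∑ ℓ,
    (Θ i (v i ℓ) - Real.log (∑ m ∈ Finset.Ici ℓ, Real.exp (Θ i (v i m))))

/-- The constraint set: entries bounded by `α` in absolute value, and rows summing to zero. -/
def constraintSet (d₁ d₂ : ℕ) (α : ℝ) : Set (Matrix (Fin d₁) (Fin d₂) ℝ) :=
  {A | (∀ i j, |A i j| ≤ α) ∧ ∀ i, ∑ j, A i j = 0}

/-- The minimizers over the constraint set of the negative log-likelihood plus `lam` times the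
nuclear norm. -/
def estimators {d₁ d₂ k : ℕ} (α lam : ℝ) (v : Fin d₁ → Fin k → Fin d₂) :
    Set (Matrix (Fin d₁) (Fin d₂) ℝ) :=
  {A | A ∈ constraintSet d₁ d₂ α ∧
    IsMinOn (fun B => negLogLik v B + lam * nuclearNorm B) (constraintSet d₁ d₂ α) A}

/-! ### The parameters of the bound -/

/-- The dynamic range: the largest difference in absolute value of two entries of one row. -/
def dynamicRange {d₁ d₂ : ℕ} (Θ : Matrix (Fin d₁) (Fin d₂) ℝ) : ℝ :=
  ⨆ p : Fin d₁ × Fin d₂ × Fin d₂, |Θ p.1 p.2.1 - Θ p.1 p.2.2|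

/-- The average dimension `d = (d₁ + d₂) / 2`. -/
def avgDim (d₁ d₂ : ℕ) : ℝ := ((d₁ : ℝ) + d₂) / 2

/-- The reference level of the regularization parameter. -/
def lambda0 (d₁ d₂ k : ℕ) (α : ℝ) : ℝ :=
  Real.exp (2 * α) *
    Real.sqrt ((d₁ * Real.log (avgDim d₁ d₂) + d₂ * Real.log (avgDim d₁ d₂) ^ 2) /
      (k * (d₁ : ℝ) ^ 2 * d₂))

end MNLRanking

end

/-! The argument is that of regularized M-estimation. Write `D` for the error. Optimality of the
estimator, convexity of the likelihood and the duality of spectral and nuclear norm show that, once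
the spectral norm of the score matrix is small enough for the gradient term to be at most `lam / 2`
times the nuclear norm of `D`, that nuclear norm is bounded by `√r` times the Frobenius norm plus
the tail of the singular values of the true matrix (`nuc_le_of_nuc_add_le`). If the claimed bound
failed, `D` would then lie in `coneSet`, where the squared Frobenius norm dominates a multiple of
the nuclear norm; a quadratic lower bound for the likelihood on this cone gives a contradiction
(`frobNorm_sq_le_of_gradient_of_curvature`). Two probabilistic facts remain.

Gradient. Given the items, the score of a user is a sum of martingale differences along the
positions of the ranking, so its norm is sub-Gaussian and its second moments are those of the items.
The rows are independent, and a matrix Chernoff bound for sums of operators `g gᵀ` controls the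
spectral norm (`prodP_score_le`). That bound rests on an elementary estimate of `tr (S + g gᵀ)ⁿ` for
every `n`, using Chebyshev's sum inequality.

Curvature. The Hessian at a position is a variance over the items still available, and availability
depends on the items through the ranking. Realizing the ranking by exponential clocks independent of
the items removes this dependence: since utilities in a row differ by at most `α`, a slot with a
very early clock precedes a slot with a late clock whatever the items are. Hence the late slots
remain available at a fixed fraction of the positions, and their items are still independent and
uniform. Pairing them yields a sum of squared differences over i.i.d. uniform pairs, which is
bounded below uniformly on the cone by symmetrization, contraction, the same matrix Chernoff bound,
and bounded differences (`prodP_pairSum_lt_le`).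

If the sample is so small that `k d₁` is below a multiple of the noise level, the bound holds for
every feasible matrix because entries are bounded (`frobNorm_sq_le_of_small_sample`). Otherwise `d₁`
is large, and all failure probabilities add up to at most `2 / d ^ 3`. -/

namespace MNLRanking

/-! ### Nuclear norm of linear maps: duality and decomposability. -/

section NuclearNorm

open Module LinearMap

variable {E F : Type*} [NormedAddCommGroup E] [InnerProductSpace ℝ E] [FiniteDimensional ℝ E]
  [NormedAddCommGroup F] [InnerProductSpace ℝ F] [FiniteDimensional ℝ F]

/-- The Hilbert-Schmidt inner product of two linear maps. -/
noncomputable def hsInner (S T : E →ₗ[ℝ] F) : ℝ := LinearMap.trace ℝ E (adjoint S ∘ₗ T)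

/-- The nuclear norm of a linear map. -/
noncomputable def nuc (T : E →ₗ[ℝ] F) : ℝ := ∑ j ∈ Finset.range (finrank ℝ E), T.singularValues j

theorem hsInner_eq_sum {ι : Type*} [Fintype ι] (b : OrthonormalBasis ι ℝ E) (S T : E →ₗ[ℝ] F) :
    hsInner S T = ∑ i, inner ℝ (S (b i)) (T (b i)) := by
  rw [hsInner, LinearMap.trace_eq_sum_inner _ b]
  simp [adjoint_inner_right]

theorem hsInner_add_left (S S' T : E →ₗ[ℝ] F) :
    hsInner (S + S') T = hsInner S T + hsInner S' T := by
  simp [hsInner, LinearMap.add_comp]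

theorem hsInner_sub_left (S S' T : E →ₗ[ℝ] F) :
    hsInner (S - S') T = hsInner S T - hsInner S' T := by
  simp [hsInner, LinearMap.sub_comp]

theorem hsInner_add_right (S T T' : E →ₗ[ℝ] F) :
    hsInner S (T + T') = hsInner S T + hsInner S T' := by
  simp [hsInner, LinearMap.comp_add]

theorem hsInner_neg_left (S T : E →ₗ[ℝ] F) : hsInner (-S) T = - hsInner S T := by
  simp [hsInner, LinearMap.neg_comp]

theorem hsInner_neg_right (S T : E →ₗ[ℝ] F) : hsInner S (-T) = - hsInner S T := by
  simp [hsInner, LinearMap.comp_neg]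

/-- A right singular basis. -/
theorem exists_singular_basis (T : E →ₗ[ℝ] F) :
    ∃ b : OrthonormalBasis (Fin (finrank ℝ E)) ℝ E, ∀ i j,
      inner ℝ (T (b i)) (T (b j)) = if i = j then T.singularValues i ^ 2 else 0 := by
  refine ⟨T.isSymmetric_adjoint_comp_self.eigenvectorBasis rfl, fun i j => ?_⟩
  rw [← adjoint_inner_right]
  have h := T.isSymmetric_adjoint_comp_self.apply_eigenvectorBasis rfl j
  rw [LinearMap.comp_apply] at h
  rw [h, inner_smul_right, orthonormal_iff_ite.mp (OrthonormalBasis.orthonormal _)]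
  by_cases hij : i = j
  · subst hij
    simp [T.sq_singularValues_fin rfl]
  · simp [hij]

theorem norm_apply_singular_basis {T : E →ₗ[ℝ] F} {b : OrthonormalBasis (Fin (finrank ℝ E)) ℝ E}
    (hb : ∀ i j, inner ℝ (T (b i)) (T (b j)) = if i = j then T.singularValues i ^ 2 else 0)
    (i : Fin (finrank ℝ E)) : ‖T (b i)‖ = T.singularValues i := by
  have h := hb i i
  rw [real_inner_self_eq_norm_sq] at h
  simp only [if_true] at h
  exact (pow_left_inj₀ (norm_nonneg _) (T.singularValues_nonneg i) two_ne_zero).mp h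

theorem nuc_eq_sum_fin (T : E →ₗ[ℝ] F) : nuc T = ∑ i : Fin (finrank ℝ E), T.singularValues i := by
  rw [nuc, Finset.sum_range]

theorem nuc_nonneg (T : E →ₗ[ℝ] F) : 0 ≤ nuc T :=
  Finset.sum_nonneg fun _ _ => T.singularValues_nonneg _

/-- Evaluate the trace in a right singular basis of `A` and apply Cauchy–Schwarz to each term. -/
theorem hsInner_le_nuc_mul (A X : E →ₗ[ℝ] F) {c : ℝ} (hX : ∀ v, ‖X v‖ ≤ c * ‖v‖) :
    hsInner A X ≤ nuc A * c := by
  obtain ⟨b, hb⟩ := exists_singular_basis A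
  rw [hsInner_eq_sum b, nuc_eq_sum_fin, Finset.sum_mul]
  refine Finset.sum_le_sum fun i _ => (real_inner_le_norm _ _).trans ?_
  rw [norm_apply_singular_basis hb]
  refine mul_le_mul_of_nonneg_left ?_ (A.singularValues_nonneg i)
  simpa using hX (b i)

/-- The partial isometry that sends each right singular vector with index in `s` to the
corresponding left singular vector. -/
theorem exists_partial_isometry (T : E →ₗ[ℝ] F) {b : OrthonormalBasis (Fin (finrank ℝ E)) ℝ E}
    (hb : ∀ i j, inner ℝ (T (b i)) (T (b j)) = if i = j then T.singularValues i ^ 2 else 0)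
    (s : Finset (Fin (finrank ℝ E))) :
    ∃ X : E →ₗ[ℝ] F, (∀ i ∈ s, X (b i) = (T.singularValues i)⁻¹ • T (b i)) ∧
      (∀ i ∉ s, X (b i) = 0) ∧ (∀ v, ‖X v‖ ≤ ‖v‖) := by
  classical
  let X : E →ₗ[ℝ] F := b.toBasis.constr ℝ fun i =>
    if i ∈ s then (T.singularValues i)⁻¹ • T (b i) else 0
  have hXb : ∀ i, X (b i) = if i ∈ s then (T.singularValues i)⁻¹ • T (b i) else 0 := by
    intro i
    have := b.toBasis.constr_basis ℝ (fun i => if i ∈ s then (T.singularValues i)⁻¹ • T (b i)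
      else 0) i
    rwa [OrthonormalBasis.coe_toBasis] at this
  refine ⟨X, fun i hi => by simp [hXb, hi], fun i hi => by simp [hXb, hi], fun v => ?_⟩
  -- A zero singular value has inverse `0`, so the corresponding basis vector is sent to `0` and `X`
  -- is only a partial isometry.
  have horth : ∀ i j, inner ℝ (X (b i)) (X (b j)) =
      if i = j then (if i ∈ s ∧ T.singularValues i ≠ 0 then 1 else 0) else 0 := by
    intro i j
    rw [hXb, hXb]
    by_cases hij : i = j
    · subst hij
      by_cases hi : i ∈ s
      · by_cases h0 : T.singularValues i = 0
        · simp [h0]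
        · simp only [hi, if_true, inner_smul_left, inner_smul_right, hb, h0, ne_eq,
            not_false_eq_true, and_self]
          simp only [conj_trivial]
          field_simp
      · simp [hi]
    · by_cases hi : i ∈ s <;> by_cases hj : j ∈ s <;>
        simp [hi, hj, inner_smul_left, inner_smul_right, hb, hij]
  have hv : X v = ∑ i, inner ℝ (b i) v • X (b i) := by
    conv_lhs => rw [← b.sum_repr' v]
    simp
  have h1 : ‖X v‖ ^ 2 ≤ ‖v‖ ^ 2 := by
    rw [← b.sum_sq_norm_inner_right v, ← real_inner_self_eq_norm_sq, hv, sum_inner]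
    refine Finset.sum_le_sum fun i _ => ?_
    rw [inner_sum]
    simp only [inner_smul_left, inner_smul_right, horth]
    simp only [conj_trivial, mul_ite, mul_one, mul_zero, Finset.sum_ite_eq, Finset.mem_univ, if_true,
      Real.norm_eq_abs, sq_abs]
    split_ifs
    · rw [sq]
    · exact sq_nonneg _
  exact (pow_le_pow_iff_left₀ (norm_nonneg _) (norm_nonneg _) two_ne_zero).mp h1

/-- Equality in the duality bound, attained by the polar factor. It makes `nuc` a supremum of linear
functionals, whence the triangle inequality. -/
theorem exists_hsInner_eq_nuc (T : E →ₗ[ℝ] F) :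
    ∃ X : E →ₗ[ℝ] F, (∀ v, ‖X v‖ ≤ ‖v‖) ∧ hsInner T X = nuc T := by
  obtain ⟨b, hb⟩ := exists_singular_basis T
  obtain ⟨X, hX, -, hX'⟩ := exists_partial_isometry T hb Finset.univ
  refine ⟨X, hX', ?_⟩
  rw [hsInner_eq_sum b, nuc_eq_sum_fin]
  refine Finset.sum_congr rfl fun i _ => ?_
  rw [hX i (Finset.mem_univ i), inner_smul_right, hb]
  by_cases h0 : T.singularValues i = 0
  · simp [h0]
  · simp only [if_true]
    field_simp

theorem hsInner_le_nuc (A X : E →ₗ[ℝ] F) (hX : ∀ v, ‖X v‖ ≤ ‖v‖) : hsInner A X ≤ nuc A := by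
  simpa using hsInner_le_nuc_mul A X (c := 1) (by simpa using hX)

theorem nuc_add_le (A B : E →ₗ[ℝ] F) : nuc (A + B) ≤ nuc A + nuc B := by
  obtain ⟨X, hX, h⟩ := exists_hsInner_eq_nuc (A + B)
  rw [← h, hsInner_add_left]
  exact add_le_add (hsInner_le_nuc A X hX) (hsInner_le_nuc B X hX)

theorem nuc_neg_le (A : E →ₗ[ℝ] F) : nuc (-A) ≤ nuc A := by
  obtain ⟨X, hX, h⟩ := exists_hsInner_eq_nuc (-A)
  rw [← h, hsInner_neg_left, ← hsInner_neg_right]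
  exact hsInner_le_nuc A (-X) (by simpa using hX)

theorem hsInner_self_eq_sum_sq (T : E →ₗ[ℝ] F) :
    hsInner T T = ∑ i : Fin (finrank ℝ E), T.singularValues i ^ 2 := by
  obtain ⟨b, hb⟩ := exists_singular_basis T
  rw [hsInner_eq_sum b]
  simp only [hb, if_true]

theorem hsInner_self_nonneg (T : E →ₗ[ℝ] F) : 0 ≤ hsInner T T := by
  rw [hsInner_self_eq_sum_sq]
  positivity

theorem hsInner_self_le_nuc_sq (T : E →ₗ[ℝ] F) : hsInner T T ≤ nuc T ^ 2 := by
  rw [hsInner_self_eq_sum_sq, nuc_eq_sum_fin]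
  exact Finset.sum_sq_le_sq_sum_of_nonneg fun i _ => T.singularValues_nonneg i

/-- Cauchy–Schwarz over the singular values of index below `m`; the others vanish. -/
theorem nuc_sq_le_rank_mul (T : E →ₗ[ℝ] F) {m : ℕ} (hm : finrank ℝ (LinearMap.range T) ≤ m) :
    nuc T ^ 2 ≤ m * hsInner T T := by
  rw [hsInner_self_eq_sum_sq, nuc]
  have h1 : ∑ j ∈ Finset.range (finrank ℝ E), T.singularValues j
      = ∑ j ∈ (Finset.range (finrank ℝ E)).filter (· < m), T.singularValues j := by
    rw [Finset.sum_filter_of_ne]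
    intro j _ hj
    by_contra hlt
    exact hj (T.singularValues_eq_zero_iff_le_finrank_range.mpr (hm.trans (not_lt.mp hlt)))
  rw [h1]
  refine (sq_sum_le_card_mul_sum_sq).trans ?_
  have h2 : ((Finset.range (finrank ℝ E)).filter (· < m)).card ≤ m := by
    calc _ ≤ (Finset.range m).card := Finset.card_le_card (by
          intro j hj; simp at hj ⊢; exact hj.2)
      _ = m := Finset.card_range m
  have h3 : ∑ j ∈ (Finset.range (finrank ℝ E)).filter (· < m), T.singularValues j ^ 2
      ≤ ∑ i : Fin (finrank ℝ E), T.singularValues i ^ 2 := by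
    rw [← Finset.sum_range (fun j => T.singularValues j ^ 2)]
    exact Finset.sum_le_sum_of_subset_of_nonneg (Finset.filter_subset _ _)
      fun _ _ _ => sq_nonneg _
  exact mul_le_mul (by exact_mod_cast h2) h3 (Finset.sum_nonneg fun _ _ => sq_nonneg _)
    (Nat.cast_nonneg _)

/-- If adding `D` to `S` increases the nuclear norm by at most half the nuclear norm of `D`, then
the nuclear norm of `D` is controlled by its Hilbert-Schmidt norm and the tail of `S`. -/
theorem nuc_le_of_nuc_add_le (S D : E →ₗ[ℝ] F) (r : ℕ)
    (h : nuc (S + D) - nuc S ≤ nuc D / 2) :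
    nuc D ≤ 4 * Real.sqrt (2 * r * hsInner D D) +
      4 * ∑ j ∈ Finset.Ico r (finrank ℝ E), S.singularValues j := by
  classical
  obtain ⟨b, hb⟩ := exists_singular_basis S
  set s : Finset (Fin (finrank ℝ E)) := Finset.univ.filter fun i => (i : ℕ) < r with hs
  have hs_card : s.card ≤ r := by
    have : s.card = (s.map Fin.valEmbedding).card := (Finset.card_map _).symm
    rw [this]
    calc _ ≤ (Finset.range r).card := Finset.card_le_card (by
          intro j hj; simp [hs] at hj ⊢; obtain ⟨a, ha, rfl⟩ := hj; exact ha)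
      _ = r := Finset.card_range r
  obtain ⟨X, hXs, hXn, hXc⟩ := exists_partial_isometry S hb s
  -- `V` and `U` are spanned by the leading right and left singular directions of `S`; `Q` and `P`
  -- project onto their orthogonal complements.
  set V : Submodule ℝ E := Submodule.span ℝ (s.image b : Finset E) with hV
  set U : Submodule ℝ F := Submodule.span ℝ (s.image (fun i => S (b i)) : Finset F) with hU
  have hVr : finrank ℝ V ≤ r :=
    (finrank_span_finset_le_card _).trans (Finset.card_image_le.trans hs_card)
  have hUr : finrank ℝ U ≤ r :=
    (finrank_span_finset_le_card _).trans (Finset.card_image_le.trans hs_card)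
  set P : F →ₗ[ℝ] F := Uᗮ.starProjection.toLinearMap with hP
  set Q : E →ₗ[ℝ] E := Vᗮ.starProjection.toLinearMap with hQ
  have hbV : ∀ i ∈ s, b i ∈ V := fun i hi =>
    Submodule.subset_span (by simpa using ⟨i, hi, rfl⟩)
  have hPadj : adjoint P = P := by
    rw [← LinearMap.isSelfAdjoint_iff', ← LinearMap.isSymmetric_iff_isSelfAdjoint]
    exact Submodule.starProjection_isSymmetric _
  have hQadj : adjoint Q = Q := by
    rw [← LinearMap.isSelfAdjoint_iff', ← LinearMap.isSymmetric_iff_isSelfAdjoint]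
    exact Submodule.starProjection_isSymmetric _
  have hPU : ∀ x, ∀ u ∈ U, inner ℝ (P x) u = 0 := fun x u hu =>
    (Submodule.mem_orthogonal' _ _).mp (Submodule.starProjection_apply_mem Uᗮ x) u hu
  have hQV : ∀ x, ∀ u ∈ V, inner ℝ (Q x) u = 0 := fun x u hu =>
    (Submodule.mem_orthogonal' _ _).mp (Submodule.starProjection_apply_mem Vᗮ x) u hu
  have hXU : ∀ v, X v ∈ U := by
    intro v
    rw [← b.sum_repr' v, map_sum]
    refine Submodule.sum_mem _ fun i _ => ?_
    rw [map_smul]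
    refine Submodule.smul_mem _ _ ?_
    by_cases hi : i ∈ s
    · rw [hXs i hi]
      exact Submodule.smul_mem _ _ (Submodule.subset_span (by simpa using ⟨i, hi, rfl⟩))
    · rw [hXn i hi]
      exact Submodule.zero_mem _
  have hXQ : ∀ v, X (Q v) = 0 := by
    intro v
    rw [← b.sum_repr' (Q v), map_sum]
    refine Finset.sum_eq_zero fun i _ => ?_
    rw [map_smul]
    by_cases hi : i ∈ s
    · rw [real_inner_comm, hQV v _ (hbV i hi), zero_smul]
    · rw [hXn i hi, smul_zero]
  have hQb : ∀ i ∈ s, Q (b i) = 0 := by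
    intro i hi
    exact (Submodule.starProjection_apply_eq_zero_iff _).mpr
      (Submodule.le_orthogonal_orthogonal V (hbV i hi))
  have hQc : ∀ v, ‖Q v‖ ≤ ‖v‖ := fun v => Submodule.norm_starProjection_apply_le _ v
  have hPc : ∀ v, ‖P v‖ ≤ ‖v‖ := fun v => Submodule.norm_starProjection_apply_le _ v
  set D2 : E →ₗ[ℝ] F := P ∘ₗ D ∘ₗ Q with hD2
  obtain ⟨Y0, hY0, hY0n⟩ := exists_hsInner_eq_nuc D2
  -- A dual certificate of the compression `D2`, compressed in turn so that its range and support
  -- are orthogonal to those of `X`. Therefore `X + Y` is still a contraction and can be used as a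
  -- test map for `S + D`.
  set Y : E →ₗ[ℝ] F := P ∘ₗ Y0 ∘ₗ Q with hY
  have hcyc : ∀ A B : E →ₗ[ℝ] F, hsInner A (P ∘ₗ B ∘ₗ Q) = hsInner (P ∘ₗ A ∘ₗ Q) B := by
    intro A B
    simp only [hsInner, adjoint_comp, hPadj, hQadj]
    rw [show adjoint A ∘ₗ P ∘ₗ B ∘ₗ Q = (adjoint A ∘ₗ P ∘ₗ B) ∘ₗ Q from rfl,
      LinearMap.trace_comp_comm']
    rfl
  have hYn : hsInner D Y = nuc D2 := by rw [hY, hcyc, ← hD2, hY0n]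
  have hPP : ∀ x, P (P x) = P x := fun x =>
    (Submodule.starProjection_eq_self_iff (K := Uᗮ)).mpr (Submodule.starProjection_apply_mem Uᗮ x)
  have hQQ : ∀ x, Q (Q x) = Q x := fun x =>
    (Submodule.starProjection_eq_self_iff (K := Vᗮ)).mpr (Submodule.starProjection_apply_mem Vᗮ x)
  have hcontr : ∀ v, ‖(X + Y) v‖ ≤ ‖v‖ := by
    intro v
    have e1 : X v = X (v - Q v) := by rw [map_sub, hXQ, sub_zero]
    have e2 : ‖X v‖ ≤ ‖v - Q v‖ := by rw [e1]; exact hXc _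
    have e3 : ‖Y v‖ ≤ ‖Q v‖ := (hPc _).trans (hY0 _)
    have e4 : inner ℝ (X v) (Y v) = 0 := by
      rw [real_inner_comm]; exact hPU _ _ (hXU v)
    have e5 : inner ℝ (v - Q v) (Q v) = 0 := by
      rw [inner_sub_left, sub_eq_zero]
      have := congrArg (fun f : E →ₗ[ℝ] E => inner ℝ (f v) (Q v)) hQadj
      beta_reduce at this
      rw [adjoint_inner_left, hQQ] at this
      exact this
    have e6 : ‖(X + Y) v‖ ^ 2 ≤ ‖v‖ ^ 2 := by
      have a1 : ‖(X + Y) v‖ ^ 2 = ‖X v‖ ^ 2 + ‖Y v‖ ^ 2 := by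
        rw [LinearMap.add_apply, norm_add_sq_real, e4]; ring
      have a2 : ‖v‖ ^ 2 = ‖v - Q v‖ ^ 2 + ‖Q v‖ ^ 2 := by
        conv_lhs => rw [← sub_add_cancel v (Q v)]
        rw [norm_add_sq_real, e5]; ring
      rw [a1, a2]
      gcongr
    exact (pow_le_pow_iff_left₀ (norm_nonneg _) (norm_nonneg _) two_ne_zero).mp e6
  -- The terms estimated below combine to `nuc (S + D) - nuc S ≥ nuc D2 - nuc D1 - 2 * tail`, with
  -- `D1 = D - D2`.
  have hmain := hsInner_le_nuc (S + D) (X + Y) hcontr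
  rw [hsInner_add_left, hsInner_add_right, hsInner_add_right, hYn] at hmain
  have hnucS : nuc S = ∑ i ∈ s, S.singularValues i + ∑ i ∈ sᶜ, S.singularValues i := by
    rw [nuc_eq_sum_fin, Finset.sum_add_sum_compl]
  have htail : ∑ i ∈ sᶜ, S.singularValues i =
      ∑ j ∈ Finset.Ico r (finrank ℝ E), S.singularValues j := by
    have hm : sᶜ.map Fin.valEmbedding = Finset.Ico r (finrank ℝ E) := by
      ext j
      simp only [hs, Finset.mem_map, Finset.mem_compl, Finset.mem_filter, Finset.mem_univ, true_and,
        not_lt, Fin.valEmbedding_apply, Finset.mem_Ico]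
      constructor
      · rintro ⟨a, ha, rfl⟩; exact ⟨ha, a.2⟩
      · rintro ⟨h1, h2⟩; exact ⟨⟨j, h2⟩, h1, rfl⟩
    rw [← hm, Finset.sum_map]
    rfl
  have hSX : hsInner S X = ∑ i ∈ s, S.singularValues i := by
    rw [hsInner_eq_sum b, ← Finset.sum_add_sum_compl s]
    have z : ∑ i ∈ sᶜ, inner ℝ (S (b i)) (X (b i)) = 0 :=
      Finset.sum_eq_zero fun i hi => by rw [hXn i (by simpa using hi), inner_zero_right]
    rw [z, add_zero]
    refine Finset.sum_congr rfl fun i hi => ?_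
    rw [hXs i hi, inner_smul_right, hb]
    by_cases h0 : S.singularValues i = 0
    · simp [h0]
    · simp only [if_true]; field_simp
  have hSY : - ∑ i ∈ sᶜ, S.singularValues i ≤ hsInner S Y := by
    rw [hsInner_eq_sum b, ← Finset.sum_add_sum_compl s]
    have z : ∑ i ∈ s, inner ℝ (S (b i)) (Y (b i)) = 0 :=
      Finset.sum_eq_zero fun i hi => by simp [hY, hQb i hi]
    rw [z, zero_add, ← Finset.sum_neg_distrib]
    refine Finset.sum_le_sum fun i _ => ?_
    have c1 := abs_real_inner_le_norm (S (b i)) (Y (b i))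
    rw [norm_apply_singular_basis hb] at c1
    have c2 : ‖Y (b i)‖ ≤ 1 := by
      refine (hPc _).trans ((hY0 _).trans ((hQc _).trans ?_))
      simp
    have c3 := mul_le_mul_of_nonneg_left c2 (S.singularValues_nonneg i)
    linarith [neg_abs_le (inner ℝ (S (b i)) (Y (b i)))]
  set D1 := D - D2 with hD1
  have hDX : - nuc D1 ≤ hsInner D X := by
    have e : hsInner D X = hsInner D1 X := by
      rw [hD1, hsInner_sub_left]
      have : hsInner D2 X = 0 := by
        rw [hsInner_eq_sum b]
        exact Finset.sum_eq_zero fun i _ => hPU _ _ (hXU _)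
      rw [this, sub_zero]
    have := hsInner_le_nuc D1 (-X) (by simpa using hXc)
    rw [hsInner_neg_right] at this
    rw [e]; linarith
  have htri : nuc D ≤ nuc D1 + nuc D2 := by
    have := nuc_add_le D1 D2
    rwa [hD1, sub_add_cancel] at this
  -- `D1` is `(1 - P) D + P D (1 - Q)`; the first summand has range in `U`, the second factors
  -- through `V`.
  have hrank : finrank ℝ (LinearMap.range D1) ≤ 2 * r := by
    have hle : LinearMap.range D1 ≤ U ⊔ V.map (P ∘ₗ D) := by
      rintro _ ⟨v, rfl⟩
      have e : D1 v = (D v - P (D v)) + (P ∘ₗ D) (v - Q v) := by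
        simp [hD1, hD2]
      rw [e]
      refine Submodule.add_mem_sup ?_ (Submodule.mem_map_of_mem ?_)
      · have := Submodule.sub_starProjection_mem_orthogonal (K := Uᗮ) (D v)
        rwa [Submodule.orthogonal_orthogonal] at this
      · have := Submodule.sub_starProjection_mem_orthogonal (K := Vᗮ) v
        rwa [Submodule.orthogonal_orthogonal] at this
    have i1 := Submodule.finrank_mono hle
    have i2 := Submodule.finrank_add_le_finrank_add_finrank U (V.map (P ∘ₗ D))
    have i3 := Submodule.finrank_map_le (P ∘ₗ D) V
    omega
  have hF : hsInner D1 D1 ≤ hsInner D D := by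
    have z : hsInner D2 D2 = hsInner D D2 := by
      have := hcyc D D2
      rw [← hD2] at this
      rw [← this]
      congr 1
      ext v
      simp [hD2, hPP, hQQ]
    have sym : hsInner D2 D = hsInner D D2 := by
      rw [hsInner_eq_sum b, hsInner_eq_sum b]
      exact Finset.sum_congr rfl fun i _ => real_inner_comm _ _
    have e : hsInner D1 D1 = hsInner D D - hsInner D2 D2 := by
      have : D1 = D + -D2 := by rw [hD1, sub_eq_add_neg]
      rw [this, hsInner_add_left, hsInner_add_right, hsInner_add_right, hsInner_neg_left,
        hsInner_neg_left, hsInner_neg_right, hsInner_neg_right, sym, z]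
      ring
    linarith [hsInner_self_nonneg D2]
  have hD1n : nuc D1 ≤ Real.sqrt (2 * r * hsInner D D) := by
    refine Real.le_sqrt_of_sq_le ((nuc_sq_le_rank_mul D1 hrank).trans ?_)
    push_cast
    gcongr
  -- The hypothesis gives `nuc D2 ≤ 3 * nuc D1 + 4 * tail`; adding `nuc D1` produces both factors
  -- `4`.
  linarith

end NuclearNorm

end MNLRanking

namespace MNLRanking

/-! ### Transfer to matrices, existence of minimizers, the dynamic range. -/

section MatrixNorms

open Module

variable {d₁ d₂ : ℕ}

/-- The two sums have lengths `min d₁ d₂` and `d₂`; the additional singular values vanish because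
the rank is at most `min d₁ d₂`. -/
theorem nuclearNorm_eq_nuc (A : Matrix (Fin d₁) (Fin d₂) ℝ) :
    nuclearNorm A = nuc (Matrix.toEuclideanLin A) := by
  have hr : finrank ℝ (LinearMap.range (Matrix.toEuclideanLin A)) ≤ min d₁ d₂ := by
    refine le_min ?_ ?_
    · simpa using Submodule.finrank_le (LinearMap.range (Matrix.toEuclideanLin A))
    · simpa using LinearMap.finrank_range_le (Matrix.toEuclideanLin A)
  rw [nuclearNorm, nuc, finrank_euclideanSpace_fin]
  refine Finset.sum_subset (Finset.range_mono (min_le_right _ _)) fun j _ hj => ?_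
  exact (LinearMap.singularValues_eq_zero_iff_le_finrank_range _).mpr
    (hr.trans (not_lt.mp fun h => hj (Finset.mem_range.mpr h)))

theorem sum_singVal_Ico_eq (A : Matrix (Fin d₁) (Fin d₂) ℝ) (r : ℕ) :
    ∑ j ∈ Finset.Ico r (min d₁ d₂), singVal A j =
      ∑ j ∈ Finset.Ico r d₂, (Matrix.toEuclideanLin A).singularValues j := by
  have hr : finrank ℝ (LinearMap.range (Matrix.toEuclideanLin A)) ≤ min d₁ d₂ := by
    refine le_min ?_ ?_
    · simpa using Submodule.finrank_le (LinearMap.range (Matrix.toEuclideanLin A))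
    · simpa using LinearMap.finrank_range_le (Matrix.toEuclideanLin A)
  refine Finset.sum_subset (Finset.Ico_subset_Ico_right (min_le_right _ _)) fun j h hj => ?_
  refine (LinearMap.singularValues_eq_zero_iff_le_finrank_range _).mpr (hr.trans ?_)
  by_contra hlt
  exact hj (Finset.mem_Ico.mpr ⟨(Finset.mem_Ico.mp h).1, not_le.mp hlt⟩)

theorem frobNorm_nonneg (A : Matrix (Fin d₁) (Fin d₂) ℝ) : 0 ≤ frobNorm A := by
  rw [frobNorm_eq_sqrt]; exact Real.sqrt_nonneg _

theorem frobNorm_sq (A : Matrix (Fin d₁) (Fin d₂) ℝ) : frobNorm A ^ 2 = ∑ i, ∑ j, A i j ^ 2 := by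
  rw [frobNorm_eq_sqrt, Real.sq_sqrt]
  positivity

theorem sum_mul_eq_hsInner (G A : Matrix (Fin d₁) (Fin d₂) ℝ) :
    ∑ i, ∑ j, G i j * A i j =
      hsInner (Matrix.toEuclideanLin A) (Matrix.toEuclideanLin G) := by
  rw [hsInner_eq_sum (EuclideanSpace.basisFun (Fin d₂) ℝ), Finset.sum_comm]
  refine Finset.sum_congr rfl fun j _ => ?_
  rw [PiLp.inner_apply]
  refine Finset.sum_congr rfl fun i _ => ?_
  simp [Matrix.toLpLin_apply, Matrix.mulVec_single]

theorem frobNorm_sq_eq_hsInner (A : Matrix (Fin d₁) (Fin d₂) ℝ) :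
    frobNorm A ^ 2 = hsInner (Matrix.toEuclideanLin A) (Matrix.toEuclideanLin A) := by
  rw [frobNorm_sq, ← sum_mul_eq_hsInner]
  simp [sq]

theorem nuclearNorm_nonneg (A : Matrix (Fin d₁) (Fin d₂) ℝ) : 0 ≤ nuclearNorm A := by
  rw [nuclearNorm_eq_nuc]; exact nuc_nonneg _

theorem nuclearNorm_add_le (A B : Matrix (Fin d₁) (Fin d₂) ℝ) :
    nuclearNorm (A + B) ≤ nuclearNorm A + nuclearNorm B := by
  simp only [nuclearNorm_eq_nuc, map_add]
  exact nuc_add_le _ _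

theorem nuclearNorm_neg_le (A : Matrix (Fin d₁) (Fin d₂) ℝ) :
    nuclearNorm (-A) ≤ nuclearNorm A := by
  simp only [nuclearNorm_eq_nuc, map_neg]
  exact nuc_neg_le _

theorem frobNorm_le_nuclearNorm (A : Matrix (Fin d₁) (Fin d₂) ℝ) :
    frobNorm A ≤ nuclearNorm A := by
  refine (pow_le_pow_iff_left₀ (frobNorm_nonneg A) (nuclearNorm_nonneg A) two_ne_zero).mp ?_
  rw [frobNorm_sq_eq_hsInner, nuclearNorm_eq_nuc]
  exact hsInner_self_le_nuc_sq _

/-- Duality between the spectral norm and the nuclear norm. -/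
theorem sum_mul_le_mul_nuclearNorm (G A : Matrix (Fin d₁) (Fin d₂) ℝ) {s : ℝ} (hs : 0 ≤ s)
    (hG : ∀ v : Fin d₂ → ℝ, ∑ i, (∑ j, G i j * v j) ^ 2 ≤ s ^ 2 * ∑ j, v j ^ 2) :
    ∑ i, ∑ j, G i j * A i j ≤ s * nuclearNorm A := by
  rw [sum_mul_eq_hsInner, nuclearNorm_eq_nuc, mul_comm s]
  refine hsInner_le_nuc_mul _ _ fun v => ?_
  refine (pow_le_pow_iff_left₀ (norm_nonneg _) (by positivity) two_ne_zero).mp ?_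
  rw [mul_pow, EuclideanSpace.norm_sq_eq, EuclideanSpace.norm_sq_eq]
  simpa [Matrix.toLpLin_apply, Matrix.mulVec, dotProduct] using hG v

theorem nuclearNorm_le_of_nuclearNorm_add_le (S D : Matrix (Fin d₁) (Fin d₂) ℝ) (r : ℕ)
    (h : nuclearNorm (S + D) - nuclearNorm S ≤ nuclearNorm D / 2) :
    nuclearNorm D ≤ 4 * (Real.sqrt 2 * Real.sqrt r * frobNorm D) +
      4 * ∑ j ∈ Finset.Ico r (min d₁ d₂), singVal S j := by
  simp only [nuclearNorm_eq_nuc, map_add] at h ⊢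
  have := nuc_le_of_nuc_add_le _ _ r h
  rw [← frobNorm_sq_eq_hsInner, Real.sqrt_mul (by positivity), Real.sqrt_mul (by positivity),
    Real.sqrt_sq (frobNorm_nonneg D), finrank_euclideanSpace_fin] at this
  rwa [sum_singVal_Ico_eq]

theorem nuclearNorm_le_mul_frobNorm (A : Matrix (Fin d₁) (Fin d₂) ℝ) :
    nuclearNorm A ≤ Real.sqrt d₂ * frobNorm A := by
  have h := nuc_sq_le_rank_mul (Matrix.toEuclideanLin A) (m := d₂)
    (by simpa using LinearMap.finrank_range_le (Matrix.toEuclideanLin A))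
  rw [← frobNorm_sq_eq_hsInner, ← nuclearNorm_eq_nuc] at h
  rw [← Real.sqrt_sq (frobNorm_nonneg A), ← Real.sqrt_mul (by positivity)]
  exact Real.le_sqrt_of_sq_le h

theorem continuous_frobNorm : Continuous (frobNorm : Matrix (Fin d₁) (Fin d₂) ℝ → ℝ) := by
  have : (frobNorm : Matrix (Fin d₁) (Fin d₂) ℝ → ℝ) =
      fun A => Real.sqrt (∑ i, ∑ j, A i j ^ 2) := funext frobNorm_eq_sqrt
  rw [this]
  fun_prop

/-- By the triangle inequality, the nuclear norm is Lipschitz for the Frobenius norm, with constant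
`√d₂`. -/
theorem continuous_nuclearNorm : Continuous (nuclearNorm : Matrix (Fin d₁) (Fin d₂) ℝ → ℝ) := by
  rw [continuous_iff_continuousAt]
  intro A
  rw [ContinuousAt, tendsto_iff_dist_tendsto_zero]
  have hb : ∀ B : Matrix (Fin d₁) (Fin d₂) ℝ,
      dist (nuclearNorm B) (nuclearNorm A) ≤ Real.sqrt d₂ * frobNorm (B - A) := by
    intro B
    refine le_trans ?_ (nuclearNorm_le_mul_frobNorm (B - A))
    rw [Real.dist_eq, abs_sub_le_iff]
    have h1 := nuclearNorm_add_le (B - A) A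
    have h2 := nuclearNorm_add_le (-(B - A)) B
    have h3 := nuclearNorm_neg_le (B - A)
    rw [sub_add_cancel] at h1
    rw [neg_sub, sub_add_cancel] at h2
    rw [neg_sub] at h3
    constructor <;> linarith
  have hlim : Filter.Tendsto (fun B => Real.sqrt d₂ * frobNorm (B - A)) (nhds A) (nhds 0) := by
    have hc : Continuous fun B => Real.sqrt d₂ * frobNorm (B - A) :=
      continuous_const.mul (continuous_frobNorm.comp (continuous_id.sub continuous_const))
    have := hc.tendsto A
    simpa [frobNorm_eq_sqrt] using this
  exact squeeze_zero (fun _ => dist_nonneg) hb hlim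

theorem isCompact_constraintSet (d₁ d₂ : ℕ) (α : ℝ) : IsCompact (constraintSet d₁ d₂ α) := by
  have h1 : IsCompact (Set.pi Set.univ fun _ : Fin d₁ => Set.pi Set.univ fun _ : Fin d₂ =>
      Set.Icc (-α) α) := isCompact_univ_pi fun _ => isCompact_univ_pi fun _ => isCompact_Icc
  have h2 : IsClosed {A : Matrix (Fin d₁) (Fin d₂) ℝ | ∀ i, ∑ j, A i j = 0} := by
    simp only [Set.ofPred_forall]
    exact isClosed_iInter fun i => isClosed_eq (by fun_prop) continuous_const
  have h3 : constraintSet d₁ d₂ α = (Set.pi Set.univ fun _ : Fin d₁ => Set.pi Set.univ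
      fun _ : Fin d₂ => Set.Icc (-α) α) ∩
      {A : Matrix (Fin d₁) (Fin d₂) ℝ | ∀ i, ∑ j, A i j = 0} := by
    refine Set.ext fun A => ?_
    exact ⟨fun h => ⟨fun i _ j _ => abs_le.mp (h.1 i j), h.2⟩,
      fun h => ⟨fun i j => abs_le.mpr (h.1 i trivial j trivial), h.2⟩⟩
  rw [h3]
  exact h1.inter_right h2

theorem continuous_negLogLik {k : ℕ} (v : Fin d₁ → Fin k → Fin d₂) :
    Continuous (negLogLik v) := by
  unfold negLogLik
  refine continuous_const.mul (continuous_finsetSum _ fun i _ => continuous_finsetSum _ fun l _ => ?_)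
  refine Continuous.sub (by fun_prop) (Continuous.log (by fun_prop) fun A => ?_)
  exact (Finset.sum_pos (fun _ _ => Real.exp_pos _) ⟨l, by simp⟩).ne'

theorem estimators_nonempty {k : ℕ} {α : ℝ} (hα : 0 ≤ α) (lam : ℝ) (v : Fin d₁ → Fin k → Fin d₂) :
    (estimators α lam v).Nonempty := by
  obtain ⟨A, hA, hmin⟩ := (isCompact_constraintSet d₁ d₂ α).exists_isMinOn
    (f := fun B => negLogLik v B + lam * nuclearNorm B) ⟨0, by simp [constraintSet, hα]⟩
    ((continuous_negLogLik v).add (continuous_const.mul continuous_nuclearNorm)).continuousOn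
  exact ⟨A, hA, hmin⟩

theorem abs_sub_le_dynamicRange (Θ : Matrix (Fin d₁) (Fin d₂) ℝ) (i : Fin d₁) (j j' : Fin d₂) :
    |Θ i j - Θ i j'| ≤ dynamicRange Θ :=
  le_ciSup (f := fun p : Fin d₁ × Fin d₂ × Fin d₂ => |Θ p.1 p.2.1 - Θ p.1 p.2.2|)
    (Set.finite_range _).bddAbove (i, j, j')

theorem dynamicRange_nonneg (Θ : Matrix (Fin d₁) (Fin d₂) ℝ) : 0 ≤ dynamicRange Θ :=
  Real.iSup_nonneg fun _ => abs_nonneg _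

/-- As the row sums vanish, an entry is the average of its differences from the entries of its row.
This makes the true matrix feasible. -/
theorem mem_constraintSet_dynamicRange {Θ : Matrix (Fin d₁) (Fin d₂) ℝ}
    (hrow : ∀ i, ∑ j, Θ i j = 0) : Θ ∈ constraintSet d₁ d₂ (dynamicRange Θ) := by
  refine ⟨fun i j => ?_, hrow⟩
  have hd : (0 : ℝ) < d₂ := by exact_mod_cast (Fin.pos j)
  have h : (d₂ : ℝ) * Θ i j = ∑ j', (Θ i j - Θ i j') := by
    simp [Finset.sum_sub_distrib, hrow i]
  have h2 : (d₂ : ℝ) * |Θ i j| ≤ d₂ * dynamicRange Θ := by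
    rw [← abs_of_pos hd, ← abs_mul, h, abs_of_pos hd]
    refine (Finset.abs_sum_le_sum_abs _ _).trans ?_
    refine (Finset.sum_le_sum fun j' _ => abs_sub_le_dynamicRange Θ i j j').trans ?_
    simp
  exact le_of_mul_le_mul_left h2 hd

end MatrixNorms

end MNLRanking

namespace MNLRanking

/-! ### Strong convexity of the log-likelihood and its gradient. -/

section Likelihood

/-- Second-order Taylor bound, from two uses of monotonicity instead of a remainder formula. -/
theorem le_of_hasDerivAt_of_le {f f' : ℝ → ℝ} {K : ℝ}
    (hf : ∀ t, HasDerivAt f (f' t) t) {f'' : ℝ → ℝ} (hf' : ∀ t, HasDerivAt f' (f'' t) t)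
    (hK : ∀ t ∈ Set.Icc (0 : ℝ) 1, K ≤ f'' t) : f 0 + f' 0 + K / 2 ≤ f 1 := by
  have hg' : ∀ t, HasDerivAt (fun t => f' t - K * t) (f'' t - K) t := fun t =>
    ((hf' t).fun_sub ((hasDerivAt_id' t).const_mul K)).congr_deriv (by ring)
  have hmono' : MonotoneOn (fun t => f' t - K * t) (Set.Icc 0 1) := by
    refine monotoneOn_of_deriv_nonneg (convex_Icc 0 1)
      (fun t _ => (hg' t).continuousAt.continuousWithinAt)
      (fun t _ => (hg' t).differentiableAt.differentiableWithinAt) fun t ht => ?_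
    rw [(hg' t).deriv]
    rw [interior_Icc] at ht
    linarith [hK t ⟨ht.1.le, ht.2.le⟩]
  have hg : ∀ t, HasDerivAt (fun t => f t - f' 0 * t - K / 2 * t ^ 2) (f' t - f' 0 - K * t) t := by
    intro t
    exact (((hf t).fun_sub ((hasDerivAt_id' t).const_mul (f' 0))).fun_sub
      ((hasDerivAt_pow 2 t).const_mul (K / 2))).congr_deriv (by norm_num; ring)
  have hmono : MonotoneOn (fun t => f t - f' 0 * t - K / 2 * t ^ 2) (Set.Icc 0 1) := by
    refine monotoneOn_of_deriv_nonneg (convex_Icc 0 1)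
      (fun t _ => (hg t).continuousAt.continuousWithinAt)
      (fun t _ => (hg t).differentiableAt.differentiableWithinAt) fun t ht => ?_
    rw [(hg t).deriv]
    rw [interior_Icc] at ht
    have := hmono' (Set.left_mem_Icc.mpr zero_le_one) ⟨ht.1.le, ht.2.le⟩ ht.1.le
    simp only [mul_zero, sub_zero] at this
    linarith
  have := hmono (Set.left_mem_Icc.mpr zero_le_one) (Set.right_mem_Icc.mpr zero_le_one) zero_le_one
  simp only [mul_zero, sub_zero, mul_one, one_pow, ne_eq, OfNat.ofNat_ne_zero, not_false_eq_true,
    zero_pow] at this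
  linarith

/-- Strong convexity of the log-sum-exp function along directions in which the spread of the
exponents stays bounded. -/
theorem log_sum_exp_ge {ι : Type*} (s : Finset ι) (hs : s.Nonempty) (a b : ι → ℝ) {β K : ℝ}
    (ha : ∀ m ∈ s, ∀ m' ∈ s, a m' - a m ≤ β)
    (hab : ∀ m ∈ s, ∀ m' ∈ s, (a m' + b m') - (a m + b m) ≤ β)
    (hK : ∀ c, K ≤ ∑ m ∈ s, (b m - c) ^ 2) :
    Real.log (∑ m ∈ s, Real.exp (a m)) +
        (∑ m ∈ s, Real.exp (a m) * b m) / (∑ m ∈ s, Real.exp (a m)) +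
        Real.exp (-β) / s.card * K / 2 ≤ Real.log (∑ m ∈ s, Real.exp (a m + b m)) := by
  set Z : ℝ → ℝ := fun t => ∑ m ∈ s, Real.exp (a m + t * b m) with hZ
  set Z1 : ℝ → ℝ := fun t => ∑ m ∈ s, Real.exp (a m + t * b m) * b m with hZ1
  set Z2 : ℝ → ℝ := fun t => ∑ m ∈ s, Real.exp (a m + t * b m) * b m * b m with hZ2
  have hpos : ∀ t, 0 < Z t := fun t => Finset.sum_pos (fun _ _ => Real.exp_pos _) hs
  have hlin : ∀ (t : ℝ) (m : ι), HasDerivAt (fun t => Real.exp (a m + t * b m))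
      (Real.exp (a m + t * b m) * b m) t := by
    intro t m
    have := (((hasDerivAt_id t).mul_const (b m)).const_add (a m)).exp
    simpa using this
  have hdZ : ∀ t, HasDerivAt Z (Z1 t) t := fun t =>
    HasDerivAt.fun_sum fun m _ => hlin t m
  have hdZ1 : ∀ t, HasDerivAt Z1 (Z2 t) t := fun t =>
    HasDerivAt.fun_sum fun m _ => (hlin t m).mul_const (b m)
  have key := le_of_hasDerivAt_of_le (f := fun t => Real.log (Z t)) (f' := fun t => Z1 t / Z t)
    (f'' := fun t => (Z2 t * Z t - Z1 t * Z1 t) / Z t ^ 2)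
    (K := Real.exp (-β) / s.card * K)
    (fun t => (hdZ t).log (hpos t).ne')
    (fun t => (hdZ1 t).div (hdZ t) (hpos t).ne') ?_
  · simpa [hZ, hZ1] using key
  intro t ht
  have hcard : (0 : ℝ) < s.card := by exact_mod_cast hs.card_pos
  -- The spread is controlled at both ends of the segment, and exponents are affine in `t`.
  have hspread : ∀ m ∈ s, ∀ m' ∈ s, (a m' + t * b m') - (a m + t * b m) ≤ β := by
    intro m hm m' hm'
    have e1 := mul_le_mul_of_nonneg_left (ha m hm m' hm') (sub_nonneg.mpr ht.2)
    have e2 := mul_le_mul_of_nonneg_left (hab m hm m' hm') ht.1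
    nlinarith
  -- Every softmax weight is at least `exp (-β) / |s|`, so the softmax variance dominates this
  -- multiple of a sum of squares.
  have hlow : ∀ m ∈ s, Real.exp (-β) / s.card * Z t ≤ Real.exp (a m + t * b m) := by
    intro m hm
    have : Z t ≤ s.card * (Real.exp β * Real.exp (a m + t * b m)) := by
      rw [← nsmul_eq_mul]
      refine Finset.sum_le_card_nsmul _ _ _ fun m' hm' => ?_
      rw [← Real.exp_add]
      exact Real.exp_le_exp.mpr (by linarith [hspread m hm m' hm'])
    calc Real.exp (-β) / s.card * Z t
        ≤ Real.exp (-β) / s.card * (s.card * (Real.exp β * Real.exp (a m + t * b m))) := by gcongr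
      _ = (Real.exp (-β) * Real.exp β) * Real.exp (a m + t * b m) := by field_simp
      _ = Real.exp (a m + t * b m) := by rw [← Real.exp_add]; simp
  set c := Z1 t / Z t with hc
  -- The second derivative of log-sum-exp is the variance of `b` under the softmax weights, centred
  -- at its mean `c`.
  have hvar : (Z2 t * Z t - Z1 t * Z1 t) / Z t ^ 2 =
      (∑ m ∈ s, Real.exp (a m + t * b m) * (b m - c) ^ 2) / Z t := by
    have : ∑ m ∈ s, Real.exp (a m + t * b m) * (b m - c) ^ 2 =
        Z2 t - 2 * c * Z1 t + c ^ 2 * Z t := by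
      simp only [hZ, hZ1, hZ2, Finset.mul_sum, ← Finset.sum_sub_distrib, ← Finset.sum_add_distrib]
      exact Finset.sum_congr rfl fun m _ => by ring
    rw [this, hc]
    field_simp [(hpos t).ne']
    ring
  rw [hvar, le_div_iff₀ (hpos t)]
  calc Real.exp (-β) / s.card * K * Z t
      ≤ Real.exp (-β) / s.card * (∑ m ∈ s, (b m - c) ^ 2) * Z t := by
        have := hpos t
        gcongr
        exact hK c
    _ = ∑ m ∈ s, (Real.exp (-β) / s.card * Z t) * (b m - c) ^ 2 := by
        rw [← Finset.mul_sum]; ring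
    _ ≤ _ := Finset.sum_le_sum fun m hm => mul_le_mul_of_nonneg_right (hlow m hm) (sq_nonneg _)

/-- The score vector of a ranked list: the gradient of its log-likelihood. -/
noncomputable def score {d₂ k : ℕ} (θ : Fin d₂ → ℝ) (v : Fin k → Fin d₂) (j : Fin d₂) : ℝ :=
  ∑ ℓ, ((if v ℓ = j then 1 else 0) -
    (∑ m ∈ Finset.Ici ℓ, Real.exp (θ (v m)) * (if v m = j then 1 else 0)) /
      ∑ m ∈ Finset.Ici ℓ, Real.exp (θ (v m)))

theorem sum_score_mul {d₂ k : ℕ} (θ : Fin d₂ → ℝ) (v : Fin k → Fin d₂) (x : Fin d₂ → ℝ) :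
    ∑ j, score θ v j * x j = ∑ ℓ, (x (v ℓ) -
      (∑ m ∈ Finset.Ici ℓ, Real.exp (θ (v m)) * x (v m)) /
        ∑ m ∈ Finset.Ici ℓ, Real.exp (θ (v m))) := by
  simp only [score, Finset.sum_mul]
  rw [Finset.sum_comm]
  refine Finset.sum_congr rfl fun ℓ _ => ?_
  simp only [sub_mul, Finset.sum_sub_distrib, ite_mul, one_mul, zero_mul, Finset.sum_ite_eq,
    Finset.mem_univ, if_true]
  congr 1
  simp only [div_mul_eq_mul_div, ← Finset.sum_div, Finset.sum_mul]
  rw [Finset.sum_comm]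
  congr 1
  refine Finset.sum_congr rfl fun m _ => ?_
  simp only [mul_assoc, ← Finset.mul_sum, ite_mul, one_mul, zero_mul, Finset.sum_ite_eq,
    Finset.mem_univ, if_true]

/-- Strong convexity of the negative log-likelihood. -/
theorem negLogLik_sub_ge {d₁ d₂ k : ℕ} (v : Fin d₁ → Fin k → Fin d₂)
    (Θ D : Matrix (Fin d₁) (Fin d₂) ℝ) {β : ℝ} (K : Fin d₁ → Fin k → ℝ)
    (h1 : ∀ i j j', Θ i j' - Θ i j ≤ β) (h2 : ∀ i j j', (Θ + D) i j' - (Θ + D) i j ≤ β)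
    (hK0 : ∀ i ℓ, 0 ≤ K i ℓ)
    (hK : ∀ i ℓ c, K i ℓ ≤ ∑ m ∈ Finset.Ici ℓ, (D i (v i m) - c) ^ 2) :
    1 / ((k : ℝ) * d₁) * (Real.exp (-β) / (2 * k) * ∑ i, ∑ ℓ, K i ℓ -
      ∑ i, ∑ j, score (Θ i) (v i) j * D i j) ≤ negLogLik v (Θ + D) - negLogLik v Θ := by
  have hrw : negLogLik v (Θ + D) - negLogLik v Θ = 1 / ((k : ℝ) * d₁) * ∑ i, ∑ ℓ,
      (Real.log (∑ m ∈ Finset.Ici ℓ, Real.exp (Θ i (v i m) + D i (v i m))) -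
        Real.log (∑ m ∈ Finset.Ici ℓ, Real.exp (Θ i (v i m))) - D i (v i ℓ)) := by
    simp only [negLogLik]
    rw [neg_mul, neg_mul, sub_neg_eq_add, neg_add_eq_sub, ← mul_sub, ← Finset.sum_sub_distrib]
    congr 1
    refine Finset.sum_congr rfl fun i _ => ?_
    rw [← Finset.sum_sub_distrib]
    refine Finset.sum_congr rfl fun ℓ _ => ?_
    simp only [Matrix.add_apply]
    ring
  rw [hrw]
  refine mul_le_mul_of_nonneg_left ?_ (by positivity)
  rw [Finset.mul_sum, ← Finset.sum_sub_distrib]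
  refine Finset.sum_le_sum fun i _ => ?_
  rw [sum_score_mul, Finset.mul_sum, ← Finset.sum_sub_distrib]
  refine Finset.sum_le_sum fun ℓ _ => ?_
  have hne : (Finset.Ici ℓ).Nonempty := ⟨ℓ, by simp⟩
  have key := log_sum_exp_ge (Finset.Ici ℓ) hne (fun m => Θ i (v i m)) (fun m => D i (v i m))
    (β := β) (K := K i ℓ) (fun m _ m' _ => h1 i _ _) (fun m _ m' _ => h2 i _ _) (hK i ℓ)
  have hcard : ((Finset.Ici ℓ).card : ℝ) ≤ k := by
    exact_mod_cast (Finset.card_le_univ _).trans (by simp)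
  have hcard0 : (0 : ℝ) < (Finset.Ici ℓ).card := by exact_mod_cast hne.card_pos
  have : Real.exp (-β) / (2 * k) * K i ℓ ≤ Real.exp (-β) / (Finset.Ici ℓ).card * K i ℓ / 2 := by
    have e : Real.exp (-β) / (2 * k) * K i ℓ = Real.exp (-β) / k * K i ℓ / 2 := by
      field_simp
    rw [e]
    have := hK0 i ℓ
    gcongr
  linarith

end Likelihood

end MNLRanking

namespace MNLRanking

/-! ### Moments of martingale sums along an MNL ranking. -/

section RankingMoments

/-- Hoeffding's lemma for a finite distribution on a symmetric interval. -/
theorem sum_mul_exp_le {ι : Type*} [Fintype ι] (q X : ι → ℝ) (hq : ∀ i, 0 ≤ q i)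
    (hq1 : ∑ i, q i = 1) (hX : ∑ i, q i * X i = 0) {b : ℝ} (hb : ∀ i, |X i| ≤ b) :
    ∑ i, q i * Real.exp (X i) ≤ Real.exp (b ^ 2 / 2) := by
  have hne : Nonempty ι := by
    by_contra h
    rw [not_nonempty_iff] at h
    simp at hq1
  obtain ⟨i0⟩ := hne
  have hb0 : 0 ≤ b := (abs_nonneg _).trans (hb i0)
  rcases hb0.eq_or_lt with rfl | hbpos
  · have : ∀ i, X i = 0 := fun i => abs_nonpos_iff.mp (hb i)
    simp [this, hq1]
  -- The chord of `exp` over `[-b, b]`; its linear part disappears in the mean.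
  have hpt : ∀ i, Real.exp (X i) ≤ Real.cosh b + X i * (Real.sinh b / b) := by
    intro i
    have h1 := (abs_le.mp (hb i)).1
    have h2 := (abs_le.mp (hb i)).2
    have := convexOn_exp.2 (Set.mem_univ b) (Set.mem_univ (-b))
      (div_nonneg (by linarith) (by linarith) : 0 ≤ (b + X i) / (2 * b))
      (div_nonneg (by linarith) (by linarith) : 0 ≤ (b - X i) / (2 * b))
      (by field_simp; ring)
    have e : ((b + X i) / (2 * b)) • b + ((b - X i) / (2 * b)) • (-b) = X i := by
      simp only [smul_eq_mul]; field_simp; ring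
    rw [e] at this
    refine this.trans (le_of_eq ?_)
    rw [Real.cosh_eq, Real.sinh_eq]
    simp only [smul_eq_mul]
    field_simp
    ring
  calc ∑ i, q i * Real.exp (X i) ≤ ∑ i, q i * (Real.cosh b + X i * (Real.sinh b / b)) :=
        Finset.sum_le_sum fun i _ => mul_le_mul_of_nonneg_left (hpt i) (hq i)
    _ = Real.cosh b * ∑ i, q i + (∑ i, q i * X i) * (Real.sinh b / b) := by
        rw [Finset.mul_sum, Finset.sum_mul, ← Finset.sum_add_distrib]
        exact Finset.sum_congr rfl fun i _ => by ring
    _ = Real.cosh b := by rw [hq1, hX]; ring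
    _ ≤ _ := Real.cosh_le_exp_half_sq b

/-- One step of the exponential supermartingale argument for the squared norm of a martingale. -/
theorem sum_mul_exp_norm_sq_le {ι V : Type*} [Fintype ι] [NormedAddCommGroup V]
    [InnerProductSpace ℝ V] (q : ι → ℝ) (ξ : ι → V) (hq : ∀ i, 0 ≤ q i)
    (hq1 : ∑ i, q i = 1) (hξ : ∑ i, q i • ξ i = 0) (hb : ∀ i, ‖ξ i‖ ^ 2 ≤ 2) (a : V) {β η N : ℝ}
    (hη : η = 1 / (16 * N)) (hN : 0 < N) (hβ0 : 0 ≤ β) (hβ : β ≤ 2 * η) :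
    ∑ i, q i * Real.exp (β * ‖a + ξ i‖ ^ 2) ≤ Real.exp ((β + η / N) * ‖a‖ ^ 2 + 4 * η) := by
  have h1 : ∀ i, Real.exp (β * ‖a + ξ i‖ ^ 2) ≤
      Real.exp (β * ‖a‖ ^ 2 + 4 * η) * Real.exp (2 * β * inner ℝ a (ξ i)) := by
    intro i
    rw [← Real.exp_add, norm_add_sq_real]
    refine Real.exp_le_exp.mpr ?_
    nlinarith [mul_le_mul_of_nonneg_left (hb i) hβ0]
  have h2 : ∑ i, q i * Real.exp (2 * β * inner ℝ a (ξ i)) ≤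
      Real.exp ((2 * β * (‖a‖ * Real.sqrt 2)) ^ 2 / 2) := by
    refine sum_mul_exp_le q _ hq hq1 ?_ fun i => ?_
    · have : ∑ i, q i * (2 * β * inner ℝ a (ξ i)) = 2 * β * inner ℝ a (∑ i, q i • ξ i) := by
        rw [inner_sum, Finset.mul_sum]
        refine Finset.sum_congr rfl fun i _ => ?_
        rw [inner_smul_right]; ring
      rw [this, hξ, inner_zero_right, mul_zero]
    · rw [abs_mul, abs_of_nonneg (by positivity : 0 ≤ 2 * β)]
      refine mul_le_mul_of_nonneg_left ((abs_real_inner_le_norm _ _).trans ?_) (by positivity)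
      exact mul_le_mul_of_nonneg_left (Real.le_sqrt_of_sq_le (hb i)) (norm_nonneg _)
  calc ∑ i, q i * Real.exp (β * ‖a + ξ i‖ ^ 2)
      ≤ ∑ i, q i * (Real.exp (β * ‖a‖ ^ 2 + 4 * η) * Real.exp (2 * β * inner ℝ a (ξ i))) :=
        Finset.sum_le_sum fun i _ => mul_le_mul_of_nonneg_left (h1 i) (hq i)
    _ = Real.exp (β * ‖a‖ ^ 2 + 4 * η) * ∑ i, q i * Real.exp (2 * β * inner ℝ a (ξ i)) := by
        rw [Finset.mul_sum]
        exact Finset.sum_congr rfl fun i _ => by ring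
    _ ≤ Real.exp (β * ‖a‖ ^ 2 + 4 * η) * Real.exp ((2 * β * (‖a‖ * Real.sqrt 2)) ^ 2 / 2) := by
        gcongr
    _ ≤ _ := by
        rw [← Real.exp_add]
        refine Real.exp_le_exp.mpr ?_
        have e : (2 * β * (‖a‖ * Real.sqrt 2)) ^ 2 / 2 = 4 * β ^ 2 * ‖a‖ ^ 2 := by
          rw [mul_pow, mul_pow ‖a‖, Real.sq_sqrt (by norm_num)]; ring
        -- This fixes `η = 1 / (16 * N)`: for `β ≤ 2 * η`, a step raises the coefficient of `‖a‖ ^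
        -- 2` by at most `η / N`, so it stays below `2 * η` for `N` steps.
        have e2 : 4 * β ^ 2 ≤ η / N := by
          have : η / N = 4 * (2 * η) ^ 2 := by rw [hη]; field_simp; ring
          rw [this]
          gcongr
        rw [e]
        nlinarith [mul_le_mul_of_nonneg_right e2 (sq_nonneg ‖a‖)]

variable {V : Type*} [NormedAddCommGroup V] [InnerProductSpace ℝ V]

/-- The mean of `x` under the softmax distribution with utilities `w`. -/
noncomputable def softMean {ι : Type*} (s : Finset ι) (w : ι → ℝ) (x : ι → V) : V :=
  (∑ m ∈ s, Real.exp (w m))⁻¹ • ∑ m ∈ s, Real.exp (w m) • x m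

/-- The sum over the positions of a ranking of the deviations of `x` at the chosen slot from its
conditional mean. -/
noncomputable def rankDev {k : ℕ} (w : Fin k → ℝ) (x : Fin k → V) (σ : Equiv.Perm (Fin k)) : V :=
  ∑ ℓ, (x (σ ℓ) - softMean (Finset.Ici ℓ) (fun m => w (σ m)) fun m => x (σ m))

/-- After the first choice `p`, the rest is an MNL ranking of the remaining slots, listed as
`Equiv.swap 0 p y.succ`. This recursion drives all the moment bounds by induction on `k`. -/
theorem rankDev_decompose {k : ℕ} (w : Fin (k + 1) → ℝ) (x : Fin (k + 1) → V) (p : Fin (k + 1))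
    (e : Equiv.Perm (Fin k)) :
    rankDev w x (Equiv.Perm.decomposeFin.symm (p, e)) =
      (x p - softMean Finset.univ w x) +
        rankDev (fun y : Fin k => w (Equiv.swap 0 p y.succ))
          (fun y : Fin k => x (Equiv.swap 0 p y.succ)) e := by
  unfold rankDev
  rw [Fin.sum_univ_succ]
  congr 1
  · have h : (Finset.Ici (0 : Fin (k + 1))) = Finset.univ := by
      ext x; simp
    rw [h, softMean, softMean,
      Equiv.sum_comp (Equiv.Perm.decomposeFin.symm (p, e)) fun m => Real.exp (w m),
      Equiv.sum_comp (Equiv.Perm.decomposeFin.symm (p, e)) fun m => Real.exp (w m) • x m]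
    simp
  · refine Finset.sum_congr rfl fun ℓ _ => ?_
    have h : Finset.Ici ℓ.succ = (Finset.Ici ℓ).map (Fin.succEmb k) := by
      ext x
      refine Fin.cases ?_ (fun y => ?_) x
      · simp [Fin.succ_ne_zero]
      · simp
    rw [softMean, softMean, h, Finset.sum_map, Finset.sum_map]
    simp

/-- The probability that a slot is ranked first. -/
noncomputable def firstProb {k : ℕ} (w : Fin (k + 1) → ℝ) (p : Fin (k + 1)) : ℝ :=
  Real.exp (w p) / ∑ m, Real.exp (w m)

theorem firstProb_nonneg {k : ℕ} (w : Fin (k + 1) → ℝ) (p : Fin (k + 1)) : 0 ≤ firstProb w p :=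
  div_nonneg (Real.exp_pos _).le (Finset.sum_nonneg fun _ _ => (Real.exp_pos _).le)

theorem sum_firstProb {k : ℕ} (w : Fin (k + 1) → ℝ) : ∑ p, firstProb w p = 1 := by
  simp only [firstProb]
  rw [← Finset.sum_div]
  exact div_self (Finset.sum_pos (fun _ _ => Real.exp_pos _) Finset.univ_nonempty).ne'

theorem softMean_univ {k : ℕ} (w : Fin (k + 1) → ℝ) (x : Fin (k + 1) → V) :
    softMean Finset.univ w x = ∑ p, firstProb w p • x p := by
  rw [softMean, Finset.smul_sum]
  refine Finset.sum_congr rfl fun p _ => ?_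
  rw [smul_smul, firstProb, div_eq_inv_mul]

theorem sum_firstProb_smul_sub {k : ℕ} (w : Fin (k + 1) → ℝ) (x : Fin (k + 1) → V) :
    ∑ p, firstProb w p • (x p - softMean Finset.univ w x) = 0 := by
  simp only [smul_sub, Finset.sum_sub_distrib]
  rw [← Finset.sum_smul, sum_firstProb, one_smul, ← softMean_univ, sub_self]

theorem sum_rankProb_succ {k : ℕ} (w : Fin (k + 1) → ℝ) (f : Equiv.Perm (Fin (k + 1)) → ℝ) :
    ∑ σ, rankProb w σ * f σ = ∑ p, firstProb w p * ∑ e,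
      rankProb (fun y : Fin k => w (Equiv.swap 0 p y.succ)) e *
        f (Equiv.Perm.decomposeFin.symm (p, e)) := by
  rw [← Equiv.sum_comp Equiv.Perm.decomposeFin.symm, Fintype.sum_prod_type]
  refine Finset.sum_congr rfl fun p _ => ?_
  rw [Finset.mul_sum]
  refine Finset.sum_congr rfl fun e _ => ?_
  rw [rankProb_decompose, firstProb, mul_assoc]

theorem sum_rankProb_mul_rankDev {k : ℕ} (w : Fin k → ℝ) (x : Fin k → ℝ) :
    ∑ σ, rankProb w σ * rankDev w x σ = 0 := by
  induction k with
  | zero => simp [rankDev]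
  | succ k ih =>
    rw [sum_rankProb_succ]
    simp only [rankDev_decompose, mul_add, Finset.sum_add_distrib, ih, add_zero]
    simp only [← Finset.sum_mul, sum_rankProb, one_mul]
    simpa using sum_firstProb_smul_sub w x

/-- The second moment of the sum of deviations is at most the sum of the squares. -/
theorem sum_rankProb_mul_rankDev_sq_le {k : ℕ} (w : Fin k → ℝ) (x : Fin k → ℝ) :
    ∑ σ, rankProb w σ * rankDev w x σ ^ 2 ≤ ∑ s, x s ^ 2 := by
  induction k with
  | zero => simp [rankDev]
  | succ k ih =>
    rw [sum_rankProb_succ]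
    set μ := softMean Finset.univ w x with hμ
    have hin : ∀ p, ∑ e, rankProb (fun y : Fin k => w (Equiv.swap 0 p y.succ)) e *
        rankDev w x (Equiv.Perm.decomposeFin.symm (p, e)) ^ 2 ≤
        (x p - μ) ^ 2 + (∑ s, x s ^ 2 - x p ^ 2) := by
      intro p
      have hsum : ∑ y : Fin k, x (Equiv.swap 0 p y.succ) ^ 2 = ∑ s, x s ^ 2 - x p ^ 2 := by
        rw [eq_sub_iff_add_eq, ← Equiv.sum_comp (Equiv.swap 0 p) fun s => x s ^ 2,
          Fin.sum_univ_succ]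
        simp [add_comm]
      have h0 := sum_rankProb_mul_rankDev (fun y : Fin k => w (Equiv.swap 0 p y.succ))
        fun y : Fin k => x (Equiv.swap 0 p y.succ)
      have h2 := ih (fun y : Fin k => w (Equiv.swap 0 p y.succ))
        fun y : Fin k => x (Equiv.swap 0 p y.succ)
      rw [hsum] at h2
      refine le_trans (le_of_eq ?_) (add_le_add_right h2 ((x p - μ) ^ 2))
      rw [← add_zero ((x p - μ) ^ 2), ← mul_zero (2 * (x p - μ)), ← h0, ← mul_one ((x p - μ) ^ 2),
        ← sum_rankProb (fun y : Fin k => w (Equiv.swap 0 p y.succ)), Finset.mul_sum,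
        Finset.mul_sum, ← Finset.sum_add_distrib, ← Finset.sum_add_distrib]
      refine Finset.sum_congr rfl fun e _ => ?_
      rw [rankDev_decompose]
      ring
    refine (Finset.sum_le_sum fun p _ =>
      mul_le_mul_of_nonneg_left (hin p) (firstProb_nonneg w p)).trans ?_
    have hmean : ∑ p, firstProb w p * x p = μ := by
      rw [hμ, softMean_univ]; simp
    -- The chosen slot leaves the sum of squares, which cancels the second moment of the first
    -- choice; the total is `∑ s, x s ^ 2 - μ ^ 2`.
    have e : ∑ p, firstProb w p * ((x p - μ) ^ 2 + (∑ s, x s ^ 2 - x p ^ 2)) =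
        (∑ p, firstProb w p) * (μ ^ 2 + ∑ s, x s ^ 2) - 2 * μ * ∑ p, firstProb w p * x p := by
      rw [Finset.sum_mul, Finset.mul_sum, ← Finset.sum_sub_distrib]
      exact Finset.sum_congr rfl fun p _ => by ring
    rw [e, sum_firstProb, hmean]
    nlinarith [sq_nonneg μ]

/-- A deviation from the mean is a convex combination of differences, so only the diameter of the
vectors matters. -/
theorem norm_sub_softMean_sq_le {k : ℕ} (w : Fin (k + 1) → ℝ) (x : Fin (k + 1) → V)
    (hx : ∀ s s', ‖x s - x s'‖ ^ 2 ≤ 2) (p : Fin (k + 1)) :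
    ‖x p - softMean Finset.univ w x‖ ^ 2 ≤ 2 := by
  have h : x p - softMean Finset.univ w x = ∑ m, firstProb w m • (x p - x m) := by
    simp only [smul_sub, Finset.sum_sub_distrib]
    rw [← Finset.sum_smul, sum_firstProb, one_smul, softMean_univ]
  have h2 : ‖x p - softMean Finset.univ w x‖ ≤ Real.sqrt 2 := by
    rw [h]
    refine (norm_sum_le _ _).trans ?_
    calc ∑ m, ‖firstProb w m • (x p - x m)‖ ≤ ∑ m, firstProb w m * Real.sqrt 2 := by
          refine Finset.sum_le_sum fun m _ => ?_
          rw [norm_smul, Real.norm_of_nonneg (firstProb_nonneg w m)]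
          exact mul_le_mul_of_nonneg_left (Real.le_sqrt_of_sq_le (hx p m)) (firstProb_nonneg w m)
      _ = Real.sqrt 2 := by rw [← Finset.sum_mul, sum_firstProb, one_mul]
  calc _ ≤ Real.sqrt 2 ^ 2 := by gcongr
    _ = 2 := Real.sq_sqrt (by norm_num)

/-- A sub-Gaussian bound for the norm of the sum of deviations. -/
theorem sum_rankProb_mul_exp_le {k : ℕ} (w : Fin k → ℝ) (x : Fin k → V)
    (hx : ∀ s s', ‖x s - x s'‖ ^ 2 ≤ 2) (a : V) {η N : ℝ} (hη : η = 1 / (16 * N)) (hN : 0 < N)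
    (hk : (k : ℝ) ≤ N) :
    ∑ σ, rankProb w σ * Real.exp (η * ‖a + rankDev w x σ‖ ^ 2) ≤
      Real.exp (η * (1 + k / N) * ‖a‖ ^ 2 + 4 * η * k) := by
  have hη0 : 0 ≤ η := by rw [hη]; positivity
  induction k generalizing a with
  | zero => simp [rankDev, rankProb]
  | succ k ih =>
    have hk' : (k : ℝ) ≤ N := by push_cast at hk; linarith
    rw [sum_rankProb_succ]
    have hin : ∀ p, ∑ e, rankProb (fun y : Fin k => w (Equiv.swap 0 p y.succ)) e *
        Real.exp (η * ‖a + rankDev w x (Equiv.Perm.decomposeFin.symm (p, e))‖ ^ 2) ≤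
        Real.exp (η * (1 + k / N) * ‖a + (x p - softMean Finset.univ w x)‖ ^ 2 + 4 * η * k) := by
      intro p
      simp only [rankDev_decompose, ← add_assoc]
      exact ih _ _ (fun s s' => hx _ _) _ hk'
    refine (Finset.sum_le_sum fun p _ =>
      mul_le_mul_of_nonneg_left (hin p) (firstProb_nonneg w p)).trans ?_
    -- The remaining `k` positions have already raised the coefficient to `η * (1 + k / N) ≤ 2 * η`;
    -- the first choice adds one more increment.
    have hstep := sum_mul_exp_norm_sq_le (firstProb w) (fun p => x p - softMean Finset.univ w x)
      (firstProb_nonneg w) (sum_firstProb w) (sum_firstProb_smul_sub w x)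
      (norm_sub_softMean_sq_le w x hx) a (β := η * (1 + k / N)) hη hN (by positivity) (by
        have : k / N ≤ 1 := (div_le_one hN).mpr hk'
        nlinarith)
    simp only [Real.exp_add, ← mul_assoc, ← Finset.sum_mul] at hstep ⊢
    refine (mul_le_mul_of_nonneg_right hstep (Real.exp_pos _).le).trans (le_of_eq ?_)
    rw [← Real.exp_add, ← Real.exp_add, ← Real.exp_add]
    congr 1
    push_cast
    ring

end RankingMoments

end MNLRanking

namespace MNLRanking

/-! ### Expectations under finite product distributions and bounded differences. -/

section ProductExpectation

variable {ι A : Type*} [Fintype ι] [Fintype A]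

/-- The expectation of `f` under the product of the finite distributions `p i`. -/
noncomputable def prodE (p : ι → A → ℝ) (f : (ι → A) → ℝ) : ℝ :=
  open Classical in ∑ ω, (∏ i, p i (ω i)) * f ω

/-- The weights `p i` are probability distributions. -/
structure IsProbWeight (p : ι → A → ℝ) : Prop where
  nonneg : ∀ i a, 0 ≤ p i a
  sum_eq_one : ∀ i, ∑ a, p i a = 1

theorem prodE_eq [DecidableEq ι] (p : ι → A → ℝ) (f : (ι → A) → ℝ) :
    prodE p f = ∑ ω, (∏ i, p i (ω i)) * f ω := by
  unfold prodE
  congr!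

theorem prodE_mono {p : ι → A → ℝ} (hp : IsProbWeight p) {f g : (ι → A) → ℝ}
    (h : ∀ ω, f ω ≤ g ω) : prodE p f ≤ prodE p g := by
  classical
  exact Finset.sum_le_sum fun ω _ =>
    mul_le_mul_of_nonneg_left (h ω) (Finset.prod_nonneg fun i _ => hp.nonneg i _)

theorem prodE_add (p : ι → A → ℝ) (f g : (ι → A) → ℝ) :
    prodE p (fun ω => f ω + g ω) = prodE p f + prodE p g := by
  simp [prodE, mul_add, Finset.sum_add_distrib]

theorem prodE_sum {κ : Type*} (s : Finset κ) (p : ι → A → ℝ) (f : κ → (ι → A) → ℝ) :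
    prodE p (fun ω => ∑ x ∈ s, f x ω) = ∑ x ∈ s, prodE p (f x) := by
  simp only [prodE, Finset.mul_sum]
  exact Finset.sum_comm

theorem prodE_const_mul (p : ι → A → ℝ) (c : ℝ) (f : (ι → A) → ℝ) :
    prodE p (fun ω => c * f ω) = c * prodE p f := by
  simp only [prodE, Finset.mul_sum]
  exact Finset.sum_congr rfl fun _ _ => by ring

theorem prodE_coord {p : ι → A → ℝ} (hp : IsProbWeight p) (i : ι) (h : A → ℝ) :
    prodE p (fun ω => h (ω i)) = ∑ a, p i a * h a := by
  classical
  have e : ∀ ω : ι → A, (∏ l, p l (ω l)) * h (ω i) =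
      ∏ l, (p l (ω l) * if l = i then h (ω l) else 1) := by
    intro ω
    rw [Finset.prod_mul_distrib, Finset.prod_ite_eq' Finset.univ i]
    simp
  rw [prodE_eq]
  simp only [e]
  rw [← Fintype.piFinset_univ, ← Finset.prod_univ_sum (fun _ => Finset.univ)
    (fun l a => p l a * if l = i then h a else 1), Finset.prod_eq_single i]
  · simp
  · intro l _ hl
    simp [hl, hp.sum_eq_one]
  · simp

theorem prodE_const {p : ι → A → ℝ} (hp : IsProbWeight p) (c : ℝ) : prodE p (fun _ => c) = c := by
  classical
  have h : ∑ ω : ι → A, ∏ i, p i (ω i) = 1 := by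
    rw [← Fintype.piFinset_univ, ← Finset.prod_univ_sum (fun _ => Finset.univ)]
    simp [hp.sum_eq_one]
  rw [prodE_eq, ← Finset.sum_mul, h, one_mul]

theorem prodE_reindex {κ : Type*} [Fintype κ] (e : ι ≃ κ) (p : ι → A → ℝ) (f : (ι → A) → ℝ) :
    prodE p f = prodE (fun x => p (e.symm x)) (fun ω => f fun i => ω (e i)) := by
  classical
  rw [prodE_eq, prodE_eq, ← Equiv.sum_comp (e.arrowCongr (Equiv.refl A))]
  refine Finset.sum_congr rfl fun ω _ => ?_
  congr 1
  · rw [← Equiv.prod_comp e]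
    simp
  · congr 1
    funext i
    simp

theorem prodE_curry {κ : Type*} [Fintype κ] [DecidableEq κ] (p : ι × κ → A → ℝ) (f : (ι × κ → A) → ℝ) :
    prodE p f = prodE (fun i (x : κ → A) => ∏ l, p (i, l) (x l))
      (fun ω => f fun q => ω q.1 q.2) := by
  classical
  rw [prodE_eq, prodE_eq, ← Equiv.sum_comp (Equiv.curry ι κ A).symm]
  refine Finset.sum_congr rfl fun ω _ => ?_
  rw [Fintype.prod_prod_type]
  rfl

theorem prodE_succ {n : ℕ} (p : Fin (n + 1) → A → ℝ) (f : (Fin (n + 1) → A) → ℝ) :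
    prodE p f = ∑ a, p 0 a * prodE (fun i => p i.succ) (fun ω => f (Fin.cons a ω)) := by
  rw [prodE_eq, ← Equiv.sum_comp (Fin.consEquiv fun _ => A), Fintype.sum_prod_type]
  refine Finset.sum_congr rfl fun a _ => ?_
  rw [prodE_eq, Finset.mul_sum]
  refine Finset.sum_congr rfl fun ω _ => ?_
  simp [Fin.prod_univ_succ, Fin.consEquiv, mul_assoc]

theorem IsProbWeight.tail {n : ℕ} {p : Fin (n + 1) → A → ℝ} (hp : IsProbWeight p) :
    IsProbWeight fun i : Fin n => p i.succ :=
  ⟨fun i => hp.nonneg i.succ, fun i => hp.sum_eq_one i.succ⟩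

theorem prodE_sub (p : ι → A → ℝ) (f g : (ι → A) → ℝ) :
    prodE p (fun ω => f ω - g ω) = prodE p f - prodE p g := by
  simp [prodE, mul_sub, Finset.sum_sub_distrib]

/-- The bounded difference inequality, in its exponential form. -/
theorem prodE_exp_le_of_bounded_diff {n : ℕ} {p : Fin n → A → ℝ} (hp : IsProbWeight p)
    (f : (Fin n → A) → ℝ) {b : ℝ}
    (hf : ∀ ω i a, |f (Function.update ω i a) - f ω| ≤ b) (s : ℝ) :
    prodE p (fun ω => Real.exp (s * f ω)) ≤
      Real.exp (s * prodE p f + n * ((s * b) ^ 2 / 2)) := by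
  induction n with
  | zero => simp [prodE]
  | succ n ih =>
    rw [prodE_succ, prodE_succ]
    -- The Doob martingale: `F` is the conditional mean given the first coordinate, and it inherits
    -- the bounded difference `b`.
    set F : A → ℝ := fun a => prodE (fun i => p i.succ) (fun ω => f (Fin.cons a ω)) with hF
    have hin : ∀ a, prodE (fun i => p i.succ) (fun ω => Real.exp (s * f (Fin.cons a ω))) ≤
        Real.exp (s * F a + n * ((s * b) ^ 2 / 2)) := by
      intro a
      refine ih hp.tail (fun ω => f (Fin.cons a ω)) fun ω i a' => ?_
      rw [Fin.cons_update]
      exact hf _ _ _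
    set m := ∑ a, p 0 a * F a with hm
    have hdiff : ∀ a a', |F a - F a'| ≤ b := by
      intro a a'
      have hpt : ∀ ω : Fin n → A, |f (Fin.cons a ω) - f (Fin.cons a' ω)| ≤ b := by
        intro ω
        have := hf (Fin.cons a' ω : Fin (n + 1) → A) 0 a
        rwa [Fin.update_cons_zero] at this
      rw [hF]
      simp only
      rw [← prodE_sub, abs_le]
      constructor
      · rw [← prodE_const hp.tail (-b)]
        exact prodE_mono hp.tail fun ω => (abs_le.mp (hpt ω)).1
      · conv_rhs => rw [← prodE_const hp.tail b]
        exact prodE_mono hp.tail fun ω => (abs_le.mp (hpt ω)).2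
    have hdev : ∀ a, |s * (F a - m)| ≤ |s| * b := by
      intro a
      rw [abs_mul]
      refine mul_le_mul_of_nonneg_left ?_ (abs_nonneg s)
      have : F a - m = ∑ a', p 0 a' * (F a - F a') := by
        simp only [mul_sub, Finset.sum_sub_distrib, ← Finset.sum_mul, hp.sum_eq_one, one_mul, hm]
      rw [this]
      refine (Finset.abs_sum_le_sum_abs _ _).trans ?_
      calc ∑ a', |p 0 a' * (F a - F a')| ≤ ∑ a', p 0 a' * b := by
            refine Finset.sum_le_sum fun a' _ => ?_
            rw [abs_mul, abs_of_nonneg (hp.nonneg 0 a')]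
            exact mul_le_mul_of_nonneg_left (hdiff a a') (hp.nonneg 0 a')
        _ = b := by rw [← Finset.sum_mul, hp.sum_eq_one, one_mul]
    have hmean : ∑ a, p 0 a * (s * (F a - m)) = 0 := by
      have : ∑ a, p 0 a * (s * (F a - m)) = s * (m - (∑ a, p 0 a) * m) := by
        rw [hm, Finset.sum_mul, ← Finset.sum_sub_distrib, Finset.mul_sum]
        exact Finset.sum_congr rfl fun a _ => by ring
      rw [this, hp.sum_eq_one]; ring
    have hstep := sum_mul_exp_le (p 0) _ (hp.nonneg 0) (hp.sum_eq_one 0) hmean hdev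
    calc ∑ a, p 0 a * prodE (fun i => p i.succ) (fun ω => Real.exp (s * f (Fin.cons a ω)))
        ≤ ∑ a, p 0 a * Real.exp (s * F a + n * ((s * b) ^ 2 / 2)) :=
          Finset.sum_le_sum fun a _ => mul_le_mul_of_nonneg_left (hin a) (hp.nonneg 0 a)
      _ = (∑ a, p 0 a * Real.exp (s * (F a - m))) *
            Real.exp (s * m + n * ((s * b) ^ 2 / 2)) := by
          rw [Finset.sum_mul]
          refine Finset.sum_congr rfl fun a _ => ?_
          rw [mul_assoc, ← Real.exp_add]
          ring_nf
      _ ≤ Real.exp ((|s| * b) ^ 2 / 2) * Real.exp (s * m + n * ((s * b) ^ 2 / 2)) := by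
          gcongr
      _ = _ := by
          rw [← Real.exp_add, mul_pow, sq_abs, ← mul_pow]
          push_cast
          ring_nf

/-- The probability of `S` under the product of the finite distributions `p i`. -/
noncomputable def prodP (p : ι → A → ℝ) (S : Set (ι → A)) : ℝ := prodE p (S.indicator 1)

theorem prodP_le_prodE {p : ι → A → ℝ} (hp : IsProbWeight p) {S : Set (ι → A)}
    {f : (ι → A) → ℝ} (h0 : ∀ ω, 0 ≤ f ω) (h1 : ∀ ω ∈ S, 1 ≤ f ω) : prodP p S ≤ prodE p f := by
  classical
  refine prodE_mono hp fun ω => ?_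
  by_cases h : ω ∈ S
  · simpa [h] using h1 ω h
  · simpa [h] using h0 ω

theorem prodP_union_le {p : ι → A → ℝ} (hp : IsProbWeight p) (S T : Set (ι → A)) :
    prodP p (S ∪ T) ≤ prodP p S + prodP p T := by
  classical
  rw [prodP, prodP, prodP, ← prodE_add]
  refine prodE_mono hp fun ω => ?_
  by_cases h : ω ∈ S <;> by_cases h' : ω ∈ T <;> simp [h, h']

theorem prodP_iUnion_le {p : ι → A → ℝ} (hp : IsProbWeight p) {κ : Type*} [Fintype κ]
    (S : κ → Set (ι → A)) : prodP p (⋃ x, S x) ≤ ∑ x, prodP p (S x) := by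
  classical
  simp only [prodP]
  rw [← prodE_sum]
  refine prodE_mono hp fun ω => ?_
  have hnn : ∀ x, 0 ≤ (S x).indicator (1 : (ι → A) → ℝ) ω := fun x =>
    Set.indicator_nonneg (fun _ _ => zero_le_one) ω
  by_cases h : ω ∈ ⋃ x, S x
  · obtain ⟨x, hx⟩ := Set.mem_iUnion.mp h
    rw [Set.indicator_of_mem h]
    refine le_trans ?_ (Finset.single_le_sum (fun x _ => hnn x) (Finset.mem_univ x))
    rw [Set.indicator_of_mem hx]
  · rw [Set.indicator_of_notMem h]
    exact Finset.sum_nonneg fun x _ => hnn x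

theorem prodP_mono {p : ι → A → ℝ} (hp : IsProbWeight p) {S T : Set (ι → A)} (h : S ⊆ T) :
    prodP p S ≤ prodP p T :=
  prodE_mono hp (Set.indicator_le_indicator_of_subset h fun _ => zero_le_one)

/-- The bounded difference inequality for the upper tail. -/
theorem prodP_le_of_bounded_diff {p : ι → A → ℝ} (hp : IsProbWeight p)
    (f : (ι → A) → ℝ) {b t : ℝ} (hb : 0 < b) (ht : 0 ≤ t) (hn : 0 < Fintype.card ι)
    (hf : ∀ ω i a ω', ω' i = a → (∀ l ≠ i, ω' l = ω l) → |f ω' - f ω| ≤ b)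
    (hS : prodE p f ≤ -t) :
    prodP p {ω | 0 < f ω} ≤ Real.exp (-(t ^ 2 / (2 * Fintype.card ι * b ^ 2))) := by
  classical
  set n := Fintype.card ι with hn'
  let e : ι ≃ Fin n := Fintype.equivFin ι
  -- The minimizer of the Chernoff exponent `-s * t + n * (s * b) ^ 2 / 2`.
  set s : ℝ := t / (n * b ^ 2) with hs
  have hnR : (0 : ℝ) < n := by exact_mod_cast hn
  have hs0 : 0 ≤ s := by positivity
  have hp' : IsProbWeight fun x => p (e.symm x) :=
    ⟨fun i => hp.nonneg _, fun i => hp.sum_eq_one _⟩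
  have h1 := prodE_exp_le_of_bounded_diff hp' (fun ω => f fun i => ω (e i)) (b := b)
    (fun ω i a => hf _ (e.symm i) a _ (by simp) fun l hl => by
      rw [Function.update_of_ne]
      rintro rfl
      simp at hl) s
  rw [← prodE_reindex e p f] at h1
  have h2 : prodE (fun x => p (e.symm x)) (fun ω => Real.exp (s * f fun i => ω (e i))) =
      prodE p fun ω => Real.exp (s * f ω) :=
    (prodE_reindex e p fun ω => Real.exp (s * f ω)).symm
  rw [h2] at h1
  refine (prodP_le_prodE hp (fun ω => (Real.exp_pos (s * f ω)).le) fun ω hω => ?_).trans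
    (h1.trans (Real.exp_le_exp.mpr ?_))
  · exact Real.one_le_exp (mul_nonneg hs0 (le_of_lt hω))
  · have h3 : s * prodE p f ≤ s * (-t) := mul_le_mul_of_nonneg_left hS hs0
    refine (add_le_add_left h3 _).trans (le_of_eq ?_)
    rw [hs]
    field_simp
    ring

end ProductExpectation

end MNLRanking

namespace MNLRanking

/-! ### A matrix Chernoff bound for sums of rank one operators. -/

section RankOneSums

open Module

variable {E : Type*} [NormedAddCommGroup E] [InnerProductSpace ℝ E]

/-- The operator `v ↦ ⟪g, v⟫ g`. -/
noncomputable def rankOneOp (g : E) : E →ₗ[ℝ] E := (innerₛₗ ℝ g).smulRight g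

@[simp]
theorem rankOneOp_apply (g v : E) : rankOneOp g v = inner ℝ g v • g := rfl

theorem rankOneOp_isSymmetric (g : E) : (rankOneOp g).IsSymmetric := by
  intro x y
  simp [inner_smul_left, inner_smul_right, real_inner_comm, mul_comm]

theorem inner_rankOneOp_self (g v : E) : inner ℝ (rankOneOp g v) v = inner ℝ g v ^ 2 := by
  simp [inner_smul_left, sq]

/-- The sum `∑ θⁿ / n! tr(Tⁿ)`, which is the trace of `exp (θ T)`. -/
noncomputable def expTrace (θ : ℝ) (T : E →ₗ[ℝ] E) : ℝ :=
  ∑' n : ℕ, θ ^ n / n.factorial * LinearMap.trace ℝ E (T ^ n)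

/-- Chebyshev's sum inequality: `(l + R) ^ a` and `l ^ b` are both increasing in `l ≥ 0`, hence
positively correlated under the weights `w`. -/
theorem chebyshev_sum_pow {ι : Type*} [Fintype ι] (w l : ι → ℝ) (hw : ∀ i, 0 ≤ w i)
    (hl : ∀ i, 0 ≤ l i) {R : ℝ} (hR : 0 ≤ R) (a b : ℕ) :
    (∑ i, w i * l i ^ b) * (∑ i, w i * (l i + R) ^ a) ≤
      (∑ i, w i) * ∑ i, w i * ((l i + R) ^ a * l i ^ b) := by
  have key : 0 ≤ ∑ i, ∑ j, w i * w j *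
      (((l i + R) ^ a - (l j + R) ^ a) * (l i ^ b - l j ^ b)) := by
    refine Finset.sum_nonneg fun i _ => Finset.sum_nonneg fun j _ =>
      mul_nonneg (mul_nonneg (hw i) (hw j)) ?_
    rcases le_total (l i) (l j) with h | h
    · exact mul_nonneg_of_nonpos_of_nonpos
        (sub_nonpos.mpr (pow_le_pow_left₀ (add_nonneg (hl i) hR) (by linarith) a))
        (sub_nonpos.mpr (pow_le_pow_left₀ (hl i) h b))
    · exact mul_nonneg
        (sub_nonneg.mpr (pow_le_pow_left₀ (add_nonneg (hl j) hR) (by linarith) a))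
        (sub_nonneg.mpr (pow_le_pow_left₀ (hl j) h b))
  have e : ∑ i, ∑ j, w i * w j * (((l i + R) ^ a - (l j + R) ^ a) * (l i ^ b - l j ^ b)) =
      2 * ((∑ i, w i) * ∑ i, w i * ((l i + R) ^ a * l i ^ b)) -
        2 * ((∑ i, w i * l i ^ b) * (∑ i, w i * (l i + R) ^ a)) := by
    have e1 : (∑ i, w i) * ∑ i, w i * ((l i + R) ^ a * l i ^ b) =
        ∑ i, ∑ j, w i * w j * ((l j + R) ^ a * l j ^ b) := by
      rw [Finset.sum_mul_sum]
      exact Finset.sum_congr rfl fun i _ => Finset.sum_congr rfl fun j _ => by ring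
    have e2 : (∑ i, w i) * ∑ i, w i * ((l i + R) ^ a * l i ^ b) =
        ∑ i, ∑ j, w i * w j * ((l i + R) ^ a * l i ^ b) := by
      rw [mul_comm, Finset.sum_mul_sum]
      exact Finset.sum_congr rfl fun i _ => Finset.sum_congr rfl fun j _ => by ring
    have e3 : (∑ i, w i * l i ^ b) * (∑ i, w i * (l i + R) ^ a) =
        ∑ i, ∑ j, w i * w j * ((l j + R) ^ a * l i ^ b) := by
      rw [Finset.sum_mul_sum]
      exact Finset.sum_congr rfl fun i _ => Finset.sum_congr rfl fun j _ => by ring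
    have e4 : (∑ i, w i * l i ^ b) * (∑ i, w i * (l i + R) ^ a) =
        ∑ i, ∑ j, w i * w j * ((l i + R) ^ a * l j ^ b) := by
      rw [mul_comm, Finset.sum_mul_sum]
      exact Finset.sum_congr rfl fun i _ => Finset.sum_congr rfl fun j _ => by ring
    rw [two_mul, two_mul]
    nth_rewrite 1 [e1]
    rw [e2]
    nth_rewrite 1 [e3]
    rw [e4]
    simp only [← Finset.sum_add_distrib, ← Finset.sum_sub_distrib]
    exact Finset.sum_congr rfl fun i _ => Finset.sum_congr rfl fun j _ => by ring
  linarith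

theorem pow_apply_eigenbasis {S : E →ₗ[ℝ] E} {ι : Type*} [Fintype ι]
    (u : OrthonormalBasis ι ℝ E) (l : ι → ℝ) (hu : ∀ i, S (u i) = l i • u i) (b : ℕ) (i : ι) :
    (S ^ b) (u i) = l i ^ b • u i := by
  induction b with
  | zero => simp
  | succ b ih => rw [pow_succ', Module.End.mul_apply, ih, map_smul, hu, smul_smul, pow_succ]

variable [FiniteDimensional ℝ E]

theorem hasSum_expTrace (θ : ℝ) {T : E →ₗ[ℝ] E} (hT : T.IsSymmetric) :
    HasSum (fun n : ℕ => θ ^ n / n.factorial * LinearMap.trace ℝ E (T ^ n))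
      (∑ i, Real.exp (θ * hT.eigenvalues rfl i)) := by
  have htr : ∀ n : ℕ, LinearMap.trace ℝ E (T ^ n) = ∑ i, hT.eigenvalues rfl i ^ n := by
    intro n
    rw [LinearMap.trace_eq_sum_inner _ (hT.eigenvectorBasis rfl)]
    refine Finset.sum_congr rfl fun i _ => ?_
    have : ∀ n : ℕ, (T ^ n) (hT.eigenvectorBasis rfl i) =
        hT.eigenvalues rfl i ^ n • hT.eigenvectorBasis rfl i := by
      intro n
      induction n with
      | zero => simp
      | succ n ih =>
        rw [pow_succ', Module.End.mul_apply, ih, map_smul, hT.apply_eigenvectorBasis, smul_smul,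
          pow_succ]
        rfl
    rw [this, inner_smul_right]
    simp
  simp only [htr, Finset.mul_sum]
  refine hasSum_sum fun i _ => ?_
  have h := NormedSpace.expSeries_div_hasSum_exp (θ * hT.eigenvalues rfl i)
  rw [← Real.exp_eq_exp_ℝ] at h
  exact h.congr_fun fun n => by rw [mul_pow]; ring

theorem expTrace_eq (θ : ℝ) {T : E →ₗ[ℝ] E} (hT : T.IsSymmetric) :
    expTrace θ T = ∑ i, Real.exp (θ * hT.eigenvalues rfl i) :=
  (hasSum_expTrace θ hT).tsum_eq

section Update

variable {S : E →ₗ[ℝ] E} {ι : Type*} [Fintype ι] (u : OrthonormalBasis ι ℝ E) (l : ι → ℝ)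

theorem inner_pow_apply_self (hu : ∀ i, S (u i) = l i • u i) (g : E) (b : ℕ) :
    inner ℝ g ((S ^ b) g) = ∑ i, inner ℝ (u i) g ^ 2 * l i ^ b := by
  conv_lhs => rw [← u.sum_repr' g]
  rw [u.sum_repr' g]
  conv_lhs => arg 3; rw [← u.sum_repr' g]
  rw [map_sum, inner_sum]
  refine Finset.sum_congr rfl fun i _ => ?_
  rw [map_smul, pow_apply_eigenbasis u l hu, inner_smul_right, inner_smul_right,
    real_inner_comm]
  ring

/-- The quadratic form of a mixed power of `S + g gᵀ` and `S` at `g` is dominated by the one in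
which `g gᵀ` is replaced by a multiple of the identity. -/
theorem inner_mixed_pow_le (hu : ∀ i, S (u i) = l i • u i) (hl : ∀ i, 0 ≤ l i) (g : E) {R : ℝ}
    (hR : ‖g‖ ^ 2 ≤ R) (a b : ℕ) :
    inner ℝ g (((S + rankOneOp g) ^ a) ((S ^ b) g)) ≤
      ∑ i, inner ℝ (u i) g ^ 2 * ((l i + R) ^ a * l i ^ b) := by
  have hR0 : 0 ≤ R := (sq_nonneg _).trans hR
  induction a generalizing b with
  | zero => simpa using (inner_pow_apply_self u l hu g b).le
  | succ a ih =>
    -- Expanding the innermost factor leaves a power with one more `S`, and a product of two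
    -- quadratic forms at `g` which `chebyshev_sum_pow` merges into one at the cost of `‖g‖ ^ 2 ≤
    -- R`.
    have h1 : ((S + rankOneOp g) ^ (a + 1)) ((S ^ b) g) =
        ((S + rankOneOp g) ^ a) ((S ^ (b + 1)) g) +
          inner ℝ g ((S ^ b) g) • ((S + rankOneOp g) ^ a) g := by
      rw [pow_succ, Module.End.mul_apply, LinearMap.add_apply, map_add, rankOneOp_apply, map_smul,
        pow_succ' S, Module.End.mul_apply]
    have h2 := ih 0
    rw [pow_zero, Module.End.one_apply] at h2
    simp only [pow_zero, mul_one] at h2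
    have h3 : 0 ≤ inner ℝ g ((S ^ b) g) := by
      rw [inner_pow_apply_self u l hu]
      exact Finset.sum_nonneg fun i _ => mul_nonneg (sq_nonneg _) (pow_nonneg (hl i) _)
    rw [h1, inner_add_right, inner_smul_right]
    have h4 := chebyshev_sum_pow (fun i => inner ℝ (u i) g ^ 2) l (fun i => sq_nonneg _) hl hR0 a b
    rw [← inner_pow_apply_self u l hu] at h4
    have h5 : ∑ i, inner ℝ (u i) g ^ 2 = ‖g‖ ^ 2 := by
      rw [← u.sum_sq_norm_inner_right g]
      simp
    have h6 : 0 ≤ ∑ i, inner ℝ (u i) g ^ 2 * ((l i + R) ^ a * l i ^ b) :=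
      Finset.sum_nonneg fun i _ => mul_nonneg (sq_nonneg _)
        (mul_nonneg (pow_nonneg (add_nonneg (hl i) hR0) _) (pow_nonneg (hl i) _))
    rw [h5] at h4
    have h7 := mul_le_mul_of_nonneg_right hR h6
    have h8 := mul_le_mul_of_nonneg_left h2 h3
    have h9 : ∑ i, inner ℝ (u i) g ^ 2 * ((l i + R) ^ (a + 1) * l i ^ b) =
        ∑ i, inner ℝ (u i) g ^ 2 * ((l i + R) ^ a * l i ^ (b + 1)) +
          R * ∑ i, inner ℝ (u i) g ^ 2 * ((l i + R) ^ a * l i ^ b) := by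
      rw [Finset.mul_sum, ← Finset.sum_add_distrib]
      exact Finset.sum_congr rfl fun i _ => by ring
    rw [h9]
    linarith [ih (b + 1)]

/-- Factors `S + g gᵀ` are turned into `S` one at a time, each leaving a quadratic form at `g`. The
bounds on these forms sum geometrically to `((l + R) ^ a - l ^ a) / R`. -/
theorem trace_mixed_pow_le (hS : S.IsSymmetric) (hu : ∀ i, S (u i) = l i • u i)
    (hl : ∀ i, 0 ≤ l i) (g : E) {R : ℝ} (hR0 : 0 < R)
    (hR : ‖g‖ ^ 2 ≤ R) (a b : ℕ) :
    LinearMap.trace ℝ E ((S + rankOneOp g) ^ a * S ^ b) ≤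
      ∑ i, (l i ^ (a + b) + inner ℝ (u i) g ^ 2 * (l i ^ b * (((l i + R) ^ a - l i ^ a) / R))) := by
  have hM : (S + rankOneOp g).IsSymmetric := hS.add (rankOneOp_isSymmetric g)
  induction a generalizing b with
  | zero =>
    rw [LinearMap.trace_eq_sum_inner _ u]
    refine (Finset.sum_congr rfl fun i _ => ?_).le
    rw [pow_zero, one_mul, pow_apply_eigenbasis u l hu, inner_smul_right]
    simp
  | succ a ih =>
    have h1 : (S + rankOneOp g) ^ (a + 1) * S ^ b =
        (S + rankOneOp g) ^ a * S ^ (b + 1) + (S + rankOneOp g) ^ a * rankOneOp g * S ^ b := by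
      rw [pow_succ, pow_succ' S]
      noncomm_ring
    have h2 : LinearMap.trace ℝ E ((S + rankOneOp g) ^ a * rankOneOp g * S ^ b) =
        inner ℝ g (((S + rankOneOp g) ^ a) ((S ^ b) g)) := by
      rw [LinearMap.trace_eq_sum_inner _ u]
      have e1 : ∀ i, inner ℝ (u i) (((S + rankOneOp g) ^ a * rankOneOp g * S ^ b) (u i)) =
          inner ℝ ((S ^ b) g) (u i) * inner ℝ (u i) (((S + rankOneOp g) ^ a) g) := by
        intro i
        rw [Module.End.mul_apply, Module.End.mul_apply, rankOneOp_apply, map_smul,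
          inner_smul_right, (hS.pow b) g (u i)]
      simp only [e1]
      rw [u.sum_inner_mul_inner, (hM.pow a) g ((S ^ b) g) |>.symm, real_inner_comm]
    rw [h1, map_add, h2]
    refine (add_le_add (ih (b + 1)) (inner_mixed_pow_le u l hu hl g hR a b)).trans (le_of_eq ?_)
    rw [← Finset.sum_add_distrib]
    refine Finset.sum_congr rfl fun i _ => ?_
    field_simp
    ring

end Update

/-- Summing the bounds on `tr (S + g gᵀ)ⁿ` against `θⁿ / n!`. The right side is affine in the
squares `⟨u i, g⟩ ^ 2`, so an expectation over `g` needs only second moments; this takes the place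
of a trace inequality such as Golden–Thompson. -/
theorem expTrace_add_rankOneOp_le {S : E →ₗ[ℝ] E} (hS : S.IsSymmetric)
    (hl : ∀ i, 0 ≤ hS.eigenvalues rfl i) (g : E) {R θ : ℝ} (hR0 : 0 < R) (hR : ‖g‖ ^ 2 ≤ R)
    (hθ : 0 ≤ θ) :
    expTrace θ (S + rankOneOp g) ≤ ∑ i, Real.exp (θ * hS.eigenvalues rfl i) *
      (1 + inner ℝ (hS.eigenvectorBasis rfl i) g ^ 2 * ((Real.exp (θ * R) - 1) / R)) := by
  have hM : (S + rankOneOp g).IsSymmetric := hS.add (rankOneOp_isSymmetric g)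
  have h1 := hasSum_expTrace θ hM
  have h2 : HasSum (fun n : ℕ => ∑ i, (θ ^ n / n.factorial) * (hS.eigenvalues rfl i ^ n +
      inner ℝ (hS.eigenvectorBasis rfl i) g ^ 2 *
        (((hS.eigenvalues rfl i + R) ^ n - hS.eigenvalues rfl i ^ n) / R)))
      (∑ i, Real.exp (θ * hS.eigenvalues rfl i) *
      (1 + inner ℝ (hS.eigenvectorBasis rfl i) g ^ 2 * ((Real.exp (θ * R) - 1) / R))) := by
    refine hasSum_sum fun i _ => ?_
    have a1 := NormedSpace.expSeries_div_hasSum_exp (θ * hS.eigenvalues rfl i)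
    have a2 := NormedSpace.expSeries_div_hasSum_exp (θ * (hS.eigenvalues rfl i + R))
    rw [← Real.exp_eq_exp_ℝ] at a1 a2
    have a3 := a1.add ((a2.sub a1).mul_left (inner ℝ (hS.eigenvectorBasis rfl i) g ^ 2 / R))
    have e : Real.exp (θ * hS.eigenvalues rfl i) *
        (1 + inner ℝ (hS.eigenvectorBasis rfl i) g ^ 2 * ((Real.exp (θ * R) - 1) / R)) =
        Real.exp (θ * hS.eigenvalues rfl i) + inner ℝ (hS.eigenvectorBasis rfl i) g ^ 2 / R *
          (Real.exp (θ * (hS.eigenvalues rfl i + R)) - Real.exp (θ * hS.eigenvalues rfl i)) := by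
      rw [mul_add θ, Real.exp_add]
      ring
    rw [e]
    exact a3.congr_fun fun n => by rw [mul_pow, mul_pow]; ring
  rw [expTrace, h1.tsum_eq]
  refine hasSum_le (fun n => ?_) h1 h2
  rw [← Finset.mul_sum]
  refine mul_le_mul_of_nonneg_left ?_ (by positivity)
  have := trace_mixed_pow_le (hS.eigenvectorBasis rfl) (hS.eigenvalues rfl) hS
    (fun i => hS.apply_eigenvectorBasis rfl i) hl g hR0 hR n 0
  simpa using this

/-- Averaging one summand multiplies the bound by at most `1 + c κ ≤ exp (c κ)`. A general positive
`S` is allowed so that the induction can absorb summands into it. -/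
theorem prodE_expTrace_le {A : Type*} [Fintype A] {n : ℕ} {p : Fin n → A → ℝ}
    (hp : IsProbWeight p) (g : Fin n → A → E) {c R θ : ℝ} (hR0 : 0 < R) (hθ : 0 ≤ θ)
    (hgR : ∀ i a, ‖g i a‖ ^ 2 ≤ R) (hgc : ∀ i v, ∑ a, p i a * inner ℝ v (g i a) ^ 2 ≤ c * ‖v‖ ^ 2)
    {S : E →ₗ[ℝ] E} (hS : S.IsPositive) :
    prodE p (fun ω => expTrace θ (S + ∑ i, rankOneOp (g i (ω i)))) ≤
      expTrace θ S * Real.exp (n * (c * ((Real.exp (θ * R) - 1) / R))) := by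
  set κ := (Real.exp (θ * R) - 1) / R with hκ
  have hκ0 : 0 ≤ κ := div_nonneg (sub_nonneg.mpr (Real.one_le_exp (by positivity))) hR0.le
  induction n generalizing S with
  | zero => simp [prodE]
  | succ n ih =>
    rw [prodE_succ]
    have hin : ∀ a, prodE (fun i => p i.succ) (fun ω => expTrace θ
        (S + ∑ i, rankOneOp (g i ((Fin.cons a ω : Fin (n + 1) → A) i)))) ≤
        expTrace θ (S + rankOneOp (g 0 a)) * Real.exp (n * (c * κ)) := by
      intro a
      simp only [Fin.sum_univ_succ, Fin.cons_zero, Fin.cons_succ, ← add_assoc]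
      refine ih hp.tail (fun i => g i.succ) (fun i => hgR i.succ) (fun i => hgc i.succ)
        (hS.add ⟨rankOneOp_isSymmetric _, fun x => ?_⟩)
      rw [inner_rankOneOp_self]
      simpa using sq_nonneg _
    have hl : ∀ i, 0 ≤ hS.isSymmetric.eigenvalues rfl i := hS.nonneg_eigenvalues rfl
    calc ∑ a, p 0 a * prodE (fun i => p i.succ) (fun ω => expTrace θ
          (S + ∑ i, rankOneOp (g i ((Fin.cons a ω : Fin (n + 1) → A) i))))
        ≤ ∑ a, p 0 a * ((∑ i, Real.exp (θ * hS.isSymmetric.eigenvalues rfl i) *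
            (1 + inner ℝ (hS.isSymmetric.eigenvectorBasis rfl i) (g 0 a) ^ 2 * κ)) *
              Real.exp (n * (c * κ))) := by
          refine Finset.sum_le_sum fun a _ => mul_le_mul_of_nonneg_left ((hin a).trans ?_)
            (hp.nonneg 0 a)
          exact mul_le_mul_of_nonneg_right
            (expTrace_add_rankOneOp_le hS.isSymmetric hl _ hR0 (hgR 0 a) hθ) (Real.exp_pos _).le
      _ = (∑ i, Real.exp (θ * hS.isSymmetric.eigenvalues rfl i) * (∑ a, p 0 a +
            (∑ a, p 0 a * inner ℝ (hS.isSymmetric.eigenvectorBasis rfl i) (g 0 a) ^ 2) * κ)) *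
              Real.exp (n * (c * κ)) := by
          rw [Finset.sum_mul]
          simp only [Finset.mul_sum, Finset.sum_mul, ← Finset.sum_add_distrib]
          rw [Finset.sum_comm]
          exact Finset.sum_congr rfl fun i _ => Finset.sum_congr rfl fun a _ => by ring
      _ ≤ (∑ i, Real.exp (θ * hS.isSymmetric.eigenvalues rfl i) * Real.exp (c * κ)) *
              Real.exp (n * (c * κ)) := by
          refine mul_le_mul_of_nonneg_right (Finset.sum_le_sum fun i _ =>
            mul_le_mul_of_nonneg_left ?_ (Real.exp_pos _).le) (Real.exp_pos _).le
          have h1 := hgc 0 (hS.isSymmetric.eigenvectorBasis rfl i)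
          rw [OrthonormalBasis.norm_eq_one, one_pow, mul_one] at h1
          rw [hp.sum_eq_one]
          have h2 := mul_le_mul_of_nonneg_right h1 hκ0
          linarith [Real.add_one_le_exp (c * κ)]
      _ = _ := by
          rw [← Finset.sum_mul, ← expTrace_eq, mul_assoc, ← Real.exp_add]
          push_cast
          ring_nf

/-- A quadratic form exceeding `t` forces an eigenvalue above `t`, which alone contributes `exp (θ
t)` to the trace. This is the Markov step of the Chernoff bound. -/
theorem one_le_expTrace_mul {S : E →ₗ[ℝ] E} (hS : S.IsSymmetric) {θ t : ℝ} (hθ : 0 ≤ θ) {v : E}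
    (hv : t * ‖v‖ ^ 2 < inner ℝ (S v) v) : 1 ≤ expTrace θ S * Real.exp (-(θ * t)) := by
  have hex : ∃ i, t < hS.eigenvalues rfl i := by
    by_contra hcon
    push Not at hcon
    have h1 : inner ℝ (S v) v = ∑ i, inner ℝ (hS.eigenvectorBasis rfl i) v ^ 2 *
        hS.eigenvalues rfl i := by
      have := inner_pow_apply_self (hS.eigenvectorBasis rfl) (hS.eigenvalues rfl)
        (fun i => hS.apply_eigenvectorBasis rfl i) v 1
      simpa [real_inner_comm] using this
    have h2 : ‖v‖ ^ 2 = ∑ i, inner ℝ (hS.eigenvectorBasis rfl i) v ^ 2 := by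
      rw [← (hS.eigenvectorBasis rfl).sum_sq_norm_inner_right v]
      simp
    rw [h1, h2, Finset.mul_sum] at hv
    refine absurd hv (not_lt.mpr (Finset.sum_le_sum fun i _ => ?_))
    rw [mul_comm t]
    exact mul_le_mul_of_nonneg_left (hcon i) (sq_nonneg _)
  obtain ⟨i, hi⟩ := hex
  rw [expTrace_eq θ hS]
  have h1 : Real.exp (θ * t) ≤ ∑ i, Real.exp (θ * hS.eigenvalues rfl i) :=
    (Real.exp_le_exp.mpr (mul_le_mul_of_nonneg_left hi.le hθ)).trans
      (Finset.single_le_sum (f := fun i => Real.exp (θ * hS.eigenvalues rfl i))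
        (fun _ _ => (Real.exp_pos _).le) (Finset.mem_univ i))
  calc (1 : ℝ) = Real.exp (θ * t) * Real.exp (-(θ * t)) := by rw [← Real.exp_add]; simp
    _ ≤ _ := mul_le_mul_of_nonneg_right h1 (Real.exp_pos _).le

/-- A matrix Chernoff bound for sums of independent bounded rank one operators. -/
theorem prodP_rankOne_sum_le {A : Type*} [Fintype A] {n : ℕ} {p : Fin n → A → ℝ}
    (hp : IsProbWeight p) (g : Fin n → A → E) {c R θ t : ℝ} (hR0 : 0 < R) (hθ : 0 ≤ θ)
    (hgR : ∀ i a, ‖g i a‖ ^ 2 ≤ R)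
    (hgc : ∀ i v, ∑ a, p i a * inner ℝ v (g i a) ^ 2 ≤ c * ‖v‖ ^ 2) :
    prodP p {ω | ∃ v, t * ‖v‖ ^ 2 < ∑ i, inner ℝ v (g i (ω i)) ^ 2} ≤
      finrank ℝ E * Real.exp (n * (c * ((Real.exp (θ * R) - 1) / R)) - θ * t) := by
  have hsym : ∀ ω : Fin n → A, (∑ i, rankOneOp (g i (ω i))).IsSymmetric := by
    intro ω
    refine Finset.sum_induction _ LinearMap.IsSymmetric (fun _ _ h h' => h.add h')
      (fun _ _ => by simp) fun i _ => rankOneOp_isSymmetric _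
  have h1 := prodE_expTrace_le hp g hR0 hθ hgR hgc (S := (0 : E →ₗ[ℝ] E))
    LinearMap.isPositive_zero
  simp only [zero_add] at h1
  have h2 : expTrace θ (0 : E →ₗ[ℝ] E) = finrank ℝ E := by
    rw [expTrace, tsum_eq_single 0]
    · simp
    · intro n hn
      rw [zero_pow hn]
      simp
  rw [h2] at h1
  have h3 : prodP p {ω | ∃ v, t * ‖v‖ ^ 2 < ∑ i, inner ℝ v (g i (ω i)) ^ 2} ≤
      prodE p (fun ω => Real.exp (-(θ * t)) * expTrace θ (∑ i, rankOneOp (g i (ω i)))) := by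
    refine prodP_le_prodE hp (fun ω => ?_) ?_
    · rw [expTrace_eq θ (hsym ω)]
      positivity
    · rintro ω ⟨v, hv⟩
      rw [mul_comm]
      refine one_le_expTrace_mul (hsym ω) hθ (v := v) (hv.trans_le (le_of_eq ?_))
      rw [LinearMap.sum_apply, sum_inner]
      refine Finset.sum_congr rfl fun i _ => ?_
      rw [inner_rankOneOp_self, real_inner_comm]
  rw [prodE_const_mul] at h3
  refine h3.trans ((mul_le_mul_of_nonneg_left h1 (Real.exp_pos _).le).trans (le_of_eq ?_))
  rw [mul_left_comm, ← Real.exp_add, neg_add_eq_sub]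

/-- The matrix Chernoff bound for independent rows with sub-Gaussian norm. -/
theorem prodP_rows_le {A : Type*} [Fintype A] {n : ℕ} {p : Fin n → A → ℝ}
    (hp : IsProbWeight p) (g : Fin n → A → E) {c R θ t η M : ℝ} (hR0 : 0 < R) (hθ : 0 ≤ θ)
    (hη : 0 ≤ η) (hgM : ∀ i, ∑ a, p i a * Real.exp (η * ‖g i a‖ ^ 2) ≤ M)
    (hgc : ∀ i v, ∑ a, p i a * inner ℝ v (g i a) ^ 2 ≤ c * ‖v‖ ^ 2) :
    prodP p {ω | ∃ v, t * ‖v‖ ^ 2 < ∑ i, inner ℝ v (g i (ω i)) ^ 2} ≤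
      n * (M * Real.exp (-(η * R))) +
        finrank ℝ E * Real.exp (n * (c * ((Real.exp (θ * R) - 1) / R)) - θ * t) := by
  classical
  -- Truncation makes the rows bounded and only lowers second moments; the exponential moment pays
  -- for the rows that are cut.
  set g' : Fin n → A → E := fun i a => if ‖g i a‖ ^ 2 ≤ R then g i a else 0 with hg'
  have h1 := prodP_rankOne_sum_le hp g' (c := c) (t := t) hR0 hθ (fun i a => by
    by_cases h : ‖g i a‖ ^ 2 ≤ R
    · simpa [hg', h] using h
    · simp [hg', h, hR0.le]) (fun i v => (Finset.sum_le_sum fun a _ =>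
        mul_le_mul_of_nonneg_left (by
          by_cases h : ‖g i a‖ ^ 2 ≤ R
          · simp [hg', h]
          · simpa [hg', h] using sq_nonneg _) (hp.nonneg i a)).trans (hgc i v))
  have h2 : ∀ i, prodP p {ω | R < ‖g i (ω i)‖ ^ 2} ≤ M * Real.exp (-(η * R)) := by
    intro i
    calc prodP p {ω | R < ‖g i (ω i)‖ ^ 2}
        ≤ prodE p (fun ω => Real.exp (-(η * R)) * Real.exp (η * ‖g i (ω i)‖ ^ 2)) := by
          refine prodP_le_prodE hp (fun ω => by positivity) fun ω hω => ?_
          rw [← Real.exp_add]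
          refine Real.one_le_exp ?_
          have : R < ‖g i (ω i)‖ ^ 2 := hω
          nlinarith
      _ = Real.exp (-(η * R)) * ∑ a, p i a * Real.exp (η * ‖g i a‖ ^ 2) := by
          rw [prodE_const_mul, prodE_coord hp i fun a => Real.exp (η * ‖g i a‖ ^ 2)]
      _ ≤ _ := by
          rw [mul_comm]
          exact mul_le_mul_of_nonneg_right (hgM i) (Real.exp_pos _).le
  have hsub : {ω | ∃ v, t * ‖v‖ ^ 2 < ∑ i, inner ℝ v (g i (ω i)) ^ 2} ⊆
      (⋃ i, {ω : Fin n → A | R < ‖g i (ω i)‖ ^ 2}) ∪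
        {ω | ∃ v, t * ‖v‖ ^ 2 < ∑ i, inner ℝ v (g' i (ω i)) ^ 2} := by
    rintro ω ⟨v, hv⟩
    by_cases hω : ∃ i, R < ‖g i (ω i)‖ ^ 2
    · exact Or.inl (Set.mem_iUnion.mpr hω)
    · push Not at hω
      refine Or.inr ⟨v, hv.trans_le (le_of_eq (Finset.sum_congr rfl fun i _ => ?_))⟩
      simp [hg', hω i]
  refine (prodP_mono hp hsub).trans ((prodP_union_le hp _ _).trans (add_le_add ?_ h1))
  refine (prodP_iUnion_le hp _).trans ((Finset.sum_le_sum fun i _ => h2 i).trans (le_of_eq ?_))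
  simp

end RankOneSums

end MNLRanking

namespace MNLRanking

/-! ### Constants in the Chernoff bound. -/

section RowsConstants

/-- The threshold for the squared spectral norm of a matrix with `d₁` independent rows. -/
noncomputable def rowsLevel (d₁ d₂ : ℕ) (k L : ℝ) : ℝ := 256 * k * (d₁ * L + d₂ * L ^ 2) / d₂

theorem prodP_rows_le_exp {A : Type*} [Fintype A] {d₁ d₂ : ℕ} (hd₂ : 0 < d₂)
    {p : Fin d₁ → A → ℝ} (hp : IsProbWeight p) (g : Fin d₁ → A → EuclideanSpace ℝ (Fin d₂))
    {k L : ℝ} (hk : 0 < k) (hL : 1 ≤ L)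
    (hgM : ∀ i, ∑ a, p i a * Real.exp (1 / (16 * k) * ‖g i a‖ ^ 2) ≤ Real.exp 1)
    (hgc : ∀ i v, ∑ a, p i a * inner ℝ v (g i a) ^ 2 ≤ k / d₂ * ‖v‖ ^ 2) :
    prodP p {ω | ∃ v, rowsLevel d₁ d₂ k L * ‖v‖ ^ 2 < ∑ i, inner ℝ v (g i (ω i)) ^ 2} ≤
      3 * (d₁ + d₂) * Real.exp (-(5 * L)) := by
  have hL0 : 0 < L := by linarith
  have hd : (0 : ℝ) < d₂ := by exact_mod_cast hd₂
  have hR : 0 < 80 * k * L := by positivity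
  -- `R` is chosen so that `η * R = 5 * L`, and `θ` so that `θ * R = 3`; then `exp 3 - 1 ≤ 20`
  -- bounds the variance term.
  have h := prodP_rows_le hp g (R := 80 * k * L) (θ := 3 / (80 * k * L)) (η := 1 / (16 * k))
    (t := rowsLevel d₁ d₂ k L) hR (by positivity) (by positivity) hgM hgc
  refine h.trans ?_
  have e1 : 1 / (16 * k) * (80 * k * L) = 5 * L := by field_simp; norm_num
  have e2 : 3 / (80 * k * L) * (80 * k * L) = 3 := by field_simp
  have he3 : Real.exp 3 ≤ 21 := by
    have : Real.exp 3 = Real.exp 1 ^ 3 := by rw [← Real.exp_nat_mul]; norm_num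
    rw [this]
    have h1 := Real.exp_one_lt_d9
    calc Real.exp 1 ^ 3 ≤ 2.75 ^ 3 := by gcongr; linarith
      _ ≤ 21 := by norm_num
  have he1 : Real.exp 1 ≤ 3 := by linarith [Real.exp_one_lt_d9]
  rw [e1, e2, finrank_euclideanSpace_fin]
  have e4 : (d₁ : ℝ) * (k / d₂ * ((Real.exp 3 - 1) / (80 * k * L))) -
      3 / (80 * k * L) * rowsLevel d₁ d₂ k L ≤ -(5 * L) := by
    have a1 : (d₁ : ℝ) * (k / d₂ * ((Real.exp 3 - 1) / (80 * k * L))) ≤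
        d₁ * (k / d₂ * (20 / (80 * k * L))) := by
      gcongr
      linarith
    have a2 : (d₁ : ℝ) * (k / d₂ * (20 / (80 * k * L))) -
      3 / (80 * k * L) * rowsLevel d₁ d₂ k L =
        d₁ * (20 - 768 * L) / (80 * L * d₂) - (768 / 80) * L := by
      rw [rowsLevel]
      field_simp
      ring
    have a3 : d₁ * (20 - 768 * L) / (80 * L * d₂) ≤ 0 :=
      div_nonpos_of_nonpos_of_nonneg
        (mul_nonpos_of_nonneg_of_nonpos (Nat.cast_nonneg _) (by linarith)) (by positivity)
    linarith
  have e5 := Real.exp_le_exp.mpr e4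
  have hpos := Real.exp_pos (-(5 * L))
  calc _ ≤ (d₁ : ℝ) * (3 * Real.exp (-(5 * L))) + d₂ * Real.exp (-(5 * L)) := by gcongr
    _ ≤ _ := by nlinarith [mul_pos hd hpos]

end RowsConstants

/-! ### Second and exponential moments of sums of independent vectors. -/

section IIDSums

variable {A V : Type*} [Fintype A] [NormedAddCommGroup V] [InnerProductSpace ℝ V]

theorem prodE_sum_eq_zero {m : ℕ} {p : Fin m → A → ℝ} (hp : IsProbWeight p) (z : A → ℝ)
    (hz : ∀ i, ∑ a, p i a * z a = 0) : prodE p (fun ω => ∑ l, z (ω l)) = 0 := by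
  rw [prodE_sum]
  exact Finset.sum_eq_zero fun l _ => by rw [prodE_coord hp l z, hz]

theorem prodE_sum_sq {m : ℕ} {p : Fin m → A → ℝ} (hp : IsProbWeight p) (z : A → ℝ)
    (hz : ∀ i, ∑ a, p i a * z a = 0) :
    prodE p (fun ω => (∑ l, z (ω l)) ^ 2) = ∑ i, ∑ a, p i a * z a ^ 2 := by
  induction m with
  | zero => simp [prodE]
  | succ m ih =>
    rw [prodE_succ, Fin.sum_univ_succ]
    have h1 : ∀ a, prodE (fun i => p i.succ)
        (fun ω => (∑ l, z ((Fin.cons a ω : Fin (m + 1) → A) l)) ^ 2) =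
        z a ^ 2 + ∑ i : Fin m, ∑ a, p i.succ a * z a ^ 2 := by
      intro a
      have e : (fun ω : Fin m → A => (∑ l, z ((Fin.cons a ω : Fin (m + 1) → A) l)) ^ 2) =
          fun ω => (z a ^ 2 + 2 * z a * ∑ l, z (ω l)) + (∑ l, z (ω l)) ^ 2 := by
        funext ω
        rw [Fin.sum_univ_succ]
        simp only [Fin.cons_zero, Fin.cons_succ]
        ring
      rw [e, prodE_add, prodE_add, prodE_const hp.tail, prodE_const_mul,
        prodE_sum_eq_zero hp.tail z fun i => hz i.succ, ih hp.tail fun i => hz i.succ]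
      ring
    simp only [h1, mul_add, Finset.sum_add_distrib, ← Finset.sum_mul, hp.sum_eq_one, one_mul]

/-- The supermartingale step used for rankings, now iterated over independent centred vectors. -/
theorem prodE_exp_norm_sum_sq_le {m : ℕ} {p : Fin m → A → ℝ} (hp : IsProbWeight p) (ξ : A → V)
    (hξ : ∀ i, ∑ a, p i a • ξ a = 0) (hb : ∀ a, ‖ξ a‖ ^ 2 ≤ 2) (x : V) {η N : ℝ}
    (hη : η = 1 / (16 * N)) (hN : 0 < N) (hm : (m : ℝ) ≤ N) :
    prodE p (fun ω => Real.exp (η * ‖x + ∑ l, ξ (ω l)‖ ^ 2)) ≤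
      Real.exp (η * (1 + m / N) * ‖x‖ ^ 2 + 4 * η * m) := by
  have hη0 : 0 ≤ η := by rw [hη]; positivity
  induction m generalizing x with
  | zero => simp [prodE]
  | succ m ih =>
    have hm' : (m : ℝ) ≤ N := by push_cast at hm; linarith
    rw [prodE_succ]
    have hin : ∀ a, prodE (fun i => p i.succ) (fun ω => Real.exp
        (η * ‖x + ∑ l, ξ ((Fin.cons a ω : Fin (m + 1) → A) l)‖ ^ 2)) ≤
        Real.exp (η * (1 + m / N) * ‖x + ξ a‖ ^ 2 + 4 * η * m) := by
      intro a
      simp only [Fin.sum_univ_succ, Fin.cons_zero, Fin.cons_succ, ← add_assoc]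
      exact ih hp.tail (fun i => hξ i.succ) _ hm'
    refine (Finset.sum_le_sum fun a _ =>
      mul_le_mul_of_nonneg_left (hin a) (hp.nonneg 0 a)).trans ?_
    have hstep := sum_mul_exp_norm_sq_le (p 0) ξ (hp.nonneg 0) (hp.sum_eq_one 0) (hξ 0) hb x
      (β := η * (1 + m / N)) hη hN (by positivity) (by
        have : m / N ≤ 1 := (div_le_one hN).mpr hm'
        nlinarith)
    simp only [Real.exp_add, ← mul_assoc, ← Finset.sum_mul] at hstep ⊢
    refine (mul_le_mul_of_nonneg_right hstep (Real.exp_pos _).le).trans (le_of_eq ?_)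
    rw [← Real.exp_add, ← Real.exp_add, ← Real.exp_add]
    congr 1
    push_cast
    ring

end IIDSums

/-! ### Spectral norm for random uniform pairs of items. -/

section PairRows

variable {d₁ d₂ : ℕ}

/-- The uniform weight on pairs of items. -/
noncomputable def pairWeight (ι : Type*) (d₂ : ℕ) (_ : ι) (_ : Fin d₂ × Fin d₂) : ℝ :=
  ((d₂ : ℝ) ^ 2)⁻¹

theorem pairWeight_isProbWeight (ι : Type*) (hd₂ : 0 < d₂) :
    IsProbWeight (pairWeight ι d₂) := by
  have hd : (d₂ : ℝ) ≠ 0 := by exact_mod_cast hd₂.ne'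
  refine ⟨fun i a => by unfold pairWeight; positivity, fun i => ?_⟩
  simp only [pairWeight, Finset.sum_const, Finset.card_univ, Fintype.card_prod, Fintype.card_fin,
    nsmul_eq_mul]
  push_cast
  field_simp

/-- The difference of the coordinate vectors of two items. -/
noncomputable def pairVec (a : Fin d₂ × Fin d₂) : EuclideanSpace ℝ (Fin d₂) :=
  EuclideanSpace.single a.1 1 - EuclideanSpace.single a.2 1

theorem norm_single_sub_single_sq_le (a b : Fin d₂) :
    ‖(EuclideanSpace.single a (1 : ℝ) - EuclideanSpace.single b 1 : EuclideanSpace ℝ (Fin d₂))‖ ^ 2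
      ≤ 2 := by
  rw [norm_sub_sq_real]
  simp only [PiLp.norm_single, norm_one, one_pow, EuclideanSpace.inner_single_left]
  have : (0 : ℝ) ≤ (EuclideanSpace.single b (1 : ℝ) : EuclideanSpace ℝ (Fin d₂)) a := by
    by_cases h : a = b <;> simp [h]
  simp only [map_one, one_mul]
  linarith

theorem inner_pairVec (v : EuclideanSpace ℝ (Fin d₂)) (a : Fin d₂ × Fin d₂) :
    inner ℝ v (pairVec a) = v a.1 - v a.2 := by
  rw [real_inner_comm, pairVec, inner_sub_left]
  simp [EuclideanSpace.inner_single_left]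

theorem sum_pairWeight_sq (ι : Type*) (i : ι) (hd₂ : 0 < d₂) (v : Fin d₂ → ℝ) :
    ∑ a, pairWeight ι d₂ i a * (v a.1 - v a.2) ^ 2 =
      2 / d₂ * ∑ j, v j ^ 2 - 2 / (d₂ : ℝ) ^ 2 * (∑ j, v j) ^ 2 := by
  have hd : (d₂ : ℝ) ≠ 0 := by exact_mod_cast hd₂.ne'
  simp only [pairWeight]
  rw [← Finset.mul_sum, Fintype.sum_prod_type]
  have : ∀ j j', (v j - v j') ^ 2 = v j ^ 2 + v j' ^ 2 - 2 * (v j * v j') := fun j j' => by ring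
  simp only [this, Finset.sum_add_distrib, Finset.sum_sub_distrib, ← Finset.mul_sum, Finset.sum_const,
    Finset.card_univ, Fintype.card_fin, nsmul_eq_mul]
  rw [← Finset.sum_mul, ← sq]
  field_simp
  ring

theorem sum_pairWeight_smul_pairVec (ι : Type*) (i : ι) :
    ∑ a : Fin d₂ × Fin d₂, pairWeight ι d₂ i a • pairVec a = 0 := by
  simp only [pairWeight, ← Finset.smul_sum, pairVec]
  rw [Fintype.sum_prod_type]
  simp only [Finset.sum_sub_distrib]
  rw [Finset.sum_comm, sub_self, smul_zero]

/-- With high probability, the matrix whose rows are sums of independent random pair vectors has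
small spectral norm. -/
theorem prodP_pairRows_le {m : ℕ} (hd₂ : 0 < d₂) {k L : ℝ} (hk : 0 < k) (hmk : 2 * (m : ℝ) ≤ k)
    (hL : 1 ≤ L) :
    prodP (pairWeight (Fin d₁ × Fin m) d₂) {ω | ∃ v, rowsLevel d₁ d₂ k L * ‖v‖ ^ 2 <
      ∑ i, inner ℝ v (∑ l, pairVec (ω (i, l))) ^ 2} ≤
      3 * (d₁ + d₂) * Real.exp (-(5 * L)) := by
  classical
  have hd : (0 : ℝ) < d₂ := by exact_mod_cast hd₂
  have hw : IsProbWeight (pairWeight (Fin m) d₂) := pairWeight_isProbWeight _ hd₂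
  have hw' : IsProbWeight fun (i : Fin d₁) (x : Fin m → Fin d₂ × Fin d₂) =>
      ∏ l, pairWeight (Fin d₁ × Fin m) d₂ (i, l) (x l) := by
    refine ⟨fun i x => Finset.prod_nonneg fun l _ => by unfold pairWeight; positivity,
      fun i => ?_⟩
    have := prodE_const hw 1
    rw [prodE_eq] at this
    simp only [mul_one] at this
    exact this
  have h := prodP_rows_le_exp hd₂ hw' (fun _ x => ∑ l, pairVec (x l)) hk hL (fun i => ?_)
    (fun i v => ?_)
  · rw [prodP, prodE_curry]
    exact h
  · have h1 := prodE_exp_norm_sum_sq_le hw (pairVec (d₂ := d₂))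
      (fun i => sum_pairWeight_smul_pairVec _ i)
      (fun a => norm_single_sub_single_sq_le a.1 a.2) 0 (η := 1 / (16 * k)) rfl hk (by linarith)
    rw [prodE_eq] at h1
    simp only [zero_add] at h1
    refine h1.trans (Real.exp_le_exp.mpr ?_)
    have : 4 * (1 / (16 * k)) * (m : ℝ) ≤ 1 := by
      rw [mul_one_div, div_mul_eq_mul_div, div_le_one (by positivity)]
      linarith
    simpa using this
  · have h1 := prodE_sum_sq hw (fun a : Fin d₂ × Fin d₂ => v a.1 - v a.2) (fun i => by
      have := congrArg (fun y => inner ℝ v y) (sum_pairWeight_smul_pairVec (d₂ := d₂) (Fin m) i)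
      simpa only [inner_sum, inner_smul_right, inner_pairVec, inner_zero_right] using this)
    rw [prodE_eq] at h1
    simp only [inner_sum, inner_pairVec]
    refine h1.le.trans ?_
    simp only [sum_pairWeight_sq (Fin m) _ hd₂, Finset.sum_const, Finset.card_univ,
      Fintype.card_fin, nsmul_eq_mul]
    have hv : ‖v‖ ^ 2 = ∑ j, v j ^ 2 := by
      rw [EuclideanSpace.norm_sq_eq]
      simp
    rw [hv]
    -- Each pair contributes at most `2 / d₂` to the variance, so `2 * m ≤ k` brings a row under the
    -- bound `k / d₂`.
    have h2 : 0 ≤ 2 / (d₂ : ℝ) ^ 2 * (∑ j, v j) ^ 2 := by positivity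
    calc (m : ℝ) * (2 / d₂ * ∑ j, v j ^ 2 - 2 / (d₂ : ℝ) ^ 2 * (∑ j, v j) ^ 2)
        ≤ m * (2 / d₂ * ∑ j, v j ^ 2) := by gcongr; linarith
      _ = (2 * m) / d₂ * ∑ j, v j ^ 2 := by ring
      _ ≤ _ := by gcongr

end PairRows

end MNLRanking

namespace MNLRanking

/-! ### Symmetrization and contraction for suprema of squares. -/

section Comparison

variable {τ A : Type*} [Fintype τ] [Nonempty τ] [Fintype A]

/-- The maximum of a function on a nonempty finite type. -/
noncomputable def maxOf (f : τ → ℝ) : ℝ := Finset.univ.sup' Finset.univ_nonempty f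

theorem le_maxOf (f : τ → ℝ) (t : τ) : f t ≤ maxOf f := Finset.le_sup' f (Finset.mem_univ t)

theorem maxOf_le {f : τ → ℝ} {c : ℝ} (h : ∀ t, f t ≤ c) : maxOf f ≤ c :=
  Finset.sup'_le _ _ fun t _ => h t

theorem exists_eq_maxOf (f : τ → ℝ) : ∃ t, maxOf f = f t := by
  obtain ⟨t, -, h⟩ := Finset.exists_mem_eq_sup' Finset.univ_nonempty f
  exact ⟨t, h⟩

/-- Symmetrization and contraction for one coordinate: the centered and negated square of an
antisymmetric function is dominated by a multiple of the function itself. -/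
theorem sum_mul_maxOf_sub_sq_le (q : A → ℝ) (hq : ∀ a, 0 ≤ q a) (hq1 : ∑ a, q a = 1)
    (sw : A ≃ A) (hsw : ∀ a, q (sw a) = q a) (b : τ → ℝ) (y : τ → A → ℝ)
    (hy : ∀ t a, y t (sw a) = - y t a) {l : ℝ} (hl : ∀ t a, |y t a| ≤ l) :
    ∑ a, q a * maxOf (fun t => b t + (∑ a', q a' * y t a' ^ 2 - y t a ^ 2)) ≤
      ∑ a, q a * maxOf (fun t => b t + 4 * l * y t a) := by
  set m : A → A → ℝ := fun a a' => maxOf fun t => b t + (y t a' ^ 2 - y t a ^ 2) with hm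
  set P : A → ℝ := fun a => maxOf fun t => b t + 4 * l * y t a with hP
  set N : A → ℝ := fun a => maxOf fun t => b t - 4 * l * y t a with hN
  have h1 : ∀ a, maxOf (fun t => b t + (∑ a', q a' * y t a' ^ 2 - y t a ^ 2)) ≤
      ∑ a', q a' * m a a' := by
    intro a
    refine maxOf_le fun t => ?_
    have e : b t + (∑ a', q a' * y t a' ^ 2 - y t a ^ 2) =
        ∑ a', q a' * (b t + (y t a' ^ 2 - y t a ^ 2)) := by
      have : ∑ a', q a' * (b t + (y t a' ^ 2 - y t a ^ 2)) =
          (∑ a', q a') * (b t - y t a ^ 2) + ∑ a', q a' * y t a' ^ 2 := by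
        rw [Finset.sum_mul, ← Finset.sum_add_distrib]
        exact Finset.sum_congr rfl fun a' _ => by ring
      rw [this, hq1]; ring
    rw [e]
    exact Finset.sum_le_sum fun a' _ => mul_le_mul_of_nonneg_left
      (le_maxOf (fun t => b t + (y t a' ^ 2 - y t a ^ 2)) t) (hq a')
  have hsq : ∀ t s a, |y t a ^ 2 - y s a ^ 2| ≤ 2 * l * |y t a - y s a| := by
    intro t s a
    have : y t a ^ 2 - y s a ^ 2 = (y t a + y s a) * (y t a - y s a) := by ring
    rw [this, abs_mul]
    refine mul_le_mul_of_nonneg_right ?_ (abs_nonneg _)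
    linarith [abs_add_le (y t a) (y s a), hl t a, hl s a]
  have hhalf : ∀ t s a, b t + b s + 4 * l * |y t a - y s a| ≤ P a + N a := by
    intro t s a
    have p1 := le_maxOf (fun t => b t + 4 * l * y t a)
    have n1 := le_maxOf (fun t => b t - 4 * l * y t a)
    rcases abs_cases (y t a - y s a) with ⟨h, -⟩ | ⟨h, -⟩
    · rw [h]; linarith [p1 t, n1 s]
    · rw [h]; linarith [p1 s, n1 t]
  -- For the two maximizers `t` and `s`, regroup the squares by argument: each difference at a fixed
  -- argument is at most `2 * l * |y t - y s|`. Symmetrizing over both orders introduces absolute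
  -- values, which `hhalf` absorbs because `t` and `s` may exchange roles.
  have h2 : ∀ a a', m a a' + m a' a ≤ (P a + N a + (P a' + N a')) / 2 := by
    intro a a'
    obtain ⟨t, ht⟩ := exists_eq_maxOf fun t => b t + (y t a' ^ 2 - y t a ^ 2)
    obtain ⟨s, hs⟩ := exists_eq_maxOf fun t => b t + (y t a ^ 2 - y t a' ^ 2)
    simp only [hm]
    rw [ht, hs]
    have k1 := hhalf t s a
    have k2 := hhalf t s a'
    have k3 := (abs_le.mp (hsq t s a)).1
    have k4 := (abs_le.mp (hsq t s a')).2
    linarith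
  -- The measure-preserving swap reverses the sign of `y` and so replaces Rademacher signs.
  have hNP : ∑ a, q a * N a = ∑ a, q a * P a := by
    rw [← Equiv.sum_comp sw]
    refine Finset.sum_congr rfl fun a _ => ?_
    rw [hsw]
    congr 1
    simp only [hN, hP, hy]
    congr 1
    funext t
    ring
  have h3 : ∑ a, ∑ a', q a * q a' * m a a' ≤ ∑ a, q a * P a := by
    have e1 : ∑ a, ∑ a', q a * q a' * m a a' =
        (∑ a, ∑ a', q a * q a' * (m a a' + m a' a)) / 2 := by
      have : ∑ a, ∑ a', q a * q a' * m a' a = ∑ a, ∑ a', q a * q a' * m a a' := by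
        rw [Finset.sum_comm]
        exact Finset.sum_congr rfl fun a _ => Finset.sum_congr rfl fun a' _ => by ring
      simp only [mul_add, Finset.sum_add_distrib]
      rw [this]; ring
    have e2 : ∑ a, ∑ a', q a * q a' * ((P a + N a + (P a' + N a')) / 2) =
        ∑ a, q a * P a + ∑ a, q a * N a := by
      have : ∀ a a', q a * q a' * ((P a + N a + (P a' + N a')) / 2) =
          (q a * P a + q a * N a) * q a' / 2 + q a * (q a' * P a' + q a' * N a') / 2 :=
        fun a a' => by ring
      simp only [this, Finset.sum_add_distrib, ← Finset.sum_div, ← Finset.mul_sum, ← Finset.sum_mul,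
        hq1]
      ring
    rw [e1]
    have : ∑ a, ∑ a', q a * q a' * (m a a' + m a' a) ≤
        ∑ a, ∑ a', q a * q a' * ((P a + N a + (P a' + N a')) / 2) :=
      Finset.sum_le_sum fun a _ => Finset.sum_le_sum fun a' _ =>
        mul_le_mul_of_nonneg_left (h2 a a') (mul_nonneg (hq a) (hq a'))
    rw [e2, hNP] at this
    linarith
  refine le_trans (Finset.sum_le_sum fun a _ => mul_le_mul_of_nonneg_left (h1 a) (hq a)) ?_
  refine le_trans (le_of_eq ?_) h3
  refine Finset.sum_congr rfl fun a _ => ?_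
  rw [Finset.mul_sum]
  exact Finset.sum_congr rfl fun a' _ => by ring

/-- Symmetrization and contraction for squares of antisymmetric functions of independent
variables. -/
theorem prodE_maxOf_sub_sq_le_fin {n : ℕ} {p : Fin n → A → ℝ} (hp : IsProbWeight p)
    (sw : A ≃ A) (hsw : ∀ i a, p i (sw a) = p i a) (b : τ → ℝ) (y : Fin n → τ → A → ℝ)
    (hy : ∀ i t a, y i t (sw a) = - y i t a) {l : ℝ} (hl : ∀ i t a, |y i t a| ≤ l) :
    prodE p (fun ω => maxOf fun t =>
        b t + ∑ i, (∑ a', p i a' * y i t a' ^ 2 - y i t (ω i) ^ 2)) ≤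
      prodE p (fun ω => maxOf fun t => b t + 4 * l * ∑ i, y i t (ω i)) := by
  induction n generalizing b with
  | zero => simp [prodE]
  | succ n ih =>
    rw [prodE_succ, prodE_succ]
    -- The first coordinate is absorbed into the offset `b` while the others are compared, and then
    -- they are absorbed while it is compared.
    set c : τ → A → ℝ := fun t a => ∑ a', p 0 a' * y 0 t a' ^ 2 - y 0 t a ^ 2 with hc
    calc ∑ a, p 0 a * prodE (fun i => p i.succ) (fun ω => maxOf fun t => b t +
          ∑ i, (∑ a', p i a' * y i t a' ^ 2 - y i t ((Fin.cons a ω : Fin (n + 1) → A) i) ^ 2))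
        ≤ ∑ a, p 0 a * prodE (fun i => p i.succ) (fun ω => maxOf fun t => (b t + c t a) +
            4 * l * ∑ i : Fin n, y i.succ t (ω i)) := by
          refine Finset.sum_le_sum fun a _ => mul_le_mul_of_nonneg_left ?_ (hp.nonneg 0 a)
          refine le_trans (le_of_eq ?_) (ih hp.tail (fun i => hsw i.succ) (fun t => b t + c t a)
            (fun i => y i.succ) (fun i => hy i.succ) fun i => hl i.succ)
          congr 1
          funext ω
          congr 1
          funext t
          rw [Fin.sum_univ_succ]
          simp only [Fin.cons_zero, Fin.cons_succ, hc]
          ring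
      _ = prodE (fun i => p i.succ) (fun ω => ∑ a, p 0 a * maxOf fun t =>
            (b t + 4 * l * ∑ i : Fin n, y i.succ t (ω i)) + c t a) := by
          rw [prodE_sum]
          refine Finset.sum_congr rfl fun a _ => ?_
          rw [prodE_const_mul]
          congr 2
          funext ω
          congr 1
          funext t
          ring
      _ ≤ prodE (fun i => p i.succ) (fun ω => ∑ a, p 0 a * maxOf fun t =>
            (b t + 4 * l * ∑ i : Fin n, y i.succ t (ω i)) + 4 * l * y 0 t a) :=
          prodE_mono hp.tail fun ω => sum_mul_maxOf_sub_sq_le (p 0) (hp.nonneg 0)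
            (hp.sum_eq_one 0) sw (hsw 0) _ (y 0) (hy 0) (hl 0)
      _ = _ := by
          rw [prodE_sum]
          refine Finset.sum_congr rfl fun a _ => ?_
          rw [prodE_const_mul]
          congr 2
          funext ω
          congr 1
          funext t
          rw [Fin.sum_univ_succ]
          simp only [Fin.cons_zero, Fin.cons_succ]
          ring

theorem prodE_maxOf_sub_sq_le {ι : Type*} [Fintype ι] {p : ι → A → ℝ} (hp : IsProbWeight p)
    (sw : A ≃ A) (hsw : ∀ i a, p i (sw a) = p i a) (b : τ → ℝ) (y : ι → τ → A → ℝ)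
    (hy : ∀ i t a, y i t (sw a) = - y i t a) {l : ℝ} (hl : ∀ i t a, |y i t a| ≤ l) :
    prodE p (fun ω => maxOf fun t =>
        b t + ∑ i, (∑ a', p i a' * y i t a' ^ 2 - y i t (ω i) ^ 2)) ≤
      prodE p (fun ω => maxOf fun t => b t + 4 * l * ∑ i, y i t (ω i)) := by
  let e := Fintype.equivFin ι
  have h := prodE_maxOf_sub_sq_le_fin (p := fun x => p (e.symm x))
    ⟨fun i => hp.nonneg _, fun i => hp.sum_eq_one _⟩ sw (fun i => hsw _) b
    (fun x => y (e.symm x)) (fun i => hy _) (fun i => hl _)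
  rw [prodE_reindex e, prodE_reindex e p fun ω => maxOf fun t => b t + 4 * l * ∑ i, y i t (ω i)]
  refine le_trans (le_of_eq ?_) (h.trans (le_of_eq ?_))
  · congr 1
    funext ω
    congr 1
    funext t
    rw [← Equiv.sum_comp e fun x => (∑ a', p (e.symm x) a' * y (e.symm x) t a' ^ 2 -
      y (e.symm x) t (ω x) ^ 2)]
    simp
  · congr 1
    funext ω
    congr 1
    funext t
    rw [← Equiv.sum_comp e fun x => y (e.symm x) t (ω x)]
    simp

end Comparison

/-! ### Lower bound for the quadratic form, uniformly over the cone. -/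

section RestrictedStrongConvexity

variable {d₁ d₂ : ℕ}

/-- The sum over users and pairs of the squared differences of the entries of `D`. -/
noncomputable def pairSum {m : ℕ} (D : Matrix (Fin d₁) (Fin d₂) ℝ)
    (ω : Fin d₁ × Fin m → Fin d₂ × Fin d₂) : ℝ :=
  ∑ q, (D q.1 (ω q).1 - D q.1 (ω q).2) ^ 2

/-- The matrices on which the quadratic form is shown to be large. -/
def coneSet (d₁ d₂ : ℕ) (α B : ℝ) : Set (Matrix (Fin d₁) (Fin d₂) ℝ) :=
  {D | (∀ i j, |D i j| ≤ 2 * α) ∧ (∀ i, ∑ j, D i j = 0) ∧ 0 < frobNorm D ∧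
    B * nuclearNorm D ≤ frobNorm D ^ 2}

/-- After contraction the process is linear in `D`, hence a trace pairing with a random matrix, and
duality bounds it by that matrix's spectral norm. -/
theorem sum_pair_mul_le {m : ℕ} {u : ℝ} (hu : 0 ≤ u) (D : Matrix (Fin d₁) (Fin d₂) ℝ)
    (ω : Fin d₁ × Fin m → Fin d₂ × Fin d₂)
    (hω : ∀ v : EuclideanSpace ℝ (Fin d₂),
      ∑ i, inner ℝ v (∑ l, pairVec (ω (i, l))) ^ 2 ≤ u ^ 2 * ‖v‖ ^ 2) :
    ∑ q, (D q.1 (ω q).1 - D q.1 (ω q).2) ≤ u * nuclearNorm D := by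
  set G : Matrix (Fin d₁) (Fin d₂) ℝ := fun i j => (∑ l, pairVec (ω (i, l))) j with hG
  have hGv : ∀ i (v : Fin d₂ → ℝ), ∑ j, G i j * v j =
      inner ℝ (WithLp.toLp 2 v) (∑ l, pairVec (ω (i, l))) := by
    intro i v
    rw [PiLp.inner_apply]
    refine Finset.sum_congr rfl fun j _ => ?_
    simp [hG]
  have h := sum_mul_le_mul_nuclearNorm G D hu fun v => by
    have := hω (WithLp.toLp 2 v)
    simp only [hGv]
    refine this.trans (le_of_eq ?_)
    rw [EuclideanSpace.norm_sq_eq]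
    simp
  refine le_trans (le_of_eq ?_) h
  rw [Fintype.sum_prod_type]
  refine Finset.sum_congr rfl fun i _ => ?_
  rw [hGv, inner_sum]
  simp [inner_pairVec]

/-- The maximal shortfall below `3 / 4` of the mean has negative expectation by contraction, and
concentrates by bounded differences. -/
theorem prodP_pairSum_lt_le_of_fintype {τ : Type*} [Fintype τ] [Nonempty τ] {m : ℕ} (hd₁ : 0 < d₁)
    (hd₂ : 0 < d₂) (hm : 0 < m) {α B u ε M : ℝ} (hα : 0 < α) (hB : 0 < B) (hu : 0 ≤ u)
    (hM : M = 2 * m / d₂)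
    (D : τ → Matrix (Fin d₁) (Fin d₂) ℝ) (hD : ∀ t, D t ∈ coneSet d₁ d₂ α B)
    (huB : 16 * α * u ≤ M * B / 8)
    (hW : prodP (pairWeight (Fin d₁ × Fin m) d₂) {ω | ∃ v, u ^ 2 * ‖v‖ ^ 2 <
      ∑ i, inner ℝ v (∑ l, pairVec (ω (i, l))) ^ 2} ≤ ε)
    (hεB : ε * (64 * α ^ 2 * (d₁ * m) + M * B ^ 2 / 8) ≤ M * B ^ 2 / 16) :
    prodP (pairWeight (Fin d₁ × Fin m) d₂)
        {ω | ∃ t, pairSum (D t) ω < 3 / 4 * (M * frobNorm (D t) ^ 2)} ≤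
      Real.exp (-((M * B ^ 2 / 16) ^ 2 / (2 * (d₁ * m) * (16 * α ^ 2) ^ 2))) := by
  classical
  have hp : IsProbWeight (pairWeight (Fin d₁ × Fin m) d₂) := pairWeight_isProbWeight _ hd₂
  have hd₂R : (0 : ℝ) < d₂ := by exact_mod_cast hd₂
  have hmR : (0 : ℝ) < m := by exact_mod_cast hm
  have hM0 : 0 < M := by rw [hM]; positivity
  set y : Fin d₁ × Fin m → τ → Fin d₂ × Fin d₂ → ℝ := fun q t a => D t q.1 a.1 - D t q.1 a.2 with hy
  have hyb : ∀ q t a, |y q t a| ≤ 4 * α := by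
    intro q t a
    have h1 := (hD t).1 q.1 a.1
    have h2 := (hD t).1 q.1 a.2
    have h3 := abs_sub (D t q.1 a.1) (D t q.1 a.2)
    simp only [hy]
    linarith
  -- The slack between the mean `M * frobNorm ^ 2` and the threshold `3 / 4` of it; keeping it
  -- inside the maximum avoids a peeling over the size of `D`.
  set b : τ → ℝ := fun t => -(M * frobNorm (D t) ^ 2 / 4) with hb
  have hmean : ∀ t, ∑ q : Fin d₁ × Fin m, ∑ a, pairWeight (Fin d₁ × Fin m) d₂ q a * y q t a ^ 2 =
      M * frobNorm (D t) ^ 2 := by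
    intro t
    have e : ∀ q : Fin d₁ × Fin m, ∑ a, pairWeight (Fin d₁ × Fin m) d₂ q a * y q t a ^ 2 =
        2 / d₂ * ∑ j, D t q.1 j ^ 2 := by
      intro q
      have := sum_pairWeight_sq (Fin d₁ × Fin m) q hd₂ (fun j => D t q.1 j)
      rw [(hD t).2.1 q.1] at this
      rw [this]
      ring
    simp only [e]
    rw [frobNorm_sq, Fintype.sum_prod_type, hM, Finset.mul_sum]
    refine Finset.sum_congr rfl fun i _ => ?_
    simp
    ring
  set V : (Fin d₁ × Fin m → Fin d₂ × Fin d₂) → ℝ := fun ω => maxOf fun t =>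
    b t + ∑ q, (∑ a, pairWeight (Fin d₁ × Fin m) d₂ q a * y q t a ^ 2 - y q t (ω q) ^ 2) with hV
  have hV' : ∀ ω t, b t + ∑ q, (∑ a, pairWeight (Fin d₁ × Fin m) d₂ q a * y q t a ^ 2 -
      y q t (ω q) ^ 2) = 3 / 4 * (M * frobNorm (D t) ^ 2) - pairSum (D t) ω := by
    intro ω t
    rw [Finset.sum_sub_distrib, hmean, pairSum, hb]
    ring
  -- The cone condition bounds its members away from zero, since the Frobenius norm is at most the
  -- nuclear norm.
  have hBnuc : ∀ t, B ≤ nuclearNorm (D t) := by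
    intro t
    obtain ⟨-, -, h1, h2⟩ := hD t
    have h3 := frobNorm_le_nuclearNorm (D t)
    have h4 : B * frobNorm (D t) ≤ frobNorm (D t) * frobNorm (D t) := by
      calc B * frobNorm (D t) ≤ B * nuclearNorm (D t) := by gcongr
        _ ≤ _ := by rw [← sq]; exact h2
    exact (le_of_mul_le_mul_right h4 h1).trans h3
  have hEV : prodE (pairWeight (Fin d₁ × Fin m) d₂) V ≤ -(M * B ^ 2 / 16) := by
    set W := {ω : Fin d₁ × Fin m → Fin d₂ × Fin d₂ | ∃ v, u ^ 2 * ‖v‖ ^ 2 <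
      ∑ i, inner ℝ v (∑ l, pairVec (ω (i, l))) ^ 2} with hWdef
    have h1 := prodE_maxOf_sub_sq_le hp (Equiv.prodComm (Fin d₂) (Fin d₂)) (fun _ _ => rfl) b y
      (fun q t a => by simp [hy]) hyb
    -- When the spectral norm is at most `u`, half of `b t` pays for the linear term and the other
    -- half leaves `-(M * B ^ 2 / 8)`. On the exceptional event the trivial bound is used, and the
    -- indicator also refunds the negative constant.
    have h2 : ∀ ω, (maxOf fun t => b t + 4 * (4 * α) * ∑ q, y q t (ω q)) ≤
        -(M * B ^ 2 / 8) +
          (64 * α ^ 2 * (d₁ * m) + M * B ^ 2 / 8) * W.indicator 1 ω := by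
      intro ω
      refine maxOf_le fun t => ?_
      by_cases hω : ω ∈ W
      · rw [Set.indicator_of_mem hω]
        have h3 : ∑ q, y q t (ω q) ≤ (d₁ * m) * (4 * α) := by
          refine (Finset.sum_le_card_nsmul _ _ (4 * α) fun q _ =>
            (le_abs_self _).trans (hyb q t (ω q))).trans (le_of_eq ?_)
          simp
        have h4 : b t ≤ 0 := by
          simp only [hb]
          have : 0 ≤ M * frobNorm (D t) ^ 2 := by positivity
          linarith
        have h5 := mul_le_mul_of_nonneg_left h3 (by positivity : 0 ≤ 4 * (4 * α))
        simp only [Pi.one_apply, mul_one]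
        nlinarith
      · rw [Set.indicator_of_notMem hω, mul_zero, add_zero]
        have hω' : ∀ v : EuclideanSpace ℝ (Fin d₂),
            ∑ i, inner ℝ v (∑ l, pairVec (ω (i, l))) ^ 2 ≤ u ^ 2 * ‖v‖ ^ 2 := by
          intro v
          by_contra hcon
          exact hω ⟨v, not_le.mp hcon⟩
        have h3 := sum_pair_mul_le hu (D t) ω hω'
        have h4 := mul_le_mul_of_nonneg_left h3 (by positivity : 0 ≤ 4 * (4 * α))
        have h5 := mul_le_mul_of_nonneg_right huB (nuclearNorm_nonneg (D t))
        have h6 := mul_le_mul_of_nonneg_left (hD t).2.2.2 hM0.le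
        have h7 := mul_le_mul_of_nonneg_left (hBnuc t) (by positivity : 0 ≤ M * B)
        simp only [hb, hy]
        nlinarith
    refine h1.trans ((prodE_mono hp h2).trans ?_)
    rw [prodE_add, prodE_const hp, prodE_const_mul]
    have h3 : 0 ≤ 64 * α ^ 2 * (d₁ * m) + M * B ^ 2 / 8 := by positivity
    have h4 := mul_le_mul_of_nonneg_left hW h3
    rw [prodP] at h4
    linarith
  have hcard : (Fintype.card (Fin d₁ × Fin m) : ℝ) = d₁ * m := by simp
  have hmain := prodP_le_of_bounded_diff hp V (b := 16 * α ^ 2) (t := M * B ^ 2 / 16)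
    (by positivity) (by positivity) (by simp [hd₁, hm]) (fun ω i a ω' _ hl => ?_) hEV
  · rw [hcard] at hmain
    refine (prodP_mono hp ?_).trans hmain
    rintro ω ⟨t, ht⟩
    have := le_maxOf (fun t => b t + ∑ q, (∑ a, pairWeight (Fin d₁ × Fin m) d₂ q a * y q t a ^ 2 -
      y q t (ω q) ^ 2)) t
    simp only [hV'] at this
    change 0 < V ω
    simp only [hV, hV']
    linarith
  · have hsq : ∀ t (a : Fin d₂ × Fin d₂), 0 ≤ y i t a ^ 2 ∧ y i t a ^ 2 ≤ 16 * α ^ 2 := by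
      intro t a
      refine ⟨sq_nonneg _, ?_⟩
      rw [← sq_abs]
      calc |y i t a| ^ 2 ≤ (4 * α) ^ 2 := by gcongr; exact hyb i t a
        _ = _ := by ring
    have hpt : ∀ t, pairSum (D t) ω' - pairSum (D t) ω = y i t (ω' i) ^ 2 - y i t (ω i) ^ 2 := by
      intro t
      rw [pairSum, pairSum, ← Finset.sum_sub_distrib, Finset.sum_eq_single i]
      · intro q _ hq
        rw [hl q hq, sub_self]
      · simp
    simp only [hV, hV']
    rw [abs_le]
    constructor
    · have : (maxOf fun t => 3 / 4 * (M * frobNorm (D t) ^ 2) - pairSum (D t) ω) ≤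
          (maxOf fun t => 3 / 4 * (M * frobNorm (D t) ^ 2) - pairSum (D t) ω') + 16 * α ^ 2 := by
        refine maxOf_le fun t => ?_
        have h1 := le_maxOf (fun t => 3 / 4 * (M * frobNorm (D t) ^ 2) - pairSum (D t) ω') t
        linarith [hpt t, hsq t (ω i), hsq t (ω' i)]
      linarith
    · have : (maxOf fun t => 3 / 4 * (M * frobNorm (D t) ^ 2) - pairSum (D t) ω') ≤
          (maxOf fun t => 3 / 4 * (M * frobNorm (D t) ^ 2) - pairSum (D t) ω) + 16 * α ^ 2 := by
        refine maxOf_le fun t => ?_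
        have h1 := le_maxOf (fun t => 3 / 4 * (M * frobNorm (D t) ^ 2) - pairSum (D t) ω) t
        linarith [hpt t, hsq t (ω i), hsq t (ω' i)]
      linarith

/-- Restricted strong convexity for the uniform pairs, simultaneously over the cone. -/
theorem prodP_pairSum_lt_le {m : ℕ} (hd₁ : 0 < d₁)
    (hd₂ : 0 < d₂) (hm : 0 < m) {α B u ε M : ℝ} (hα : 0 < α) (hB : 0 < B) (hu : 0 ≤ u)
    (hM : M = 2 * m / d₂)
    (huB : 16 * α * u ≤ M * B / 8)
    (hW : prodP (pairWeight (Fin d₁ × Fin m) d₂) {ω | ∃ v, u ^ 2 * ‖v‖ ^ 2 <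
      ∑ i, inner ℝ v (∑ l, pairVec (ω (i, l))) ^ 2} ≤ ε)
    (hεB : ε * (64 * α ^ 2 * (d₁ * m) + M * B ^ 2 / 8) ≤ M * B ^ 2 / 16) :
    prodP (pairWeight (Fin d₁ × Fin m) d₂)
        {ω | ∃ D ∈ coneSet d₁ d₂ α B, pairSum D ω < 3 / 4 * (M * frobNorm D ^ 2)} ≤
      Real.exp (-((M * B ^ 2 / 16) ^ 2 / (2 * (d₁ * m) * (16 * α ^ 2) ^ 2))) := by
  classical
  have hp : IsProbWeight (pairWeight (Fin d₁ × Fin m) d₂) := pairWeight_isProbWeight _ hd₂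
  set S := {ω : Fin d₁ × Fin m → Fin d₂ × Fin d₂ |
    ∃ D ∈ coneSet d₁ d₂ α B, pairSum D ω < 3 / 4 * (M * frobNorm D ^ 2)} with hS
  -- The cone is infinite but the sample space is finite: one violating matrix per bad outcome gives
  -- a finite family with the same bad event.
  choose D hDc hDlt using fun ω : S => ω.2
  by_cases hne : Nonempty S
  · refine (prodP_mono hp ?_).trans
      (prodP_pairSum_lt_le_of_fintype hd₁ hd₂ hm hα hB hu hM D hDc huB hW hεB)
    intro ω hω
    exact ⟨⟨ω, hω⟩, hDlt ⟨ω, hω⟩⟩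
  · have : S = ∅ := Set.isEmpty_coe_sort.mp (not_nonempty_iff.mp hne)
    rw [this, prodP, Set.indicator_empty]
    exact (prodE_const hp 0).le.trans (Real.exp_pos _).le

end RestrictedStrongConvexity

end MNLRanking

namespace MNLRanking

/-! ### The sampling law as a finite product of weights. -/

section SampleWeights

variable {d₁ d₂ k : ℕ}

instance instDiscreteMeasurableSpacePerm (k : ℕ) :
    DiscreteMeasurableSpace (Equiv.Perm (Fin k)) := ⟨fun _ => trivial⟩

/-- The probability of the outcome of a user, as a real number. -/
noncomputable def userWeight (θ : Fin d₂ → ℝ) (x : UserOutcome d₂ k) : ℝ :=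
  ((d₂ : ℝ) ^ k)⁻¹ * rankProb (fun s => θ (x.1 s)) x.2

theorem userWeight_nonneg (θ : Fin d₂ → ℝ) (x : UserOutcome d₂ k) : 0 ≤ userWeight θ x :=
  mul_nonneg (by positivity) (rankProb_nonneg _ _)

theorem sum_userWeight_mul (θ : Fin d₂ → ℝ) (f : UserOutcome d₂ k → ℝ) :
    ∑ x, userWeight θ x * f x =
      ((d₂ : ℝ) ^ k)⁻¹ * ∑ J, ∑ σ, rankProb (fun s => θ (J s)) σ * f (J, σ) := by
  rw [Fintype.sum_prod_type, Finset.mul_sum]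
  refine Finset.sum_congr rfl fun J _ => ?_
  rw [Finset.mul_sum]
  exact Finset.sum_congr rfl fun σ _ => by rw [userWeight, mul_assoc]

theorem userWeight_isProbWeight [NeZero d₂] (Θ : Matrix (Fin d₁) (Fin d₂) ℝ) :
    IsProbWeight fun i => userWeight (k := k) (Θ i) := by
  refine ⟨fun i x => userWeight_nonneg _ x, fun i => ?_⟩
  have hd : (d₂ : ℝ) ≠ 0 := by exact_mod_cast NeZero.ne d₂
  have := sum_userWeight_mul (k := k) (Θ i) fun _ => 1
  simp only [mul_one, sum_rankProb] at this
  rw [this]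
  simp [hd]

theorem userPMF_apply [NeZero d₂] (θ : Fin d₂ → ℝ) (x : UserOutcome d₂ k) :
    userPMF k θ x = ENNReal.ofReal (userWeight θ x) := by
  classical
  obtain ⟨J, σ⟩ := x
  have hd : (0 : ℝ) < d₂ := by exact_mod_cast Nat.pos_of_ne_zero (NeZero.ne d₂)
  rw [userPMF, PMF.bind_apply, tsum_eq_single J]
  · rw [PMF.map_apply, tsum_eq_single σ]
    · simp only [if_true, PMF.uniformOfFintype_apply, rankPMF, PMF.ofFintype_apply, userWeight]
      rw [ENNReal.ofReal_mul (by positivity), ENNReal.ofReal_inv_of_pos (by positivity),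
        ENNReal.ofReal_pow hd.le]
      simp
    · intro σ' h
      rw [if_neg]
      rintro ⟨⟩
      exact h rfl
  · intro J' h
    rw [PMF.map_apply]
    convert mul_zero _
    rw [ENNReal.tsum_eq_zero]
    intro σ'
    rw [if_neg]
    rintro ⟨⟩
    exact h rfl

theorem sampleLaw_real_eq_prodP [NeZero d₂] (Θ : Matrix (Fin d₁) (Fin d₂) ℝ)
    (S : Set (Fin d₁ → UserOutcome d₂ k)) :
    (sampleLaw k Θ).real S = prodP (fun i => userWeight (Θ i)) S := by
  classical
  have hpt : ∀ ω, (sampleLaw k Θ).real {ω} = ∏ i, userWeight (Θ i) (ω i) := by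
    intro ω
    rw [Measure.real, sampleLaw, Measure.pi_singleton, ENNReal.toReal_prod]
    refine Finset.prod_congr rfl fun i _ => ?_
    rw [PMF.toMeasure_apply_singleton _ _ (measurableSet_singleton _), userPMF_apply,
      ENNReal.toReal_ofReal (userWeight_nonneg _ _)]
  have : IsProbabilityMeasure (sampleLaw k Θ) := by unfold sampleLaw; infer_instance
  have h : S = ((Finset.univ.filter (· ∈ S) : Finset (Fin d₁ → UserOutcome d₂ k)) : Set _) := by
    simp
  conv_lhs => rw [h, ← sum_measureReal_singleton]
  rw [prodP, prodE_eq, Finset.sum_filter]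
  refine Finset.sum_congr rfl fun ω _ => ?_
  by_cases hω : ω ∈ S <;> simp [hω, hpt]

end SampleWeights

/-! ### Spectral norm of the score matrix. -/

section Gradient

variable {d₁ d₂ k : ℕ}

/-- The uniform average over the families of items of a sum over the slots. -/
theorem sum_items_sum_slots [NeZero d₂] (f : Fin d₂ → ℝ) :
    ((d₂ : ℝ) ^ k)⁻¹ * ∑ J : Fin k → Fin d₂, ∑ s, f (J s) = k / d₂ * ∑ j, f j := by
  have hd : (d₂ : ℝ) ≠ 0 := by exact_mod_cast NeZero.ne d₂
  have hp : IsProbWeight fun (_ : Fin k) (_ : Fin d₂) => (d₂ : ℝ)⁻¹ :=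
    ⟨fun _ _ => by positivity, fun _ => by simp [hd]⟩
  have h := prodE_sum Finset.univ (fun (_ : Fin k) (_ : Fin d₂) => (d₂ : ℝ)⁻¹)
    (fun s (J : Fin k → Fin d₂) => f (J s))
  simp only [prodE_coord hp _ f] at h
  rw [prodE_eq] at h
  simp only [Finset.prod_const, Finset.card_univ, Fintype.card_fin, ← Finset.mul_sum,
    Finset.sum_const, nsmul_eq_mul, inv_pow] at h
  rw [h]
  field_simp

theorem inner_score (θ : Fin d₂ → ℝ) (J : Fin k → Fin d₂) (σ : Equiv.Perm (Fin k))
    (v : EuclideanSpace ℝ (Fin d₂)) :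
    inner ℝ v (WithLp.toLp 2 (score θ fun ℓ => J (σ ℓ))) =
      rankDev (fun s => θ (J s)) (fun s => v (J s)) σ := by
  have h := sum_score_mul θ (fun ℓ => J (σ ℓ)) v
  rw [PiLp.inner_apply]
  simp only [rankDev, softMean, smul_eq_mul]
  refine Eq.trans (Finset.sum_congr rfl fun j _ => ?_) (h.trans (Finset.sum_congr rfl fun ℓ _ => ?_))
  · simp
  · rw [div_eq_inv_mul]

/-- Given the items, the score is a martingale sum of coordinate vectors, whose mutual squared
distances are at most `2`; the ranking moment bounds apply. -/
theorem toLp_score_eq_rankDev (θ : Fin d₂ → ℝ) (J : Fin k → Fin d₂) (σ : Equiv.Perm (Fin k)) :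
    (WithLp.toLp 2 (score θ fun ℓ => J (σ ℓ)) : EuclideanSpace ℝ (Fin d₂)) =
      rankDev (fun s => θ (J s)) (fun s => EuclideanSpace.single (J s) (1 : ℝ)) σ := by
  refine ext_inner_left ℝ fun v => ?_
  rw [inner_score]
  simp only [rankDev, softMean, inner_sum, inner_sub_right, inner_smul_right, smul_eq_mul]
  simp [EuclideanSpace.inner_single_right]

/-- With high probability, the matrix of the scores has small spectral norm. -/
theorem prodP_score_le [NeZero d₂] (Θ : Matrix (Fin d₁) (Fin d₂) ℝ) {L : ℝ} (hk : 0 < k)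
    (hL : 1 ≤ L) :
    prodP (fun i => userWeight (k := k) (Θ i)) {ω | ∃ v : EuclideanSpace ℝ (Fin d₂),
      rowsLevel d₁ d₂ k L * ‖v‖ ^ 2 <
        ∑ i, inner ℝ v (WithLp.toLp 2 (score (Θ i) (rankedItems ω i))) ^ 2} ≤
      3 * (d₁ + d₂) * Real.exp (-(5 * L)) := by
  have hkR : (0 : ℝ) < k := by exact_mod_cast hk
  have hd : (d₂ : ℝ) ≠ 0 := by exact_mod_cast NeZero.ne d₂
  refine prodP_rows_le_exp (Nat.pos_of_ne_zero (NeZero.ne d₂)) (userWeight_isProbWeight Θ)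
    (fun i (x : UserOutcome d₂ k) => WithLp.toLp 2 (score (Θ i) fun ℓ => x.1 (x.2 ℓ))) hkR hL
    (fun i => ?_) (fun i v => ?_)
  · rw [sum_userWeight_mul]
    have h : ∀ J : Fin k → Fin d₂, ∑ σ, rankProb (fun s => Θ i (J s)) σ *
        Real.exp (1 / (16 * k) * ‖(WithLp.toLp 2 (score (Θ i) fun ℓ => J (σ ℓ)) :
          EuclideanSpace ℝ (Fin d₂))‖ ^ 2) ≤ Real.exp 1 := by
      intro J
      have := sum_rankProb_mul_exp_le (fun s => Θ i (J s))
        (fun s => (EuclideanSpace.single (J s) (1 : ℝ) : EuclideanSpace ℝ (Fin d₂)))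
        (fun s s' => norm_single_sub_single_sq_le _ _) 0 (η := 1 / (16 * k)) rfl hkR le_rfl
      simp only [zero_add] at this
      simp only [toLp_score_eq_rankDev]
      refine this.trans (Real.exp_le_exp.mpr ?_)
      have e : 4 * (1 / (16 * k)) * (k : ℝ) = 1 / 4 := by field_simp; norm_num
      rw [e, norm_zero]
      norm_num
    calc _ ≤ ((d₂ : ℝ) ^ k)⁻¹ * ∑ _J : Fin k → Fin d₂, Real.exp 1 :=
          mul_le_mul_of_nonneg_left (Finset.sum_le_sum fun J _ => h J) (by positivity)
      _ = Real.exp 1 := by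
          simp only [Finset.sum_const, Finset.card_univ, Fintype.card_fun, Fintype.card_fin,
            nsmul_eq_mul]
          push_cast
          field_simp
  · rw [sum_userWeight_mul]
    simp only [inner_score]
    have h : ∀ J : Fin k → Fin d₂, ∑ σ, rankProb (fun s => Θ i (J s)) σ *
        rankDev (fun s => Θ i (J s)) (fun s => v (J s)) σ ^ 2 ≤ ∑ s, v (J s) ^ 2 := fun J =>
      sum_rankProb_mul_rankDev_sq_le _ _
    refine (mul_le_mul_of_nonneg_left (Finset.sum_le_sum fun J _ => h J)
      (by positivity)).trans ?_
    rw [sum_items_sum_slots fun j => v j ^ 2, EuclideanSpace.norm_sq_eq]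
    simp

end Gradient

end MNLRanking

namespace MNLRanking

/-! ### Exponential clocks and MNL probabilities. -/

section Clocks

open ProbabilityTheory Set

theorem lintegral_expMeasure_indicator {a s : ℝ} (ha : 0 ≤ a) (hs : 0 ≤ s) :
    ∫⁻ x, (Ioi s).indicator (fun x => ENNReal.ofReal (Real.exp (-(a * x)))) x
      ∂(expMeasure 1) = ENNReal.ofReal (Real.exp (-((1 + a) * s)) / (1 + a)) := by
  have hm : Measurable fun x : ℝ => ENNReal.ofReal (Real.exp (-(a * x))) := by fun_prop
  have hg : Measurable (gammaPDF 1 1) := (measurable_gammaPDFReal 1 1).ennreal_ofReal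
  rw [expMeasure, gammaMeasure, lintegral_withDensity_eq_lintegral_mul _ hg
    (hm.indicator measurableSet_Ioi)]
  have e : ∀ x, (gammaPDF 1 1 * (Ioi s).indicator
      (fun x => ENNReal.ofReal (Real.exp (-(a * x))))) x =
      (Ioi s).indicator (fun x => ENNReal.ofReal (Real.exp (-(1 + a) * x))) x := by
    intro x
    by_cases hx : x ∈ Ioi s
    · have hx0 : 0 ≤ x := hs.trans (le_of_lt hx)
      have : gammaPDF 1 1 x = _ := exponentialPDF_of_nonneg (r := 1) hx0
      rw [Pi.mul_apply, indicator_of_mem hx, indicator_of_mem hx, this,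
        ← ENNReal.ofReal_mul (by positivity), one_mul, ← Real.exp_add]
      congr 2
      ring
    · simp [hx]
  simp only [e]
  rw [lintegral_indicator measurableSet_Ioi, ← ofReal_integral_eq_lintegral_ofReal
    (integrableOn_exp_mul_Ioi (by linarith) s) (Filter.Eventually.of_forall fun _ =>
      (Real.exp_pos _).le), integral_exp_mul_Ioi (by linarith)]
  congr 1
  rw [neg_mul, neg_div_neg_eq]

/-- The event that the clocks `E i * exp (-w i)` ring in increasing order, all after time `t`. -/
def chainEvent {k : ℕ} (w : Fin k → ℝ) (t : ℝ) : Set (Fin k → ℝ) :=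
  {E | (∀ i, t < E i * Real.exp (-w i)) ∧ StrictMono fun i => E i * Real.exp (-w i)}

theorem measurableSet_chainEvent {k : ℕ} (w : Fin k → ℝ) (t : ℝ) :
    MeasurableSet (chainEvent w t) := by
  have h : chainEvent w t = (⋂ i, {E | t < E i * Real.exp (-w i)}) ∩
      ⋂ i, ⋂ j, ⋂ (_ : i < j), {E | E i * Real.exp (-w i) < E j * Real.exp (-w j)} := by
    ext E
    simp [chainEvent, StrictMono]
  rw [h]
  refine (MeasurableSet.iInter fun i => measurableSet_lt (by fun_prop) (by fun_prop)).inter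
    (MeasurableSet.iInter fun i => MeasurableSet.iInter fun j => MeasurableSet.iInter fun _ =>
      measurableSet_lt (by fun_prop) (by fun_prop))

theorem cons_mem_chainEvent {k : ℕ} (w : Fin (k + 1) → ℝ) (t x : ℝ) (E : Fin k → ℝ) :
    (Fin.cons x E : Fin (k + 1) → ℝ) ∈ chainEvent w t ↔ t < x * Real.exp (-w 0) ∧
      E ∈ chainEvent (fun i => w i.succ) (x * Real.exp (-w 0)) := by
  simp only [chainEvent, mem_ofPred_eq, Fin.forall_fin_succ, Fin.cons_zero, Fin.cons_succ]
  constructor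
  · rintro ⟨⟨h0, -⟩, hm⟩
    refine ⟨h0, fun i => ?_, fun i j hij => ?_⟩
    · simpa using hm (Fin.succ_pos i)
    · simpa using hm (Fin.succ_lt_succ_iff.mpr hij)
  · rintro ⟨h0, h1, hm⟩
    refine ⟨⟨h0, fun i => h0.trans (h1 i)⟩, fun i j => ?_⟩
    refine Fin.cases ?_ (fun i => ?_) i <;> refine Fin.cases ?_ (fun j => ?_) j
    · intro h; exact absurd h (lt_irrefl _)
    · intro _; simpa using h1 j
    · intro h; simp at h
    · intro h; simpa using hm (Fin.succ_lt_succ_iff.mp h)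

theorem rankProb_one_succ {k : ℕ} (w : Fin (k + 1) → ℝ) :
    rankProb w 1 = Real.exp (w 0) / (∑ m, Real.exp (w m)) * rankProb (fun i => w i.succ) 1 := by
  have h := rankProb_decompose w 0 1
  have e : Equiv.Perm.decomposeFin.symm (0, (1 : Equiv.Perm (Fin k))) = 1 :=
    (Equiv.Perm.decomposeFin_symm_of_one 0).trans (Equiv.swap_self 0)
  rw [e] at h
  simpa only [Equiv.swap_self, Equiv.refl_apply] using h

/-- The joint law of independent clocks. -/
noncomputable def clockLaw (k : ℕ) : Measure (Fin k → ℝ) := Measure.pi fun _ => expMeasure 1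

instance instIsProbabilityMeasureClockLaw (k : ℕ) : IsProbabilityMeasure (clockLaw k) := by
  have := isProbabilityMeasure_expMeasure (r := 1) one_pos
  unfold clockLaw
  infer_instance

/-- Integrate out the first clock: the later ones must ring after it, which is the same event with
one clock fewer and a new starting time. This is why a general `t` is needed. Only the identity
ranking is treated; other rankings follow by relabelling. -/
theorem clockLaw_chainEvent {k : ℕ} (w : Fin k → ℝ) {t : ℝ} (ht : 0 ≤ t) :
    clockLaw k (chainEvent w t) =
      ENNReal.ofReal (Real.exp (-(t * ∑ i, Real.exp (w i))) * rankProb w 1) := by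
  have := isProbabilityMeasure_expMeasure (r := 1) one_pos
  induction k generalizing t with
  | zero =>
    have : chainEvent w t = univ := by
      ext E
      simp [chainEvent, StrictMono]
    simp [this, rankProb]
  | succ k ih =>
    set W := ∑ i : Fin k, Real.exp (w i.succ) with hW
    have hW0 : 0 ≤ W := Finset.sum_nonneg fun _ _ => (Real.exp_pos _).le
    have hmp := (measurePreserving_piFinSuccAbove (fun _ : Fin (k + 1) => expMeasure 1) 0).symm
    rw [clockLaw, ← hmp.measure_preimage_equiv, Measure.prod_apply
      (hmp.measurable (measurableSet_chainEvent w t))]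
    have e : ∀ x : ℝ, Measure.pi (fun _ : Fin k => expMeasure 1) (Prod.mk x ⁻¹'
        ((MeasurableEquiv.piFinSuccAbove (fun _ : Fin (k + 1) => ℝ) 0).symm ⁻¹'
          chainEvent w t)) =
        (Ioi (t * Real.exp (w 0))).indicator
          (fun x => ENNReal.ofReal (Real.exp (-(Real.exp (-w 0) * W * x)))) x *
          ENNReal.ofReal (rankProb (fun i => w i.succ) 1) := by
      intro x
      have hpre : Prod.mk x ⁻¹'
        ((MeasurableEquiv.piFinSuccAbove (fun _ : Fin (k + 1) => ℝ) 0).symm ⁻¹'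
          chainEvent w t) = {E | t < x * Real.exp (-w 0) ∧
            E ∈ chainEvent (fun i => w i.succ) (x * Real.exp (-w 0))} := by
        ext E
        have h2 := cons_mem_chainEvent w t x E
        simpa [MeasurableEquiv.piFinSuccAbove, Fin.consEquiv] using h2
      rw [hpre]
      have hiff : t < x * Real.exp (-w 0) ↔ x ∈ Ioi (t * Real.exp (w 0)) := by
        rw [Real.exp_neg, ← div_eq_mul_inv, lt_div_iff₀ (Real.exp_pos _), mem_Ioi]
      by_cases hx : x ∈ Ioi (t * Real.exp (w 0))
      · have hx' := hiff.mpr hx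
        simp only [hx', true_and, ofPred_mem_eq]
        have := ih (fun i => w i.succ) (t := x * Real.exp (-w 0)) (ht.trans hx'.le)
        rw [clockLaw] at this
        rw [this, indicator_of_mem hx, ← ENNReal.ofReal_mul (Real.exp_pos _).le]
        congr 4
        ring
      · simp [hiff, hx]
    simp only [e]
    rw [lintegral_mul_const', lintegral_expMeasure_indicator (by positivity) (by positivity),
      ← ENNReal.ofReal_mul (by positivity), rankProb_one_succ, Fin.sum_univ_succ, ← hW]
    · congr 1
      rw [Real.exp_neg (w 0)]
      have h0 := Real.exp_pos (w 0)
      have e1 : (1 + (Real.exp (w 0))⁻¹ * W) = (Real.exp (w 0) + W) / Real.exp (w 0) := by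
        field_simp
      have e2 : (Real.exp (w 0) + W) / Real.exp (w 0) * (t * Real.exp (w 0)) =
        t * (Real.exp (w 0) + W) := by field_simp
      rw [e1, e2]
      have : 0 < Real.exp (w 0) + W := by positivity
      field_simp
    · exact ENNReal.ofReal_ne_top

end Clocks

end MNLRanking

namespace MNLRanking

/-! ### Realizing the sampling model by items and independent clocks. -/

section ClockSampling

open ProbabilityTheory Set

/-- The ranking of the slots by the times `E s * exp (-w s)` at which their clocks ring. -/
noncomputable def clockRank {k : ℕ} (w : Fin k → ℝ) (E : Fin k → ℝ) : Equiv.Perm (Fin k) :=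
  Tuple.sort fun s => E s * Real.exp (-w s)

theorem measurable_clockRank {k : ℕ} (w : Fin k → ℝ) : Measurable (clockRank w) := by
  refine measurable_to_countable' fun σ => ?_
  have h : clockRank w ⁻¹' {σ} = (⋂ i, ⋂ j, ⋂ (_ : i ≤ j),
      {E | E (σ i) * Real.exp (-w (σ i)) ≤ E (σ j) * Real.exp (-w (σ j))}) ∩
      ⋂ i, ⋂ j, ⋂ (_ : i < j), ({E | E (σ i) * Real.exp (-w (σ i)) =
        E (σ j) * Real.exp (-w (σ j))}ᶜ ∪ {_E | σ i < σ j}) := by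
    ext E
    simp only [mem_preimage, mem_singleton_iff, clockRank, eq_comm (b := σ), Tuple.eq_sort_iff,
      mem_inter_iff, mem_iInter, mem_union, mem_compl_iff, mem_ofPred_eq, Monotone,
      Function.comp_apply, imp_iff_not_or (a := _ = _)]
  rw [h]
  refine (MeasurableSet.iInter fun i => MeasurableSet.iInter fun j => MeasurableSet.iInter fun _ =>
      measurableSet_le (by fun_prop) (by fun_prop)).inter
    (MeasurableSet.iInter fun i => MeasurableSet.iInter fun j => MeasurableSet.iInter fun _ =>
      (measurableSet_eq_fun (by fun_prop) (by fun_prop)).compl.union (MeasurableSet.const _))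

theorem rankProb_comp {k : ℕ} (w : Fin k → ℝ) (σ : Equiv.Perm (Fin k)) :
    rankProb (fun i => w (σ i)) 1 = rankProb w σ := rfl

/-- Strictly increasing ringing times along `σ` make `σ` the sorting permutation. An inequality
suffices, because two probability measures with one below the other are equal; ties need not be
shown null. -/
theorem ofReal_rankProb_le_clockLaw {k : ℕ} (w : Fin k → ℝ) (σ : Equiv.Perm (Fin k)) :
    ENNReal.ofReal (rankProb w σ) ≤ (clockLaw k).map (clockRank w) {σ} := by
  have := isProbabilityMeasure_expMeasure (r := 1) one_pos
  have h := clockLaw_chainEvent (fun i => w (σ i)) le_rfl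
  rw [zero_mul, neg_zero, Real.exp_zero, one_mul, rankProb_comp] at h
  have hmp := (measurePreserving_piCongrLeft (α := fun _ : Fin k => ℝ)
    (fun _ : Fin k => expMeasure 1) σ).symm
  rw [← h, Measure.map_apply (measurable_clockRank w) (measurableSet_singleton σ), clockLaw,
    ← hmp.measure_preimage_equiv]
  refine measure_mono fun E hE => ?_
  have hE' : StrictMono fun i => E (σ i) * Real.exp (-w (σ i)) := hE.2
  rw [mem_preimage, mem_singleton_iff, clockRank, eq_comm, Tuple.eq_sort_iff]
  exact ⟨hE'.monotone, fun i j hij he => absurd he (hE' hij).ne⟩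

/-- Independent exponential clocks ring in the order given by the MNL law. -/
theorem map_clockRank {k : ℕ} (w : Fin k → ℝ) :
    (clockLaw k).map (clockRank w) = (rankPMF w).toMeasure := by
  have : IsProbabilityMeasure ((clockLaw k).map (clockRank w)) :=
    Measure.isProbabilityMeasure_map (measurable_clockRank w).aemeasurable
  symm
  refine Measure.eq_of_le_of_isProbabilityMeasure (Measure.le_iff.mpr fun s _ => ?_)
  classical
  have hs : s = ((Finset.univ.filter (· ∈ s) : Finset (Equiv.Perm (Fin k))) : Set _) := by simp
  rw [hs, ← sum_measure_singleton, ← sum_measure_singleton]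
  refine Finset.sum_le_sum fun σ _ => ?_
  rw [PMF.toMeasure_apply_singleton _ _ (measurableSet_singleton _)]
  exact ofReal_rankProb_le_clockLaw w σ

/-- The law of the items of one user. -/
noncomputable def itemLaw (d₂ k : ℕ) [NeZero d₂] : Measure (Fin k → Fin d₂) :=
  (PMF.uniformOfFintype (Fin k → Fin d₂)).toMeasure

instance instIsProbabilityMeasureItemLaw (d₂ k : ℕ) [NeZero d₂] :
    IsProbabilityMeasure (itemLaw d₂ k) := by
  unfold itemLaw
  infer_instance

/-- The outcome of a user, from the items and the clocks. -/
noncomputable def clockOutcome {d₂ k : ℕ} (θ : Fin d₂ → ℝ)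
    (x : (Fin k → Fin d₂) × (Fin k → ℝ)) : UserOutcome d₂ k :=
  (x.1, clockRank (fun s => θ (x.1 s)) x.2)

theorem measurable_clockOutcome {d₂ k : ℕ} (θ : Fin d₂ → ℝ) :
    Measurable (clockOutcome (k := k) θ) := by
  have h : Measurable fun x : (Fin k → Fin d₂) × (Fin k → ℝ) =>
      clockRank (fun s => θ (x.1 s)) x.2 :=
    measurable_from_prod_countable_right fun J => measurable_clockRank fun s => θ (J s)
  exact measurable_fst.prodMk h

theorem map_clockOutcome {d₂ k : ℕ} [NeZero d₂] (θ : Fin d₂ → ℝ) :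
    ((itemLaw d₂ k).prod (clockLaw k)).map (clockOutcome θ) = (userPMF k θ).toMeasure := by
  refine Measure.ext_of_singleton fun x => ?_
  obtain ⟨J, σ⟩ := x
  have hd : (0 : ℝ) < d₂ := by exact_mod_cast Nat.pos_of_ne_zero (NeZero.ne d₂)
  have h : clockOutcome θ ⁻¹' {(J, σ)} =
      ({J} : Set (Fin k → Fin d₂)) ×ˢ (clockRank (fun s => θ (J s)) ⁻¹' {σ}) := by
    ext ⟨J', E⟩
    simp only [clockOutcome, mem_preimage, mem_singleton_iff, Prod.mk.injEq, mem_prod]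
    constructor <;> · rintro ⟨rfl, h⟩; exact ⟨rfl, h⟩
  rw [Measure.map_apply (measurable_clockOutcome θ) (measurableSet_singleton _), h,
    Measure.prod_prod, ← Measure.map_apply (measurable_clockRank _) (measurableSet_singleton _),
    map_clockRank, itemLaw, PMF.toMeasure_apply_singleton _ _ (measurableSet_singleton _),
    PMF.toMeasure_apply_singleton _ _ (measurableSet_singleton _),
    PMF.toMeasure_apply_singleton _ _ (measurableSet_singleton _), userPMF_apply, userWeight,
    ENNReal.ofReal_mul (by positivity), ENNReal.ofReal_inv_of_pos (by positivity),
    ENNReal.ofReal_pow hd.le, rankPMF, PMF.ofFintype_apply]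
  simp

/-- The outcomes of all users, from the items and the clocks. -/
noncomputable def clockSample {d₁ d₂ k : ℕ} (Θ : Matrix (Fin d₁) (Fin d₂) ℝ)
    (J : Fin d₁ → Fin k → Fin d₂) (E : Fin d₁ → Fin k → ℝ) : Fin d₁ → UserOutcome d₂ k :=
  fun i => clockOutcome (Θ i) (J i, E i)

/-- A bad event has small probability if it has small probability over the items for all clocks
outside of an event of small probability. -/
theorem sampleLaw_le_of_clocks {d₁ d₂ k : ℕ} [NeZero d₂] (Θ : Matrix (Fin d₁) (Fin d₂) ℝ)
    (S : Set (Fin d₁ → UserOutcome d₂ k)) (G : Set (Fin d₁ → Fin k → ℝ)) {δ η : ℝ}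
    (hδ : 0 ≤ δ) (hη : 0 ≤ η) (hG : (Measure.pi fun _ : Fin d₁ => clockLaw k).real Gᶜ ≤ η)
    (h : ∀ E ∈ G, (Measure.pi fun _ : Fin d₁ => itemLaw d₂ k).real
      {J | clockSample Θ J E ∈ S} ≤ δ) :
    (sampleLaw k Θ).real S ≤ η + δ := by
  set ν := Measure.pi fun _ : Fin d₁ => itemLaw d₂ k
  set μ := Measure.pi fun _ : Fin d₁ => clockLaw k
  have hmp := (measurePreserving_arrowProdEquivProdArrow (Fin k → Fin d₂) (Fin k → ℝ) (Fin d₁)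
    (fun _ => itemLaw d₂ k) (fun _ => clockLaw k)).symm
  have hm : Measurable fun (x : Fin d₁ → (Fin k → Fin d₂) × (Fin k → ℝ)) i =>
      clockOutcome (Θ i) (x i) :=
    measurable_pi_lambda _ fun i => (measurable_clockOutcome (Θ i)).comp (measurable_pi_apply i)
  have hlaw : sampleLaw k Θ = (ν.prod μ).map fun x => clockSample Θ x.1 x.2 := by
    have h1 : sampleLaw k Θ = (Measure.pi fun _ : Fin d₁ =>
        (itemLaw d₂ k).prod (clockLaw k)).map fun x i => clockOutcome (Θ i) (x i) := by
      have : ∀ i : Fin d₁, SigmaFinite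
          (((itemLaw d₂ k).prod (clockLaw k)).map (clockOutcome (Θ i))) := fun i => by
        rw [map_clockOutcome]; infer_instance
      rw [Measure.pi_map_pi fun i => (measurable_clockOutcome (Θ i)).aemeasurable, sampleLaw]
      simp only [map_clockOutcome]
    rw [h1, ← hmp.map_eq, Measure.map_map hm hmp.measurable]
    rfl
  have hm' : Measurable fun x : (Fin d₁ → Fin k → Fin d₂) × (Fin d₁ → Fin k → ℝ) =>
      clockSample Θ x.1 x.2 := hm.comp hmp.measurable
  have hS : MeasurableSet S := S.toFinite.measurableSet
  have hS' := hm' hS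
  have key : sampleLaw k Θ S ≤ ENNReal.ofReal η + ENNReal.ofReal δ := by
    rw [hlaw, Measure.map_apply hm' hS, Measure.prod_apply_symm hS']
    -- Items and clocks are independent, so Fubini allows the items to be integrated with the clocks
    -- frozen.
    calc ∫⁻ E, ν ((fun J => (J, E)) ⁻¹' ((fun x => clockSample Θ x.1 x.2) ⁻¹' S)) ∂μ
        ≤ ∫⁻ E, (Gᶜ.indicator 1 E + ENNReal.ofReal δ) ∂μ := by
          refine lintegral_mono fun E => ?_
          by_cases hE : E ∈ G
          · have h2 := h E hE
            rw [Measure.real, ← ENNReal.le_ofReal_iff_toReal_le (measure_ne_top _ _) hδ] at h2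
            exact h2.trans le_add_self
          · rw [indicator_of_mem hE]
            exact prob_le_one.trans le_self_add
      _ ≤ μ Gᶜ + ENNReal.ofReal δ := by
          rw [lintegral_add_right _ measurable_const, lintegral_const, measure_univ, mul_one]
          gcongr
          exact lintegral_indicator_one_le _
      _ ≤ _ := by
          gcongr
          rwa [ENNReal.le_ofReal_iff_toReal_le (measure_ne_top _ _) hη]
  rw [Measure.real]
  refine ENNReal.toReal_le_of_le_ofReal (by positivity) ?_
  rwa [ENNReal.ofReal_add hη hδ]

end ClockSampling

end MNLRanking

namespace MNLRanking

/-! ### Enough early and late clocks. -/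

section ClockTail

open ProbabilityTheory Set

/-- Lower-tail Chernoff bound with parameter `1 / 5`: the mean factor is at most `exp (-9 q / 100)`
by `exp (-1 / 5) ≤ 41 / 50`, and the threshold costs `exp (8 q / 100)`, both per clock. -/
theorem clockLaw_card_lt_le (k : ℕ) {A : Set ℝ} [DecidablePred (· ∈ A)] (hA : MeasurableSet A)
    {q : ℝ} (hq : q / 2 ≤ (expMeasure 1).real A) :
    (clockLaw k).real {E | ((Finset.univ.filter fun s => E s ∈ A).card : ℝ) < 2 / 5 * q * k} ≤
      Real.exp (-(q * k / 100)) := by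
  have := isProbabilityMeasure_expMeasure (r := 1) one_pos
  set p := (expMeasure 1).real A
  set g : ℝ → ℝ := fun x => 1 - A.indicator (fun _ => 1 - Real.exp (-(1 / 5))) x with hg
  have he : Real.exp (-(1 / 5)) ≤ 41 / 50 := by
    have h := Real.quadratic_le_exp_of_nonneg (x := 1 / 5) (by norm_num)
    rw [Real.exp_neg]
    refine inv_le_of_inv_le₀ (by norm_num) (le_trans (by norm_num) h)
  have hgi : Integrable g (expMeasure 1) :=
    (integrable_const 1).sub ((integrable_const _).indicator hA)
  have hgint : ∫ x, g x ∂(expMeasure 1) = 1 - p * (1 - Real.exp (-(1 / 5))) := by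
    rw [hg, integral_sub (integrable_const 1) ((integrable_const _).indicator hA),
      integral_indicator_const _ hA]
    simp [p]
  have hp0 : 0 ≤ p := measureReal_nonneg
  have hp1 : p ≤ 1 := measureReal_le_one
  have hgle : ∫ x, g x ∂(expMeasure 1) ≤ Real.exp (-(9 / 100 * q)) := by
    rw [hgint]
    refine le_trans ?_ (Real.add_one_le_exp _)
    nlinarith
  have hg0 : 0 ≤ ∫ x, g x ∂(expMeasure 1) := by
    rw [hgint]
    nlinarith [Real.exp_pos (-(1 / 5 : ℝ))]
  have hprod : ∀ E : Fin k → ℝ, ∏ s, g (E s) =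
      Real.exp (-(1 / 5 * ((Finset.univ.filter fun s => E s ∈ A).card : ℝ))) := by
    intro E
    have : ∀ s, g (E s) = if E s ∈ A then Real.exp (-(1 / 5)) else 1 := by
      intro s
      by_cases h : E s ∈ A <;> simp [hg, h]
    simp only [this, Finset.prod_ite, Finset.prod_const, one_pow, mul_one]
    rw [← Real.exp_nat_mul]
    congr 1
    ring
  have hint : Integrable (fun E : Fin k → ℝ => ∏ s, g (E s)) (clockLaw k) :=
    Integrable.fintype_prod fun _ => hgi
  have hM := mul_meas_ge_le_integral_of_nonneg (μ := clockLaw k)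
    (Filter.Eventually.of_forall fun E => by
      rw [hprod]; exact (Real.exp_pos _).le) hint (Real.exp (-(1 / 5 * (2 / 5 * q * k))))
  have hI : ∫ E : Fin k → ℝ, ∏ s, g (E s) ∂(clockLaw k) = (∫ x, g x ∂(expMeasure 1)) ^ k := by
    rw [clockLaw, integral_fintype_prod_eq_pow, Fintype.card_fin]
  rw [hI] at hM
  have hsub : (clockLaw k).real {E | ((Finset.univ.filter fun s => E s ∈ A).card : ℝ) <
      2 / 5 * q * k} ≤ (clockLaw k).real {E | Real.exp (-(1 / 5 * (2 / 5 * q * k))) ≤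
        ∏ s, g (E s)} := by
    refine measureReal_mono fun E hE => ?_
    simp only [mem_ofPred_eq] at hE ⊢
    rw [hprod]
    refine Real.exp_le_exp.mpr ?_
    linarith
  have hpow : (∫ x, g x ∂(expMeasure 1)) ^ k ≤ Real.exp (-(9 / 100 * q * k)) := by
    refine (pow_le_pow_left₀ hg0 hgle k).trans (le_of_eq ?_)
    rw [← Real.exp_nat_mul]
    congr 1
    ring
  refine hsub.trans ?_
  have h3 : Real.exp (-(1 / 5 * (2 / 5 * q * k))) * Real.exp (-(q * k / 100)) =
      Real.exp (-(9 / 100 * q * k)) := by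
    rw [← Real.exp_add]
    congr 1
    ring
  rw [← h3] at hpow
  exact le_of_mul_le_mul_left (hM.trans hpow) (Real.exp_pos _)

theorem expMeasure_real_Iic {x : ℝ} (hx : 0 ≤ x) :
    (expMeasure 1).real (Iic x) = 1 - Real.exp (-x) := by
  have := isProbabilityMeasure_expMeasure (r := 1) one_pos
  rw [← cdf_eq_real, cdf_expMeasure_eq one_pos, if_pos hx, one_mul]

/-- The clocks are balanced if for every user sufficiently many clocks ring early, and sufficiently
many ring late. -/
def balancedClocks (d₁ k : ℕ) (α : ℝ) : Set (Fin d₁ → Fin k → ℝ) :=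
  {E | ∀ i, 2 / 5 * Real.exp (-α) * k ≤
      ((Finset.univ.filter fun s => E i s ∈ Iic (Real.exp (-α) * Real.log 2)).card : ℝ) ∧
    2 / 5 * 1 * (k : ℝ) ≤ ((Finset.univ.filter fun s => E i s ∈ Ioi (Real.log 2)).card : ℝ)}

theorem pi_clockLaw_balancedClocks_compl_le (d₁ k : ℕ) {α : ℝ} (hα : 0 ≤ α) :
    (Measure.pi fun _ : Fin d₁ => clockLaw k).real (balancedClocks d₁ k α)ᶜ ≤
      2 * d₁ * Real.exp (-(Real.exp (-α) * k / 100)) := by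
  have := isProbabilityMeasure_expMeasure (r := 1) one_pos
  have hl2 : 0 < Real.log 2 := Real.log_pos one_lt_two
  have hu1 : Real.exp (-α) ≤ 1 := Real.exp_le_one_iff.mpr (by linarith)
  have hu0 : 0 < Real.exp (-α) := Real.exp_pos _
  have hlow : Real.exp (-α) / 2 ≤ (expMeasure 1).real (Iic (Real.exp (-α) * Real.log 2)) := by
    rw [expMeasure_real_Iic (by positivity)]
    -- With `u = exp (-α) ≤ 1`, a clock rings before `u * log 2` with probability `1 - 2⁻ᵘ`, and
    -- Bernoulli's inequality gives at least `u / 2`.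
    have h := rpow_one_add_le_one_add_mul_self (s := -1 / 2) (by norm_num) hu0.le hu1
    have e : (1 + -1 / 2 : ℝ) ^ Real.exp (-α) = Real.exp (-(Real.exp (-α) * Real.log 2)) := by
      rw [Real.rpow_def_of_pos (by norm_num), show (1 + -1 / 2 : ℝ) = 2⁻¹ by norm_num,
        Real.log_inv]
      congr 1
      ring
    rw [e] at h
    linarith
  have hhigh : (1 : ℝ) / 2 ≤ (expMeasure 1).real (Ioi (Real.log 2)) := by
    rw [← compl_Iic, probReal_compl_eq_one_sub measurableSet_Iic, expMeasure_real_Iic hl2.le,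
      Real.exp_neg, Real.exp_log two_pos]
    norm_num
  set B₁ : Set (Fin k → ℝ) := {E | ((Finset.univ.filter fun s =>
    E s ∈ Iic (Real.exp (-α) * Real.log 2)).card : ℝ) < 2 / 5 * Real.exp (-α) * k}
  set B₂ : Set (Fin k → ℝ) := {E | ((Finset.univ.filter fun s =>
    E s ∈ Ioi (Real.log 2)).card : ℝ) < 2 / 5 * 1 * k}
  have h1 : (clockLaw k).real B₁ ≤ Real.exp (-(Real.exp (-α) * k / 100)) :=
    clockLaw_card_lt_le k measurableSet_Iic hlow
  have h2 : (clockLaw k).real B₂ ≤ Real.exp (-(Real.exp (-α) * k / 100)) := by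
    refine (clockLaw_card_lt_le k measurableSet_Ioi hhigh).trans (Real.exp_le_exp.mpr ?_)
    have : (0 : ℝ) ≤ k := by positivity
    nlinarith
  have hsub : (balancedClocks d₁ k α)ᶜ ⊆ ⋃ i : Fin d₁, Function.eval i ⁻¹' (B₁ ∪ B₂) := by
    intro E hE
    simp only [balancedClocks, mem_compl_iff, mem_ofPred_eq, not_forall, not_and_or, not_le] at hE
    obtain ⟨i, hi⟩ := hE
    exact mem_iUnion.mpr ⟨i, hi⟩
  have hev : ∀ (i : Fin d₁) (B : Set (Fin k → ℝ)),
      (Measure.pi fun _ : Fin d₁ => clockLaw k).real (Function.eval i ⁻¹' B) ≤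
        (clockLaw k).real B := by
    intro i B
    have hmp := measurePreserving_eval (fun _ : Fin d₁ => clockLaw k) i
    have h := Measure.le_map_apply (μ := Measure.pi fun _ : Fin d₁ => clockLaw k) hmp.measurable.aemeasurable B
    rw [hmp.map_eq] at h
    exact ENNReal.toReal_mono (measure_ne_top _ _) h
  calc _ ≤ (Measure.pi fun _ : Fin d₁ => clockLaw k).real
          (⋃ i : Fin d₁, Function.eval i ⁻¹' (B₁ ∪ B₂)) := measureReal_mono hsub
    _ ≤ ∑ i : Fin d₁, (Measure.pi fun _ : Fin d₁ => clockLaw k).real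
          (Function.eval i ⁻¹' (B₁ ∪ B₂)) := measureReal_iUnion_fintype_le _
    _ ≤ ∑ _i : Fin d₁, 2 * Real.exp (-(Real.exp (-α) * k / 100)) := by
        refine Finset.sum_le_sum fun i _ => (hev i _).trans ?_
        refine (measureReal_union_le _ _).trans ?_
        linarith
    _ = _ := by
        simp only [Finset.sum_const, Finset.card_univ, Fintype.card_fin, nsmul_eq_mul]
        ring

end ClockTail

/-! ### Items in distinct slots are independent and uniform. -/

section ItemMarginals

variable {X Y A : Type*} [Fintype X] [Fintype Y] [Fintype A] [DecidableEq X] [DecidableEq Y]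

/-- The marginal of a uniform family on distinct coordinates is uniform, since all restrictions have
equally many extensions. The form without division also covers empty types. -/
theorem card_mul_sum_comp_injective {g : Y → X} (hg : Function.Injective g) (f : (Y → A) → ℝ) :
    (Fintype.card (Y → A) : ℝ) * ∑ J : X → A, f (J ∘ g) =
      Fintype.card (X → A) * ∑ K : Y → A, f K := by
  classical
  let e : Y ⊕ ((Set.range g)ᶜ : Set X) ≃ X :=
    (Equiv.sumCongr (Equiv.ofInjective g hg) (Equiv.refl _)).trans (Equiv.Set.sumCompl _)
  let e' : (Y → A) × (((Set.range g)ᶜ : Set X) → A) ≃ (X → A) :=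
    (Equiv.sumArrowEquivProdArrow _ _ A).symm.trans (e.arrowCongr (Equiv.refl A))
  have he : ∀ x, e' x ∘ g = x.1 := by
    intro x
    funext y
    have : e.symm (g y) = Sum.inl y := by
      rw [Equiv.symm_apply_eq]
      simp [e]
    simp [e', Equiv.arrowCongr, this, Equiv.sumArrowEquivProdArrow]
  have hsum : ∀ f : (Y → A) → ℝ, ∑ J : X → A, f (J ∘ g) =
      Fintype.card (((Set.range g)ᶜ : Set X) → A) * ∑ K : Y → A, f K := by
    intro f
    rw [← e'.sum_comp, Fintype.sum_prod_type]
    simp only [he, Finset.sum_const, Finset.card_univ, nsmul_eq_mul, Finset.mul_sum]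
  have h1 := hsum fun _ => 1
  simp only [Finset.sum_const, Finset.card_univ, nsmul_eq_mul, mul_one] at h1
  rw [hsum f, h1]
  ring

end ItemMarginals

section PairMarginals

open Set

variable {d₁ d₂ k m : ℕ}

/-- The pairs of items in the pairs of slots selected by `e`. -/
def selectedPairs (e : Fin d₁ → Fin m ⊕ Fin m → Fin k) (J : Fin d₁ → Fin k → Fin d₂) :
    Fin d₁ × Fin m → Fin d₂ × Fin d₂ :=
  fun q => (J q.1 (e q.1 (Sum.inl q.2)), J q.1 (e q.1 (Sum.inr q.2)))

/-- Disjoint pairs of slots hold independent uniform pairs of items. -/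
theorem pi_itemLaw_selectedPairs [NeZero d₂] {e : Fin d₁ → Fin m ⊕ Fin m → Fin k}
    (he : ∀ i, Function.Injective (e i)) (S : Set (Fin d₁ × Fin m → Fin d₂ × Fin d₂)) :
    (Measure.pi fun _ : Fin d₁ => itemLaw d₂ k).real {J | selectedPairs e J ∈ S} =
      prodP (pairWeight (Fin d₁ × Fin m) d₂) S := by
  classical
  have hd : (d₂ : ℝ) ≠ 0 := by exact_mod_cast NeZero.ne d₂
  have hpt : ∀ J, (Measure.pi fun _ : Fin d₁ => itemLaw d₂ k).real {J} =
      (Fintype.card (Fin d₁ × Fin k → Fin d₂) : ℝ)⁻¹ := by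
    intro J
    rw [Measure.real, Measure.pi_singleton, ENNReal.toReal_prod]
    simp only [itemLaw, PMF.toMeasure_apply_singleton _ _ (measurableSet_singleton _),
      PMF.uniformOfFintype_apply, ENNReal.toReal_inv, ENNReal.toReal_natCast, Finset.prod_const,
      Finset.card_univ, Fintype.card_fun, Fintype.card_fin, Fintype.card_prod]
    rw [inv_pow]
    congr 1
    push_cast
    rw [← pow_mul, mul_comm]
  let g : (Fin d₁ × Fin m) ⊕ (Fin d₁ × Fin m) → Fin d₁ × Fin k :=
    Sum.elim (fun q => (q.1, e q.1 (Sum.inl q.2))) fun q => (q.1, e q.1 (Sum.inr q.2))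
  have hg : Function.Injective g := by
    rintro (⟨i, l⟩ | ⟨i, l⟩) (⟨i', l'⟩ | ⟨i', l'⟩) h <;>
    · simp only [g, Sum.elim_inl, Sum.elim_inr, Prod.mk.injEq] at h
      obtain ⟨rfl, h⟩ := h
      have := he i h
      simp_all
  let pr : ((Fin d₁ × Fin m) ⊕ (Fin d₁ × Fin m) → Fin d₂) ≃
      (Fin d₁ × Fin m → Fin d₂ × Fin d₂) :=
    (Equiv.sumArrowEquivProdArrow _ _ _).trans (Equiv.arrowProdEquivProdArrow _ _ _).symm
  have h1 : (Measure.pi fun _ : Fin d₁ => itemLaw d₂ k).real {J | selectedPairs e J ∈ S} =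
      (Fintype.card (Fin d₁ × Fin k → Fin d₂) : ℝ)⁻¹ *
        ∑ J : Fin d₁ × Fin k → Fin d₂, S.indicator 1 (pr (J ∘ g)) := by
    have h : {J : Fin d₁ → Fin k → Fin d₂ | selectedPairs e J ∈ S} =
      ((Finset.univ.filter (fun J => selectedPairs e J ∈ S) : Finset _) : Set _) := by
      ext; simp
    rw [h, ← sum_measureReal_singleton]
    simp only [hpt]
    rw [Finset.sum_const, nsmul_eq_mul, mul_comm, Finset.card_filter,
      ← (Equiv.curry (Fin d₁) (Fin k) (Fin d₂)).sum_comp]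
    push_cast
    rfl
  have h2 : prodP (pairWeight (Fin d₁ × Fin m) d₂) S =
      (Fintype.card ((Fin d₁ × Fin m) ⊕ (Fin d₁ × Fin m) → Fin d₂) : ℝ)⁻¹ *
        ∑ K : (Fin d₁ × Fin m) ⊕ (Fin d₁ × Fin m) → Fin d₂, S.indicator 1 (pr K) := by
    rw [prodP, prodE_eq, pr.sum_comp (fun ω => S.indicator 1 ω), Finset.mul_sum]
    refine Finset.sum_congr rfl fun ω _ => ?_
    congr 1
    simp only [pairWeight, Finset.prod_const, Finset.card_univ, Fintype.card_prod,
      Fintype.card_fun, Fintype.card_fin, Fintype.card_sum]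
    rw [inv_pow]
    congr 1
    push_cast
    rw [← pow_mul]
    congr 1
    ring
  have h3 := card_mul_sum_comp_injective hg fun K => (S.indicator 1 (pr K) : ℝ)
  rw [h1, h2]
  have hc1 : (Fintype.card (Fin d₁ × Fin k → Fin d₂) : ℝ) ≠ 0 := by
    exact_mod_cast Fintype.card_ne_zero
  have hc2 : (Fintype.card ((Fin d₁ × Fin m) ⊕ (Fin d₁ × Fin m) → Fin d₂) : ℝ) ≠ 0 := by
    exact_mod_cast Fintype.card_ne_zero
  rw [inv_mul_eq_div, inv_mul_eq_div, div_eq_div_iff hc1 hc2, mul_comm, h3, mul_comm]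

end PairMarginals

end MNLRanking

namespace MNLRanking

/-! ### Curvature of the likelihood from late slots. -/

section Curvature

open Set

variable {d₁ d₂ k m : ℕ}

/-- The factor `exp (-α)` between the two thresholds outweighs any difference of utilities, so this
order does not depend on the items. -/
theorem early_clock_lt_late_clock {θ : Fin d₂ → ℝ} {α : ℝ} (hθ : ∀ j j', θ j - θ j' ≤ α)
    (J : Fin k → Fin d₂) {E : Fin k → ℝ} {s s' : Fin k}
    (hs : E s ≤ Real.exp (-α) * Real.log 2) (hs' : Real.log 2 < E s') :
    E s * Real.exp (-θ (J s)) < E s' * Real.exp (-θ (J s')) := by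
  have hl2 : 0 < Real.log 2 := Real.log_pos one_lt_two
  calc E s * Real.exp (-θ (J s)) ≤ Real.exp (-α) * Real.log 2 * Real.exp (-θ (J s)) :=
        mul_le_mul_of_nonneg_right hs (Real.exp_pos _).le
    _ = Real.log 2 * Real.exp (-α + -θ (J s)) := by rw [Real.exp_add]; ring
    _ ≤ Real.log 2 * Real.exp (-θ (J s')) := by
        refine mul_le_mul_of_nonneg_left (Real.exp_le_exp.mpr ?_) hl2.le
        linarith [hθ (J s') (J s)]
    _ < _ := mul_lt_mul_of_pos_right hs' (Real.exp_pos _)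

/-- All slots with early clocks are ranked before a slot with a late clock. -/
theorem card_early_le_position {θ : Fin d₂ → ℝ} {α : ℝ} (hθ : ∀ j j', θ j - θ j' ≤ α)
    (J : Fin k → Fin d₂) {E : Fin k → ℝ} {s' : Fin k} (hs' : Real.log 2 < E s') :
    (Finset.univ.filter fun s => E s ∈ Iic (Real.exp (-α) * Real.log 2)).card ≤
      ((clockRank (fun s => θ (J s)) E).symm s' : ℕ) := by
  set σ := clockRank (fun s => θ (J s)) E
  have hmono : Monotone ((fun s => E s * Real.exp (-θ (J s))) ∘ σ) := Tuple.monotone_sort _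
  have h : (Finset.univ.filter fun s => E s ∈ Iic (Real.exp (-α) * Real.log 2)).card ≤
      (Finset.Iio (σ.symm s')).card := by
    refine Finset.card_le_card_of_injOn σ.symm (fun s hs => ?_) σ.symm.injective.injOn
    have hs : E s ≤ Real.exp (-α) * Real.log 2 := by simpa using hs
    simp only [Finset.coe_Iio, mem_Iio]
    by_contra hle
    have := hmono (not_lt.mp hle)
    simp only [Function.comp_apply, Equiv.apply_symm_apply] at this
    exact absurd (early_clock_lt_late_clock hθ J hs hs') (not_lt.mpr this)
  simpa using h

/-- At a position `ℓ` below the number of early clocks no late slot has been ranked yet. Grouping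
late slots in pairs removes the unknown centre through `(x - c) ^ 2 + (y - c) ^ 2 ≥ (x - y) ^ 2 /
2`. -/
theorem half_sum_sq_sub_le {θ : Fin d₂ → ℝ} {α : ℝ} (hθ : ∀ j j', θ j - θ j' ≤ α)
    (J : Fin k → Fin d₂) {E : Fin k → ℝ} {e : Fin m ⊕ Fin m → Fin k}
    (he : Function.Injective e) (hlate : ∀ z, Real.log 2 < E (e z)) {ℓ : Fin k}
    (hℓ : (ℓ : ℕ) < (Finset.univ.filter fun s =>
      E s ∈ Iic (Real.exp (-α) * Real.log 2)).card) (x : Fin d₂ → ℝ) (c : ℝ) :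
    1 / 2 * ∑ l, (x (J (e (Sum.inl l))) - x (J (e (Sum.inr l)))) ^ 2 ≤
      ∑ p ∈ Finset.Ici ℓ, (x (J (clockRank (fun s => θ (J s)) E p)) - c) ^ 2 := by
  set σ := clockRank (fun s => θ (J s)) E with hσ
  have h1 : ∑ z, (x (J (e z)) - c) ^ 2 ≤
      ∑ p ∈ Finset.Ici ℓ, (x (J (σ p)) - c) ^ 2 := by
    let f : Fin m ⊕ Fin m ↪ Fin k := ⟨fun z => σ.symm (e z), σ.symm.injective.comp he⟩
    have hf : ∑ z, (x (J (e z)) - c) ^ 2 = ∑ p ∈ Finset.univ.map f, (x (J (σ p)) - c) ^ 2 := by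
      simp [f]
    rw [hf]
    refine Finset.sum_le_sum_of_subset_of_nonneg (fun p hp => ?_) fun _ _ _ => sq_nonneg _
    obtain ⟨z, -, rfl⟩ := Finset.mem_map.mp hp
    rw [Finset.mem_Ici, Fin.le_def]
    exact hℓ.le.trans (card_early_le_position hθ J (hlate z))
  refine le_trans ?_ h1
  rw [Fintype.sum_sum_type, ← Finset.sum_add_distrib, Finset.mul_sum]
  refine Finset.sum_le_sum fun l _ => ?_
  nlinarith [sq_nonneg (x (J (e (Sum.inl l))) - c + (x (J (e (Sum.inr l))) - c))]

/-- A lower bound for the curvature of the likelihood along `D`, as it enters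
`negLogLik_sub_ge`. -/
def IsCurvatureBound (v : Fin d₁ → Fin k → Fin d₂) (D : Matrix (Fin d₁) (Fin d₂) ℝ)
    (K : Fin d₁ → Fin k → ℝ) : Prop :=
  (∀ i ℓ, 0 ≤ K i ℓ) ∧ ∀ i ℓ c, K i ℓ ≤ ∑ p ∈ Finset.Ici ℓ, (D i (v i p) - c) ^ 2

/-- The quantifier order is the point: the paired slots depend on the clocks alone, so the items
they hold remain i.i.d. and uniform. Balanced clocks leave `2 / 5 * k ≥ 2 * m` late slots. -/
theorem exists_selectedPairs_curvature {Θ : Matrix (Fin d₁) (Fin d₂) ℝ} {α : ℝ}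
    (hΘ : ∀ i j j', Θ i j - Θ i j' ≤ α) (hm : 5 * m ≤ k) {E : Fin d₁ → Fin k → ℝ}
    (hE : E ∈ balancedClocks d₁ k α) :
    ∃ e : Fin d₁ → Fin m ⊕ Fin m → Fin k, (∀ i, Function.Injective (e i)) ∧
      ∀ (J : Fin d₁ → Fin k → Fin d₂) (D : Matrix (Fin d₁) (Fin d₂) ℝ),
        ∃ K, IsCurvatureBound (rankedItems (clockSample Θ J E)) D K ∧
          1 / 5 * Real.exp (-α) * k * pairSum D (selectedPairs e J) ≤ ∑ i, ∑ ℓ, K i ℓ := by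
  have hex : ∀ i, ∃ e : Fin m ⊕ Fin m → Fin k, Function.Injective e ∧
      ∀ z, Real.log 2 < E i (e z) := by
    intro i
    have hcard : Fintype.card (Fin m ⊕ Fin m) ≤
        (Finset.univ.filter fun s => E i s ∈ Ioi (Real.log 2)).card := by
      have h := (hE i).2
      have hmR : (5 * m : ℝ) ≤ k := by exact_mod_cast hm
      rw [Fintype.card_sum, Fintype.card_fin]
      have : ((m + m : ℕ) : ℝ) ≤
          ((Finset.univ.filter fun s => E i s ∈ Ioi (Real.log 2)).card : ℝ) := by
        push_cast
        linarith
      exact_mod_cast this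
    rw [← Fintype.card_coe] at hcard
    obtain ⟨f⟩ := Function.Embedding.nonempty_of_card_le hcard
    refine ⟨fun z => (f z : Fin k), Subtype.val_injective.comp f.injective, fun z => ?_⟩
    have := (f z).2
    simpa using this
  choose e he hlate using hex
  refine ⟨e, he, fun J D => ?_⟩
  set N : Fin d₁ → ℕ := fun i =>
    (Finset.univ.filter fun s => E i s ∈ Iic (Real.exp (-α) * Real.log 2)).card with hN
  set H : Fin d₁ → ℝ := fun i =>
    1 / 2 * ∑ l, (D i (J i (e i (Sum.inl l))) - D i (J i (e i (Sum.inr l)))) ^ 2 with hH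
  have hH0 : ∀ i, 0 ≤ H i := fun i =>
    mul_nonneg (by norm_num) (Finset.sum_nonneg fun _ _ => sq_nonneg _)
  -- The same bound `H i` serves at each of the first `N i` positions, and zero afterwards.
  refine ⟨fun i ℓ => if (ℓ : ℕ) < N i then H i else 0, ⟨fun i ℓ => ?_, fun i ℓ c => ?_⟩, ?_⟩
  · dsimp only
    split_ifs
    exacts [hH0 i, le_rfl]
  · dsimp only
    split_ifs with h
    · exact half_sum_sq_sub_le (hΘ i) (J i) (he i) (hlate i) h (D i) c
    · exact Finset.sum_nonneg fun _ _ => sq_nonneg _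
  · have hNk : ∀ i, N i ≤ k := fun i => (Finset.card_le_univ _).trans_eq (Fintype.card_fin k)
    have hsum : ∀ i, ∑ ℓ : Fin k, (if (ℓ : ℕ) < N i then H i else 0) = N i * H i := by
      intro i
      rw [Finset.sum_ite, Finset.sum_const_zero, add_zero, Finset.sum_const, nsmul_eq_mul]
      congr 2
      rw [Fin.card_filter_val_lt, min_eq_right (hNk i)]
    simp only [hsum]
    have hps : pairSum D (selectedPairs e J) = ∑ i, 2 * H i := by
      rw [pairSum, Fintype.sum_prod_type]
      refine Finset.sum_congr rfl fun i _ => ?_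
      simp only [hH, selectedPairs]
      ring
    rw [hps, Finset.mul_sum]
    refine Finset.sum_le_sum fun i _ => ?_
    have h := mul_le_mul_of_nonneg_right (hE i).1 (hH0 i)
    calc _ = 2 / 5 * Real.exp (-α) * k * H i := by ring
      _ ≤ _ := h

/-- With high probability, the curvature of the likelihood is bounded below uniformly over the
directions in the cone. -/
theorem sampleLaw_curvature_lt_le [NeZero d₂] {Θ : Matrix (Fin d₁) (Fin d₂) ℝ} {α B M δ : ℝ}
    (hα : 0 ≤ α) (hΘ : ∀ i j j', Θ i j - Θ i j' ≤ α) (hm : 5 * m ≤ k) (hδ : 0 ≤ δ)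
    (h : prodP (pairWeight (Fin d₁ × Fin m) d₂)
      {ω | ∃ D ∈ coneSet d₁ d₂ α B, pairSum D ω < 3 / 4 * (M * frobNorm D ^ 2)} ≤ δ) :
    (sampleLaw k Θ).real {ω | ∃ D ∈ coneSet d₁ d₂ α B, ∀ K,
      IsCurvatureBound (rankedItems ω) D K → ∑ i, ∑ ℓ, K i ℓ <
        1 / 5 * Real.exp (-α) * k * (3 / 4 * (M * frobNorm D ^ 2))} ≤
      2 * d₁ * Real.exp (-(Real.exp (-α) * k / 100)) + δ := by
  -- The event quantifies over all curvature bounds because the one constructed depends on the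
  -- clocks, which the outcome does not reveal.
  refine sampleLaw_le_of_clocks Θ _ (balancedClocks d₁ k α) hδ (by positivity)
    (pi_clockLaw_balancedClocks_compl_le d₁ k hα) fun E hE => ?_
  obtain ⟨e, he, hK⟩ := exists_selectedPairs_curvature hΘ hm hE
  rw [← pi_itemLaw_selectedPairs he] at h
  refine le_trans (measureReal_mono fun J hJ => ?_) h
  obtain ⟨D, hD, hlt⟩ := hJ
  obtain ⟨K, hK1, hK2⟩ := hK J D
  refine ⟨D, hD, ?_⟩
  by_contra hge
  refine absurd (hlt K hK1) (not_lt.mpr (le_trans ?_ hK2))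
  exact mul_le_mul_of_nonneg_left (not_lt.mp hge) (by positivity)

end Curvature

end MNLRanking

namespace MNLRanking

/-! ### The deterministic error bound. -/

section Deterministic

variable {d₁ d₂ k : ℕ}

theorem sum_mul_le_of_inner_sq_le (G D : Matrix (Fin d₁) (Fin d₂) ℝ) {s : ℝ} (hs : 0 ≤ s)
    (hG : ∀ v : EuclideanSpace ℝ (Fin d₂),
      ∑ i, inner ℝ v (WithLp.toLp 2 (G i)) ^ 2 ≤ s ^ 2 * ‖v‖ ^ 2) :
    ∑ i, ∑ j, G i j * D i j ≤ s * nuclearNorm D := by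
  refine sum_mul_le_mul_nuclearNorm G D hs fun v => ?_
  have h := hG (WithLp.toLp 2 v)
  rw [EuclideanSpace.norm_sq_eq] at h
  simpa [PiLp.inner_apply] using h

set_option maxHeartbeats 800000 in
/-- The error bound on the event that the gradient is small and the curvature is large. -/
theorem frobNorm_sq_le_of_gradient_of_curvature [NeZero d₁] [NeZero d₂] (hk : 0 < k)
    {Θs : Matrix (Fin d₁) (Fin d₂) ℝ} (hrow : ∀ i, ∑ j, Θs i j = 0) {α l₀ c₀ lam s M : ℝ}
    (hα : α = dynamicRange Θs) (hl₀ : 0 < l₀) (hc₀ : 0 < c₀) (hlam : 32 * l₀ ≤ lam)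
    (hlam' : lam ≤ c₀ * l₀) (hs : 0 ≤ s) (hsl : s ≤ 16 * l₀ * (k * d₁))
    (hM : k ≤ 3 * (M * d₂)) {v : Fin d₁ → Fin k → Fin d₂}
    (hgrad : ∀ x : EuclideanSpace ℝ (Fin d₂),
      ∑ i, inner ℝ x (WithLp.toLp 2 (score (Θs i) (v i))) ^ 2 ≤ s ^ 2 * ‖x‖ ^ 2)
    (hcurv : ∀ D ∈ coneSet d₁ d₂ α (72 * Real.exp (4 * α) * c₀ * l₀ * (d₁ * d₂)), ∃ K,
      IsCurvatureBound v D K ∧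
        1 / 5 * Real.exp (-α) * k * (3 / 4 * (M * frobNorm D ^ 2)) ≤ ∑ i, ∑ ℓ, K i ℓ)
    {Θh : Matrix (Fin d₁) (Fin d₂) ℝ} (hΘh : Θh ∈ estimators α lam v) (r : ℕ) :
    1 / ((d₁ : ℝ) * d₂) * frobNorm (Θh - Θs) ^ 2 ≤
      288 * Real.sqrt 2 * Real.exp (4 * α) * c₀ * l₀ * Real.sqrt r * frobNorm (Θh - Θs) +
        288 * Real.exp (4 * α) * c₀ * l₀ * ∑ j ∈ Finset.Ico r (min d₁ d₂), singVal Θs j := by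
  have hα0 : 0 ≤ α := hα ▸ dynamicRange_nonneg Θs
  have hkR : (0 : ℝ) < k := by exact_mod_cast hk
  have ha : (0 : ℝ) < d₁ := by exact_mod_cast Nat.pos_of_ne_zero (NeZero.ne d₁)
  have hb : (0 : ℝ) < d₂ := by exact_mod_cast Nat.pos_of_ne_zero (NeZero.ne d₂)
  have hlam0 : 0 < lam := lt_of_lt_of_le (by positivity) hlam
  -- Failure of the bound is what places `D` in the cone.
  by_contra hfail
  rw [not_le] at hfail
  set D := Θh - Θs with hD
  have hΘhD : Θs + D = Θh := by rw [hD]; abel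
  set F := frobNorm D
  set n := nuclearNorm D
  set T := ∑ j ∈ Finset.Ico r (min d₁ d₂), singVal Θs j with hT
  have hT0 : 0 ≤ T := Finset.sum_nonneg fun j _ => LinearMap.singularValues_nonneg _ _
  have hF0 : 0 ≤ F := frobNorm_nonneg D
  have hn0 : 0 ≤ n := nuclearNorm_nonneg D
  have hF : 0 < F := by
    rcases hF0.eq_or_lt with h | h
    · rw [← h] at hfail
      have : 0 ≤ 288 * Real.exp (4 * α) * c₀ * l₀ * T := by positivity
      norm_num at hfail
      linarith
    · exact h
  have hΘs : Θs ∈ constraintSet d₁ d₂ α := by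
    rw [hα]
    exact mem_constraintSet_dynamicRange hrow
  obtain ⟨hΘhmem, hmin⟩ := hΘh
  have hbasic : negLogLik v Θh + lam * nuclearNorm Θh ≤ negLogLik v Θs + lam * nuclearNorm Θs :=
    hmin hΘs
  have h1 : ∀ i j j', Θs i j' - Θs i j ≤ 2 * α := fun i j j' => by
    have := (le_abs_self _).trans (abs_sub_le_dynamicRange Θs i j' j)
    rw [← hα] at this
    linarith
  -- The estimator only has entries bounded by `α`, so its rows may spread by `2 * α`; this fixes `β
  -- = 2 * α` in the strong convexity bound.
  have h2 : ∀ i j j', (Θs + D) i j' - (Θs + D) i j ≤ 2 * α := fun i j j' => by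
    rw [hΘhD]
    have e1 := abs_le.mp (hΘhmem.1 i j)
    have e2 := abs_le.mp (hΘhmem.1 i j')
    linarith [e1.1, e2.2]
  have hgD := sum_mul_le_of_inner_sq_le (fun i => score (Θs i) (v i)) D hs hgrad
  have hkd : 0 < (k : ℝ) * d₁ := by positivity
  have hlower : ∀ K, IsCurvatureBound v D K →
      1 / ((k : ℝ) * d₁) * (Real.exp (-(2 * α)) / (2 * k) * ∑ i, ∑ ℓ, K i ℓ) - 16 * l₀ * n ≤
        negLogLik v Θh - negLogLik v Θs := by
    intro K hK
    have h := negLogLik_sub_ge v Θs D K h1 h2 hK.1 hK.2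
    rw [hΘhD] at h
    refine le_trans ?_ h
    rw [mul_sub]
    have : 1 / ((k : ℝ) * d₁) * ∑ i, ∑ j, score (Θs i) (v i) j * D i j ≤ 16 * l₀ * n := by
      rw [one_div, inv_mul_le_iff₀ hkd]
      calc _ ≤ s * n := hgD
        _ ≤ 16 * l₀ * (k * d₁) * n := mul_le_mul_of_nonneg_right hsl hn0
        _ = _ := by ring
    linarith
  have hnuc : nuclearNorm (Θs + D) - nuclearNorm Θs ≤ n / 2 := by
    -- Zero curvature, that is plain convexity, is enough here; `16 * l₀ ≤ lam / 2` then gives the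
    -- cone inequality.
    have h := hlower (fun _ _ => 0) ⟨fun _ _ => le_rfl, fun _ _ _ =>
      Finset.sum_nonneg fun _ _ => sq_nonneg _⟩
    simp only [Finset.sum_const_zero, mul_zero, zero_sub] at h
    rw [hΘhD]
    have h3 : lam * (nuclearNorm Θh - nuclearNorm Θs) ≤ lam * (n / 2) := by
      nlinarith
    exact le_of_mul_le_mul_left h3 hlam0
  have hcone := nuclearNorm_le_of_nuclearNorm_add_le Θs D r hnuc
  -- The constant is `288 / 4`, with `4` from the cone inequality.
  have hBn : 72 * Real.exp (4 * α) * c₀ * l₀ * (d₁ * d₂) * n < F ^ 2 := by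
    rw [one_div, inv_mul_eq_div, lt_div_iff₀ (by positivity)] at hfail
    refine lt_of_le_of_lt ?_ hfail
    calc _ ≤ 72 * Real.exp (4 * α) * c₀ * l₀ * (d₁ * d₂) *
          (4 * (√2 * √r * F) + 4 * T) := mul_le_mul_of_nonneg_left hcone (by positivity)
      _ = _ := by ring
  have hDmem : D ∈ coneSet d₁ d₂ α (72 * Real.exp (4 * α) * c₀ * l₀ * (d₁ * d₂)) := by
    refine ⟨fun i j => ?_, fun i => ?_, hF, hBn.le⟩
    · rw [hD, Matrix.sub_apply]
      have := abs_sub (Θh i j) (Θs i j)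
      linarith [hΘhmem.1 i j, hΘs.1 i j]
    · simp [hD, Finset.sum_sub_distrib, hΘhmem.2 i, hrow i]
  obtain ⟨K, hK, hKF⟩ := hcurv D hDmem
  have hup : negLogLik v Θh - negLogLik v Θs ≤ lam * n := by
    have h3 : nuclearNorm Θs ≤ nuclearNorm Θh + n := by
      have := nuclearNorm_add_le Θh (-D)
      have h4 := nuclearNorm_neg_le D
      rw [show Θh + -D = Θs by rw [hD]; abel] at this
      linarith
    nlinarith
  have hquad := (hlower K hK).trans hup
  have hlow : Real.exp (-(3 * α)) / (40 * (d₁ * d₂)) * F ^ 2 ≤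
      1 / ((k : ℝ) * d₁) * (Real.exp (-(2 * α)) / (2 * k) * ∑ i, ∑ ℓ, K i ℓ) := by
    calc Real.exp (-(3 * α)) / (40 * (d₁ * d₂)) * F ^ 2
        = Real.exp (-(3 * α)) * F ^ 2 / (40 * d₁ * d₂ * k) * k := by field_simp
      _ ≤ Real.exp (-(3 * α)) * F ^ 2 / (40 * d₁ * d₂ * k) * (3 * (M * d₂)) :=
          mul_le_mul_of_nonneg_left hM (by positivity)
      _ = 1 / ((k : ℝ) * d₁) * (Real.exp (-(2 * α)) / (2 * k) *
            (1 / 5 * Real.exp (-α) * k * (3 / 4 * (M * F ^ 2)))) := by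
          rw [show -(3 * α) = -(2 * α) + -α by ring, Real.exp_add]
          field_simp
          ring
      _ ≤ _ := by gcongr
  have h7 : 0 ≤ c₀ * l₀ * n := mul_nonneg (mul_nonneg hc₀.le hl₀.le) hn0
  -- `9 / 5 = 72 / 40`. The upper bound for the same quantity is `(lam + 16 * l₀) * n ≤ 3 / 2 * (c₀
  -- * l₀ * n)`, a contradiction.
  have hfin : 9 / 5 * (c₀ * l₀ * n) < Real.exp (-(3 * α)) / (40 * (d₁ * d₂)) * F ^ 2 := by
    have he : 1 ≤ Real.exp α := Real.one_le_exp hα0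
    have hee : Real.exp (-(3 * α)) * Real.exp (4 * α) = Real.exp α := by
      rw [← Real.exp_add]
      congr 1
      ring
    have hpos : 0 < Real.exp (-(3 * α)) / (40 * ((d₁ : ℝ) * d₂)) := by positivity
    have hmul := mul_lt_mul_of_pos_left hBn hpos
    refine lt_of_le_of_lt ?_ hmul
    calc 9 / 5 * (c₀ * l₀ * n) ≤ 9 / 5 * (c₀ * l₀ * n) * Real.exp α :=
          le_mul_of_one_le_right (mul_nonneg (by norm_num) h7) he
      _ = _ := by
          rw [← hee]
          field_simp
          ring
  have h5 : lam * n ≤ c₀ * l₀ * n := mul_le_mul_of_nonneg_right hlam' hn0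
  have h6 : 16 * l₀ * n ≤ 1 / 2 * (c₀ * l₀ * n) := by
    have := mul_le_mul_of_nonneg_right (hlam.trans hlam') hn0
    linarith
  linarith

end Deterministic

end MNLRanking

namespace MNLRanking

/-! ### Numerical estimates, with `x = exp α`, `a = d₁`, `b = d₂`. -/

section Numerics

/-- The noise level of the problem, in terms of real dimensions and of the logarithm `L`. -/
noncomputable def noiseLevel (a b L : ℝ) : ℝ := a * L + b * L ^ 2

theorem sq_two_mul_le_exp_sq {α : ℝ} (hα : 0 ≤ α) : 2 * α ^ 2 ≤ Real.exp α ^ 2 := by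
  rw [← Real.exp_nat_mul]
  have h := Real.quadratic_le_exp_of_nonneg (x := ((2 : ℕ) : ℝ) * α) (by positivity)
  push_cast at h ⊢
  nlinarith

theorem six_mul_le_exp_pow (α : ℝ) : 6 * α ≤ Real.exp α ^ 6 := by
  rw [← Real.exp_nat_mul]
  have h := Real.add_one_le_exp (((6 : ℕ) : ℝ) * α)
  push_cast at h ⊢
  linarith

theorem noiseLevel_lt_of_lt {a b k L α x : ℝ} (hx : 1 ≤ x) (hαx : 2 * α ^ 2 ≤ x ^ 2)
    (ha : 0 ≤ a) (hk : 0 ≤ k)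
    (h : 169869312 * x ^ 12 * noiseLevel a b L < 4 * α ^ 2 * (k * a)) :
    84934656 * x ^ 10 * noiseLevel a b L < k * a := by
  have hx2 : 0 < x ^ 2 := by positivity
  have h1 : 4 * α ^ 2 * (k * a) ≤ 2 * x ^ 2 * (k * a) :=
    mul_le_mul_of_nonneg_right (by linarith) (by positivity)
  have h2 : x ^ 2 * (2 * (84934656 * x ^ 10 * noiseLevel a b L)) < x ^ 2 * (2 * (k * a)) := by
    calc _ = 169869312 * x ^ 12 * noiseLevel a b L := by ring
      _ < _ := h
      _ ≤ _ := h1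
      _ = _ := by ring
  linarith [lt_of_mul_lt_mul_left h2 hx2.le]

theorem mul_log_lt_of_noiseLevel_lt {a b k L x : ℝ} (hx : 1 ≤ x) (ha : 0 < a) (hb : 0 ≤ b)
    (h : 84934656 * x ^ 10 * noiseLevel a b L < k * a) :
    84934656 * x ^ 10 * L < k := by
  refine lt_of_mul_lt_mul_right (lt_of_le_of_lt ?_ h) ha.le
  rw [mul_assoc]
  refine mul_le_mul_of_nonneg_left ?_ (by positivity)
  rw [noiseLevel]
  nlinarith [mul_nonneg hb (sq_nonneg L)]

/-- The number `84934656` is `9216 ^ 2`. Combined with `k ≤ d₁ ^ 2 * log d`, a large sample forces a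
large dimension, which makes all later numerical conditions on `d` harmless. -/
theorem dim_ge_of_lt {a k L x : ℝ} (hx : 1 ≤ x) (ha : 0 ≤ a) (hL : 0 < L)
    (hk : k ≤ a ^ 2 * L) (h : 84934656 * x ^ 10 * L < k) : 9216 ≤ a := by
  have hx10 : 1 ≤ x ^ 10 := one_le_pow₀ hx
  have h1 : 9216 ^ 2 * L ≤ a ^ 2 * L := by nlinarith
  exact (sq_le_sq₀ (by norm_num) ha).mp (le_of_mul_le_mul_right h1 hL)

theorem five_mul_le_exp_neg_mul {k L α : ℝ} (hα : 0 ≤ α) (hL : 0 ≤ L)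
    (h : 84934656 * Real.exp α ^ 10 * L ≤ k) : 5 * L ≤ Real.exp (-α) * k / 100 := by
  have hx : 1 ≤ Real.exp α := Real.one_le_exp hα
  have h1 : Real.exp α * (500 * L) ≤ k := by
    refine le_trans ?_ h
    calc Real.exp α * (500 * L) ≤ Real.exp α ^ 10 * (84934656 * L) := by
          gcongr
          · exact le_self_pow₀ hx (by norm_num)
          · norm_num
      _ = _ := by ring
  rw [Real.exp_neg, inv_mul_eq_div, le_div_iff₀ (by norm_num), le_div_iff₀ (Real.exp_pos α)]
  linarith

theorem eight_le_log {d : ℝ} (hd : 4608 ≤ d) : 8 ≤ Real.log d := by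
  rw [Real.le_log_iff_exp_le (by linarith)]
  have h := Real.exp_one_lt_d9
  calc Real.exp 8 = Real.exp 1 ^ 8 := by rw [← Real.exp_nat_mul]; norm_num
    _ ≤ 2.7182818286 ^ 8 := pow_le_pow_left₀ (Real.exp_pos _).le h.le 8
    _ ≤ d := le_trans (by norm_num) hd

/-- The condition `16 * α * u ≤ M * B / 8` of the cone bound, for `u = 16 k d₁ S` and the cone
constant `B`. -/
theorem radius_le {a b k x α c₀ S M : ℝ} (ha : 0 ≤ a) (hk : 0 ≤ k) (hS : 0 ≤ S)
    (hx : 0 ≤ x) (hαx : 6 * α ≤ x ^ 6) (hc₀ : 32 < c₀) (hM : k ≤ 3 * (M * b)) :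
    16 * α * (16 * (k * a) * S) ≤
      M * (72 * x ^ 4 * c₀ * (x ^ 2 * S) * (a * b)) / 8 := by
  have hkaS : 0 ≤ k * a * S := by positivity
  calc 16 * α * (16 * (k * a) * S) = 256 * α * (k * a * S) := by ring
    _ ≤ 3 * 32 * x ^ 6 * (k * a * S) := mul_le_mul_of_nonneg_right (by linarith [pow_nonneg hx 6]) hkaS
    _ ≤ 3 * c₀ * x ^ 6 * (k * a * S) := by gcongr
    _ = 3 * c₀ * x ^ 6 * a * S * k := by ring
    _ ≤ 3 * c₀ * x ^ 6 * a * S * (3 * (M * b)) :=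
        mul_le_mul_of_nonneg_left hM (by positivity)
    _ = _ := by ring

theorem noiseLevel_le_mul_sq {a b k x c₀ S M P : ℝ} (hb : 0 ≤ b) (hP : 0 ≤ P)
    (hSP : S ^ 2 * (k * a ^ 2 * b) = P)
    (hc₀ : 32 < c₀) (hM : k ≤ 3 * (M * b)) :
    1769472 * x ^ 12 * P ≤ M * (72 * x ^ 4 * c₀ * (x ^ 2 * S) * (a * b)) ^ 2 := by
  have hc : 32 ^ 2 ≤ c₀ ^ 2 := pow_le_pow_left₀ (by norm_num) hc₀.le 2
  calc 1769472 * x ^ 12 * P = 1728 * 32 ^ 2 * x ^ 12 * P := by ring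
    _ ≤ 1728 * c₀ ^ 2 * x ^ 12 * P := by gcongr
    _ = 1728 * c₀ ^ 2 * x ^ 12 * S ^ 2 * a ^ 2 * b * k := by rw [← hSP]; ring
    _ ≤ 1728 * c₀ ^ 2 * x ^ 12 * S ^ 2 * a ^ 2 * b * (3 * (M * b)) :=
        mul_le_mul_of_nonneg_left hM (by positivity)
    _ = _ := by ring

theorem sq_add_sq_le_noiseLevel_sq {a b L : ℝ} (ha : 0 ≤ a) (hb : 0 ≤ b) (hL : 1 ≤ L) :
    L ^ 2 * (a ^ 2 + b ^ 2) ≤ noiseLevel a b L ^ 2 := by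
  have h : L * (a + b) ≤ noiseLevel a b L := by
    rw [noiseLevel]
    nlinarith [mul_nonneg hb (mul_nonneg (by linarith : 0 ≤ L) (by linarith : 0 ≤ L - 1))]
  have h2 : (L * (a + b)) ^ 2 ≤ noiseLevel a b L ^ 2 := pow_le_pow_left₀ (by positivity) h 2
  nlinarith [mul_nonneg (sq_nonneg L) (mul_nonneg ha hb)]

/-- With `Y = M * B ^ 2`: the exceptional event has probability of order `d ^ (-4)`, while the
trivial bound on it is of order `x ^ 2 * d ^ 2 * L` because `k` is limited. -/
theorem tail_mean_le {a b k L α x d ε m Y : ℝ} (ha : 1 ≤ a) (hb : 0 ≤ b) (hk : 0 ≤ k)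
    (hL : 1 ≤ L) (hx : 1 ≤ x)
    (hαx : 2 * α ^ 2 ≤ x ^ 2) (hd : d = (a + b) / 2) (hd5 : 5 ≤ d) (hε0 : 0 ≤ ε)
    (hε : ε ≤ 6 / d ^ 4) (hak : a * k ≤ (a ^ 2 + b ^ 2) / 2 * L) (hm : 5 * m ≤ k)
    (hY : 1769472 * x ^ 12 * noiseLevel a b L ≤ Y) :
    ε * (64 * α ^ 2 * (a * m) + Y / 8) ≤ Y / 16 := by
  have hd4 : 625 ≤ d ^ 4 := le_trans (by norm_num) (pow_le_pow_left₀ (by norm_num) hd5 4)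
  have hε4 : ε ≤ 1 / 4 := hε.trans (by rw [div_le_iff₀ (by positivity)]; linarith)
  have hP : L ≤ noiseLevel a b L := by
    rw [noiseLevel]
    nlinarith [mul_nonneg hb (sq_nonneg L)]
  have hx12 : x ^ 2 ≤ x ^ 12 := pow_le_pow_right₀ hx (by norm_num)
  have hY2 : 1769472 * (x ^ 2 * L) ≤ Y := by
    refine le_trans ?_ hY
    rw [mul_assoc]
    gcongr
  have hak' : a * k ≤ 2 * d ^ 2 * L := by
    refine hak.trans (mul_le_mul_of_nonneg_right ?_ (by linarith))
    rw [hd]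
    nlinarith
  have h1 : ε * (64 * α ^ 2 * (a * m)) ≤ 77 * (x ^ 2 * L) := by
    calc ε * (64 * α ^ 2 * (a * m)) = ε * (64 / 5 * α ^ 2 * a * (5 * m)) := by ring
      _ ≤ ε * (64 / 5 * α ^ 2 * a * k) := by gcongr
      _ = ε * (32 / 5 * (2 * α ^ 2) * (a * k)) := by ring
      _ ≤ 6 / d ^ 4 * (32 / 5 * x ^ 2 * (2 * d ^ 2 * L)) := by gcongr
      _ = 384 / 5 * (x ^ 2 * L) * (1 / d ^ 2) := by
          field_simp
          ring
      _ ≤ 384 / 5 * (x ^ 2 * L) * 1 := by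
          gcongr
          rw [div_le_one (by positivity)]
          nlinarith
      _ ≤ _ := by nlinarith [mul_nonneg (sq_nonneg x) (by linarith : 0 ≤ L)]
  have hxL : 0 ≤ x ^ 2 * L := by positivity
  have h2 : ε * (Y / 8) ≤ 1 / 4 * (Y / 8) := mul_le_mul_of_nonneg_right hε4 (by linarith)
  rw [mul_add]
  linarith

/-- The bounded difference exponent is at least `4 * L` because `d₁ k ≤ (d₁ ^ 2 + d₂ ^ 2) / 2 * L`
and the noise level is at least `L (d₁ + d₂)`. -/
theorem concentration_exponent_ge {a b k L α x m Y : ℝ} (ha : 0 < a) (hb : 0 ≤ b)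
    (hL : 1 ≤ L) (hx : 1 ≤ x) (hα : 0 < α) (hαx : 2 * α ^ 2 ≤ x ^ 2)
    (hak : a * k ≤ (a ^ 2 + b ^ 2) / 2 * L) (hm0 : 0 < m) (hm : 5 * m ≤ k)
    (hY : 1769472 * x ^ 12 * noiseLevel a b L ≤ Y) :
    4 * L ≤ (Y / 16) ^ 2 / (2 * (a * m) * (16 * α ^ 2) ^ 2) := by
  rw [le_div_iff₀ (by positivity)]
  have hP : 0 ≤ noiseLevel a b L := by
    rw [noiseLevel]
    positivity
  have hα4 : 4 * α ^ 4 ≤ x ^ 4 := by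
    have := pow_le_pow_left₀ (by positivity) hαx 2
    nlinarith
  have hx24 : x ^ 4 ≤ x ^ 24 := pow_le_pow_right₀ hx (by norm_num)
  have hYsq : (1769472 * x ^ 12 * noiseLevel a b L) ^ 2 ≤ Y ^ 2 :=
    pow_le_pow_left₀ (by positivity) hY 2
  have hsq := sq_add_sq_le_noiseLevel_sq ha.le hb hL
  have h0 : 0 ≤ x ^ 24 * noiseLevel a b L ^ 2 := by positivity
  have hk : 0 ≤ k := by linarith
  calc 4 * L * (2 * (a * m) * (16 * α ^ 2) ^ 2)
      = 512 / 5 * L * (a * (5 * m)) * (4 * α ^ 4) := by ring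
    _ ≤ 512 / 5 * L * (a * k) * x ^ 4 := by gcongr
    _ ≤ 512 / 5 * L * ((a ^ 2 + b ^ 2) / 2 * L) * x ^ 24 := by gcongr
    _ = 256 / 5 * x ^ 24 * (L ^ 2 * (a ^ 2 + b ^ 2)) := by ring
    _ ≤ 256 / 5 * x ^ 24 * noiseLevel a b L ^ 2 := by gcongr
    _ ≤ (1769472 * x ^ 12 * noiseLevel a b L) ^ 2 / 16 ^ 2 := by nlinarith
    _ ≤ Y ^ 2 / 16 ^ 2 := by gcongr
    _ = _ := by ring

/-- Gradient, clocks and concentration contribute `6`, `4` and `1` times `d ^ (-4)`. -/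
theorem sum_tails_le {a b L d y : ℝ} (hb : 0 ≤ b) (hd : d = (a + b) / 2)
    (hdL : Real.exp L = d) (hd6 : 6 ≤ d) (hy : 5 * L ≤ y) :
    3 * (a + b) * Real.exp (-(5 * L)) + (2 * a * Real.exp (-y) + Real.exp (-(4 * L))) ≤
      2 / d ^ 3 := by
  have hd0 : 0 < d := by linarith
  have e5 : Real.exp (-(5 * L)) = 1 / d ^ 5 := by
    rw [Real.exp_neg, ← hdL, ← Real.exp_nat_mul, one_div]
    norm_num
  have e4 : Real.exp (-(4 * L)) = 1 / d ^ 4 := by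
    rw [Real.exp_neg, ← hdL, ← Real.exp_nat_mul, one_div]
    norm_num
  have ey : Real.exp (-y) ≤ 1 / d ^ 5 := by
    rw [← e5]
    exact Real.exp_le_exp.mpr (by linarith)
  have h1 : 2 * a * Real.exp (-y) ≤ 4 * d * (1 / d ^ 5) := by
    calc 2 * a * Real.exp (-y) ≤ 4 * d * Real.exp (-y) :=
          mul_le_mul_of_nonneg_right (by linarith) (Real.exp_pos _).le
      _ ≤ _ := mul_le_mul_of_nonneg_left ey (by linarith)
  have h2 : 3 * (a + b) = 6 * d := by linarith
  rw [e5, e4, h2]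
  have h3 : 6 * d * (1 / d ^ 5) + (4 * d * (1 / d ^ 5) + 1 / d ^ 4) = 11 / d ^ 4 := by
    field_simp
    ring
  have h4 : 11 / d ^ 4 ≤ 2 / d ^ 3 := by
    rw [div_le_div_iff₀ (by positivity) (by positivity)]
    have : 0 ≤ d ^ 3 := by positivity
    nlinarith
  linarith

end Numerics

end MNLRanking

namespace MNLRanking

/-! ### Small samples, regular samples, and the theorem. -/

section Main

variable {d₁ d₂ k : ℕ}

theorem lambda0_eq (d₁ d₂ k : ℕ) (α : ℝ) : lambda0 d₁ d₂ k α = Real.exp α ^ 2 *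
    √(noiseLevel d₁ d₂ (Real.log (avgDim d₁ d₂)) / (k * (d₁ : ℝ) ^ 2 * d₂)) := by
  rw [lambda0, noiseLevel, ← Real.exp_nat_mul]
  norm_num

theorem sqrt_noise_sq {a b k P : ℝ} (ha : 0 < a) (hb : 0 < b) (hk : 0 < k) (hP : 0 ≤ P) :
    √(P / (k * a ^ 2 * b)) ^ 2 * (k * a ^ 2 * b) = P := by
  rw [Real.sq_sqrt (by positivity)]
  field_simp

/-- When the sample size is small, the error bound follows from the boundedness of the entries. -/
theorem frobNorm_sq_le_of_small_sample [NeZero d₁] [NeZero d₂] (hk : 0 < k)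
    {A : Matrix (Fin d₁) (Fin d₂) ℝ} {α c₀ : ℝ} (hc₀ : 32 ≤ c₀)
    (hA : ∀ i j, |A i j| ≤ 2 * α) (hL : 0 ≤ Real.log (avgDim d₁ d₂))
    (h : 4 * α ^ 2 * ((k : ℝ) * d₁) ≤
      169869312 * Real.exp α ^ 12 * noiseLevel d₁ d₂ (Real.log (avgDim d₁ d₂)))
    {r : ℕ} (hr : 1 ≤ r) :
    1 / ((d₁ : ℝ) * d₂) * frobNorm A ^ 2 ≤
      288 * √2 * Real.exp (4 * α) * c₀ * lambda0 d₁ d₂ k α * √r * frobNorm A := by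
  have hkR : (0 : ℝ) < k := by exact_mod_cast hk
  have ha : (0 : ℝ) < d₁ := by exact_mod_cast Nat.pos_of_ne_zero (NeZero.ne d₁)
  have hb : (0 : ℝ) < d₂ := by exact_mod_cast Nat.pos_of_ne_zero (NeZero.ne d₂)
  set P := noiseLevel d₁ d₂ (Real.log (avgDim d₁ d₂))
  have hP : 0 ≤ P := by
    simp only [P, noiseLevel]
    positivity
  set S := √(P / (k * (d₁ : ℝ) ^ 2 * d₂)) with hS
  have hSP : S ^ 2 * (k * (d₁ : ℝ) ^ 2 * d₂) = P := sqrt_noise_sq ha hb hkR hP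
  have hS0 : 0 ≤ S := Real.sqrt_nonneg _
  -- The coefficient of the bound at its smallest, `c₀ = 32` and `r = 1`, with `9216 = 288 * 32`; it
  -- remains to compare the Frobenius norm itself with `d₁ d₂ q`.
  set q := 9216 * √2 * Real.exp α ^ 6 * S with hq
  have hq0 : 0 ≤ q := by positivity
  have hF2 : frobNorm A ^ 2 ≤ 4 * α ^ 2 * (d₁ * d₂) := by
    rw [frobNorm_sq]
    calc ∑ i, ∑ j, A i j ^ 2 ≤ ∑ _i : Fin d₁, ∑ _j : Fin d₂, (2 * α) ^ 2 :=
          Finset.sum_le_sum fun i _ => Finset.sum_le_sum fun j _ => by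
            rw [← sq_abs]
            exact pow_le_pow_left₀ (abs_nonneg _) (hA i j) 2
      _ = _ := by
          simp only [Finset.sum_const, Finset.card_univ, Fintype.card_fin, nsmul_eq_mul]
          ring
  have hqF : frobNorm A ≤ d₁ * d₂ * q := by
    refine (sq_le_sq₀ (frobNorm_nonneg A) (by positivity)).mp (hF2.trans ?_)
    have hq2 : q ^ 2 = 169869312 * Real.exp α ^ 12 * S ^ 2 := by
      rw [hq, mul_pow, mul_pow, mul_pow, Real.sq_sqrt (by norm_num)]
      ring
    rw [mul_pow, hq2]
    refine le_of_mul_le_mul_right ?_ hkR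
    calc 4 * α ^ 2 * ((d₁ : ℝ) * d₂) * k = d₂ * (4 * α ^ 2 * (k * d₁)) := by ring
      _ ≤ d₂ * (169869312 * Real.exp α ^ 12 * P) := by gcongr
      _ = _ := by rw [← hSP]; ring
  have hqle : q ≤ 288 * √2 * Real.exp (4 * α) * c₀ * lambda0 d₁ d₂ k α * √r := by
    have hr1 : 1 ≤ √(r : ℝ) := Real.one_le_sqrt.mpr (by exact_mod_cast hr)
    have e4 : Real.exp (4 * α) = Real.exp α ^ 4 := by
      rw [← Real.exp_nat_mul]
      norm_num
    rw [lambda0_eq, ← hS, e4]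
    calc q = 288 * √2 * Real.exp α ^ 4 * 32 * (Real.exp α ^ 2 * S) * 1 := by rw [hq]; ring
      _ ≤ _ := by gcongr
  rw [one_div, inv_mul_le_iff₀ (by positivity)]
  calc frobNorm A ^ 2 = frobNorm A * frobNorm A := sq _
    _ ≤ d₁ * d₂ * q * frobNorm A := mul_le_mul_of_nonneg_right hqF (frobNorm_nonneg A)
    _ ≤ d₁ * d₂ * (288 * √2 * Real.exp (4 * α) * c₀ * lambda0 d₁ d₂ k α * √r) * frobNorm A :=
        mul_le_mul_of_nonneg_right (mul_le_mul_of_nonneg_left hqle (by positivity))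
          (frobNorm_nonneg A)
    _ = _ := by ring

theorem rowsLevel_eq (a b : ℕ) {k L : ℝ} (hb : (0 : ℝ) < b) (ha : (0 : ℝ) < a) (hk : 0 < k)
    (hP : 0 ≤ noiseLevel a b L) :
    rowsLevel a b k L = (16 * (k * a) * √(noiseLevel a b L / (k * (a : ℝ) ^ 2 * b))) ^ 2 := by
  have h := sqrt_noise_sq ha hb hk hP
  rw [mul_pow, mul_pow, rowsLevel, div_eq_iff hb.ne']
  rw [show 256 * k * ((a : ℝ) * L + b * L ^ 2) = 256 * k * noiseLevel a b L from rfl]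
  nth_rewrite 1 [← h]
  ring

set_option maxHeartbeats 800000 in
/-- With high probability, the gradient of the likelihood is small at the true parameter, and its
curvature is bounded below in the directions of the cone. -/
theorem sampleLaw_not_regular_le [NeZero d₁] [NeZero d₂] {Θ : Matrix (Fin d₁) (Fin d₂) ℝ}
    {α c₀ L M : ℝ} {m : ℕ} (hα : 0 < α) (hΘ : ∀ i j j', Θ i j - Θ i j' ≤ α)
    (hLdef : L = Real.log (avgDim d₁ d₂)) (hL : 0 < L)
    (hk : 24 ≤ k) (hk1 : (k : ℝ) ≤ (d₁ : ℝ) ^ 2 * L)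
    (hk2 : (k : ℝ) ≤ ((d₁ : ℝ) ^ 2 + (d₂ : ℝ) ^ 2) / (2 * d₁) * L) (hc₀ : 32 < c₀)
    (hreg : 169869312 * Real.exp α ^ 12 * noiseLevel d₁ d₂ L < 4 * α ^ 2 * ((k : ℝ) * d₁))
    (hm0 : 0 < m) (hm : 5 * m ≤ k) (hMdef : M = 2 * m / d₂) (hM : (k : ℝ) ≤ 3 * (M * d₂)) :
    (sampleLaw k Θ).real
      ({ω | ∃ v : EuclideanSpace ℝ (Fin d₂), rowsLevel d₁ d₂ k L * ‖v‖ ^ 2 <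
          ∑ i, inner ℝ v (WithLp.toLp 2 (score (Θ i) (rankedItems ω i))) ^ 2} ∪
        {ω | ∃ D ∈ coneSet d₁ d₂ α
            (72 * Real.exp (4 * α) * c₀ * lambda0 d₁ d₂ k α * (d₁ * d₂)), ∀ K,
          IsCurvatureBound (rankedItems ω) D K → ∑ i, ∑ ℓ, K i ℓ <
            1 / 5 * Real.exp (-α) * k * (3 / 4 * (M * frobNorm D ^ 2))}) ≤
      2 / avgDim d₁ d₂ ^ 3 := by
  have hkN : 0 < k := by omega
  have hkR : (0 : ℝ) < k := by exact_mod_cast hkN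
  have hd₁ : 0 < d₁ := Nat.pos_of_ne_zero (NeZero.ne d₁)
  have hd₂ : 0 < d₂ := Nat.pos_of_ne_zero (NeZero.ne d₂)
  have ha : (0 : ℝ) < d₁ := by exact_mod_cast hd₁
  have hb : (0 : ℝ) < d₂ := by exact_mod_cast hd₂
  have hmR : (0 : ℝ) < m := by exact_mod_cast hm0
  have hmk : 5 * (m : ℝ) ≤ k := by exact_mod_cast hm
  have hx : 1 ≤ Real.exp α := Real.one_le_exp hα.le
  have hαx := sq_two_mul_le_exp_sq hα.le
  have hx0 : 0 < Real.exp α := Real.exp_pos α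
  -- Outside the small-sample regime `k` exceeds a large multiple of `L`, and `d₁` is at least
  -- `9216`.
  have hlt := noiseLevel_lt_of_lt hx hαx ha.le hkR.le hreg
  have hltL := mul_log_lt_of_noiseLevel_lt hx ha hb.le hlt
  have ha9 := dim_ge_of_lt hx ha.le hL hk1 hltL
  set d := avgDim d₁ d₂ with hd
  have hdab : d = ((d₁ : ℝ) + d₂) / 2 := rfl
  have hd4608 : 4608 ≤ d := by linarith
  have hL8 : 8 ≤ L := hLdef ▸ eight_le_log hd4608
  have hL1 : 1 ≤ L := by linarith
  have hexpL : Real.exp L = d := by rw [hLdef, Real.exp_log (by linarith)]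
  set P := noiseLevel d₁ d₂ L with hPdef
  have hP : 0 < P := by
    simp only [hPdef, noiseLevel]
    positivity
  set S := √(P / (k * (d₁ : ℝ) ^ 2 * d₂)) with hS
  have hSP : S ^ 2 * (k * (d₁ : ℝ) ^ 2 * d₂) = P := sqrt_noise_sq ha hb hkR hP.le
  have hS0 : 0 < S := Real.sqrt_pos.mpr (by positivity)
  have hl₀ : lambda0 d₁ d₂ k α = Real.exp α ^ 2 * S := by rw [lambda0_eq, ← hd, ← hLdef]
  have e4 : Real.exp (4 * α) = Real.exp α ^ 4 := by
    rw [← Real.exp_nat_mul]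
    norm_num
  rw [e4, hl₀]
  set B := 72 * Real.exp α ^ 4 * c₀ * (Real.exp α ^ 2 * S) * (d₁ * d₂) with hB
  have hB0 : 0 < B := by positivity
  have hak : (d₁ : ℝ) * k ≤ ((d₁ : ℝ) ^ 2 + (d₂ : ℝ) ^ 2) / 2 * L := by
    calc (d₁ : ℝ) * k ≤ d₁ * (((d₁ : ℝ) ^ 2 + (d₂ : ℝ) ^ 2) / (2 * d₁) * L) :=
          mul_le_mul_of_nonneg_left hk2 ha.le
      _ = _ := by field_simp
  have hY := noiseLevel_le_mul_sq (x := Real.exp α) hb.le hP.le hSP hc₀ hM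
  rw [← hB] at hY
  set ε := 3 * ((d₁ : ℝ) + d₂) * Real.exp (-(5 * L)) with hε
  have hε6 : ε ≤ 6 / d ^ 4 := by
    have e5 : Real.exp (-(5 * L)) = 1 / d ^ 5 := by
      rw [Real.exp_neg, ← hexpL, ← Real.exp_nat_mul, one_div]
      norm_num
    rw [hε, e5, show 3 * ((d₁ : ℝ) + d₂) = 6 * d by linarith]
    refine le_of_eq ?_
    have : d ≠ 0 := by linarith
    field_simp
  have hmean := tail_mean_le (by linarith) hb.le hkR.le hL1 hx hαx hdab (by linarith)
    (by positivity) hε6 hak hmk hY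
  have hexp := concentration_exponent_ge ha hb.le hL1 hx hα hαx hak hmR hmk hY
  have hgrad := prodP_score_le (k := k) Θ (L := L) hkN hL1
  rw [← sampleLaw_real_eq_prodP] at hgrad
  have hpairs := prodP_pairRows_le (d₁ := d₁) (m := m) hd₂ hkR (by linarith) hL1
  rw [rowsLevel_eq d₁ d₂ hb ha hkR hP.le, ← hPdef, ← hS] at hpairs
  have hcone := prodP_pairSum_lt_le (B := B) (M := M) hd₁ hd₂ hm0 hα hB0 (by positivity) hMdef
    (radius_le ha.le hkR.le hS0.le hx0.le (six_mul_le_exp_pow α) hc₀ hM) hpairs hmean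
  have hcurv := sampleLaw_curvature_lt_le (k := k) hα.le hΘ hm (Real.exp_pos _).le
    (hcone.trans (Real.exp_le_exp.mpr (neg_le_neg hexp)))
  have hy := five_mul_le_exp_neg_mul hα.le hL.le hltL.le
  have hsum := sum_tails_le hb.le hdab hexpL (by linarith) hy
  exact (measureReal_union_le _ _).trans ((add_le_add hgrad hcurv).trans hsum)

end Main

end MNLRanking

theorem theorem1 (d₁ d₂ k : ℕ) [NeZero d₁] [NeZero d₂]
    (Θs : Matrix (Fin d₁) (Fin d₂) ℝ) (hrow : ∀ i, ∑ j, Θs i j = 0)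
    (α : ℝ) (hα : α = MNLRanking.dynamicRange Θs)
    (hk : 24 ≤ k)
    (hk' : (k : ℝ) ≤ min ((d₁ : ℝ) ^ 2) (((d₁ : ℝ) ^ 2 + (d₂ : ℝ) ^ 2) / (2 * d₁)) *
      Real.log (MNLRanking.avgDim d₁ d₂))
    (c₀ : ℝ) (hc₀ : 32 < c₀)
    (lam : ℝ) (hlam : lam ∈ Set.Icc (32 * MNLRanking.lambda0 d₁ d₂ k α)
      (c₀ * MNLRanking.lambda0 d₁ d₂ k α)) :
    1 - 2 / MNLRanking.avgDim d₁ d₂ ^ 3 ≤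
      (MNLRanking.sampleLaw k Θs).real
        {ω | (MNLRanking.estimators α lam (MNLRanking.rankedItems ω)).Nonempty ∧
          ∀ Θh ∈ MNLRanking.estimators α lam (MNLRanking.rankedItems ω),
            ∀ r ∈ Finset.Icc 1 (min d₁ d₂),
              1 / ((d₁ : ℝ) * d₂) * MNLRanking.frobNorm (Θh - Θs) ^ 2 ≤
                288 * Real.sqrt 2 * Real.exp (4 * α) * c₀ * MNLRanking.lambda0 d₁ d₂ k α *
                    Real.sqrt r * MNLRanking.frobNorm (Θh - Θs) +
                  288 * Real.exp (4 * α) * c₀ * MNLRanking.lambda0 d₁ d₂ k α *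
                    ∑ j ∈ Finset.Ico r (min d₁ d₂), MNLRanking.singVal Θs j} := by
  classical
  have hkN : 0 < k := by omega
  have hkR : (0 : ℝ) < k := by exact_mod_cast hkN
  have ha : (0 : ℝ) < d₁ := by exact_mod_cast Nat.pos_of_ne_zero (NeZero.ne d₁)
  have hb : (0 : ℝ) < d₂ := by exact_mod_cast Nat.pos_of_ne_zero (NeZero.ne d₂)
  have hα0 : 0 ≤ α := hα ▸ MNLRanking.dynamicRange_nonneg Θs
  have : IsProbabilityMeasure (MNLRanking.sampleLaw k Θs) := by
    unfold MNLRanking.sampleLaw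
    infer_instance
  set L := Real.log (MNLRanking.avgDim d₁ d₂) with hLdef
  have hL : 0 < L := by
    -- If `log d ≤ 0`, the upper bound on `k` would be at most zero.
    by_contra hL
    have h24 : (24 : ℝ) ≤ k := by exact_mod_cast hk
    have hmin : 0 ≤ min ((d₁ : ℝ) ^ 2) (((d₁ : ℝ) ^ 2 + (d₂ : ℝ) ^ 2) / (2 * d₁)) :=
      le_min (by positivity) (by positivity)
    linarith [mul_nonpos_of_nonneg_of_nonpos hmin (not_lt.mp hL)]
  have hk1 := hk'.trans (mul_le_mul_of_nonneg_right (min_le_left _ _) hL.le)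
  have hk2 := hk'.trans (mul_le_mul_of_nonneg_right (min_le_right _ _) hL.le)
  have hΘs : Θs ∈ MNLRanking.constraintSet d₁ d₂ α := by
    rw [hα]
    exact MNLRanking.mem_constraintSet_dynamicRange hrow
  have hdpos : 0 < MNLRanking.avgDim d₁ d₂ := by
    unfold MNLRanking.avgDim
    positivity
  -- The small-sample regime, where the bound holds for every outcome; here `169869312 = 2 * 9216 ^
  -- 2`.
  by_cases hreg : 4 * α ^ 2 * ((k : ℝ) * d₁) ≤
      169869312 * Real.exp α ^ 12 * MNLRanking.noiseLevel d₁ d₂ L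
  · have hall : {ω : Fin d₁ → MNLRanking.UserOutcome d₂ k |
        (MNLRanking.estimators α lam (MNLRanking.rankedItems ω)).Nonempty ∧
          ∀ Θh ∈ MNLRanking.estimators α lam (MNLRanking.rankedItems ω),
            ∀ r ∈ Finset.Icc 1 (min d₁ d₂),
              1 / ((d₁ : ℝ) * d₂) * MNLRanking.frobNorm (Θh - Θs) ^ 2 ≤
                288 * Real.sqrt 2 * Real.exp (4 * α) * c₀ * MNLRanking.lambda0 d₁ d₂ k α *
                    Real.sqrt r * MNLRanking.frobNorm (Θh - Θs) +
                  288 * Real.exp (4 * α) * c₀ * MNLRanking.lambda0 d₁ d₂ k α *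
                    ∑ j ∈ Finset.Ico r (min d₁ d₂), MNLRanking.singVal Θs j} = Set.univ := by
      refine Set.eq_univ_of_forall fun ω => ⟨MNLRanking.estimators_nonempty hα0 _ _,
        fun Θh hΘh r hr => ?_⟩
      have hA : ∀ i j, |(Θh - Θs) i j| ≤ 2 * α := fun i j => by
        rw [Matrix.sub_apply]
        linarith [abs_sub (Θh i j) (Θs i j), hΘh.1.1 i j, hΘs.1 i j]
      refine (MNLRanking.frobNorm_sq_le_of_small_sample hkN hc₀.le hA hL.le hreg
        (Finset.mem_Icc.mp hr).1).trans (le_add_of_nonneg_right ?_)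
      have hl : 0 ≤ MNLRanking.lambda0 d₁ d₂ k α :=
        mul_nonneg (Real.exp_pos _).le (Real.sqrt_nonneg _)
      have hT : 0 ≤ ∑ j ∈ Finset.Ico r (min d₁ d₂), MNLRanking.singVal Θs j :=
        Finset.sum_nonneg fun j _ => LinearMap.singularValues_nonneg _ _
      have hc : 0 ≤ c₀ := by linarith
      positivity
    rw [hall, probReal_univ]
    linarith [show 0 ≤ 2 / MNLRanking.avgDim d₁ d₂ ^ 3 by positivity]
  · rw [not_le] at hreg
    have hP : 0 < MNLRanking.noiseLevel d₁ d₂ L := by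
      unfold MNLRanking.noiseLevel
      positivity
    have hα1 : 0 < α := by
      rcases hα0.eq_or_lt with h | h
      · rw [← h] at hreg
        norm_num at hreg
        linarith
      · exact h
    have hrange : ∀ i j j', Θs i j - Θs i j' ≤ α := fun i j j' => by
      rw [hα]
      exact (le_abs_self _).trans (MNLRanking.abs_sub_le_dynamicRange Θs i j j')
    -- The number of pairs is `m = ⌊k / 5⌋`, and the lower bound on `k` ensures `k ≤ 6 * m`, that is
    -- `k ≤ 3 * (M * d₂)`.
    have hm0 : 0 < k / 5 := by omega
    have hM : (k : ℝ) ≤ 3 * (2 * ((k / 5 : ℕ) : ℝ) / d₂ * d₂) := by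
      rw [div_mul_cancel₀ _ hb.ne']
      have : k ≤ 3 * (2 * (k / 5)) := by omega
      exact_mod_cast this
    have hbad := MNLRanking.sampleLaw_not_regular_le hα1 hrange hLdef hL hk hk1 hk2 hc₀ hreg hm0
      (by omega : 5 * (k / 5) ≤ k) rfl hM
    set Bad := {ω : Fin d₁ → MNLRanking.UserOutcome d₂ k |
      ∃ v : EuclideanSpace ℝ (Fin d₂), MNLRanking.rowsLevel d₁ d₂ k L * ‖v‖ ^ 2 <
          ∑ i, inner ℝ v (WithLp.toLp 2
            (MNLRanking.score (Θs i) (MNLRanking.rankedItems ω i))) ^ 2} ∪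
        {ω | ∃ D ∈ MNLRanking.coneSet d₁ d₂ α (72 * Real.exp (4 * α) * c₀ *
            MNLRanking.lambda0 d₁ d₂ k α * (d₁ * d₂)), ∀ K,
          MNLRanking.IsCurvatureBound (MNLRanking.rankedItems ω) D K → ∑ i, ∑ ℓ, K i ℓ <
            1 / 5 * Real.exp (-α) * k *
              (3 / 4 * (2 * ((k / 5 : ℕ) : ℝ) / d₂ * MNLRanking.frobNorm D ^ 2))} with hBad
    have hcompl := probReal_compl_eq_one_sub (μ := MNLRanking.sampleLaw k Θs)
      Bad.toFinite.measurableSet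
    refine le_trans (by linarith) (hcompl.symm.le.trans (measureReal_mono fun ω hω => ?_))
    rw [hBad, Set.mem_compl_iff, Set.mem_union, not_or] at hω
    obtain ⟨hω1, hω2⟩ := hω
    simp only [Set.mem_ofPred_eq, not_exists, not_and, not_forall, not_lt] at hω1 hω2
    refine ⟨MNLRanking.estimators_nonempty hα0 _ _, fun Θh hΘh r _ => ?_⟩
    set S := √(MNLRanking.noiseLevel d₁ d₂ L / (k * (d₁ : ℝ) ^ 2 * d₂)) with hS
    have hS0 : 0 < S := Real.sqrt_pos.mpr (by positivity)
    have hl₀ : MNLRanking.lambda0 d₁ d₂ k α = Real.exp α ^ 2 * S := by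
      rw [MNLRanking.lambda0_eq]
    -- The gradient level `16 k d₁ S` does not need the factor `exp (2 * α)` of `lambda0`.
    have hSl : S ≤ MNLRanking.lambda0 d₁ d₂ k α := by
      rw [hl₀]
      exact le_mul_of_one_le_left hS0.le (one_le_pow₀ (Real.one_le_exp hα0))
    rw [MNLRanking.rowsLevel_eq d₁ d₂ hb ha hkR hP.le] at hω1
    refine MNLRanking.frobNorm_sq_le_of_gradient_of_curvature hkN hrow hα (hS0.trans_le hSl)
      (by linarith) hlam.1 hlam.2 (by positivity) ?_ hM hω1 (fun D hD => ?_) hΘh r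
    · calc 16 * ((k : ℝ) * d₁) * S ≤ 16 * ((k : ℝ) * d₁) * MNLRanking.lambda0 d₁ d₂ k α := by
            gcongr
        _ = _ := by ring
    · obtain ⟨K, hK, hKle⟩ := hω2 D hD
      exact ⟨K, hK, hKle⟩
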